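/- **Theorem 4.9.** Let $B=B(0,1)\subset\mathbb R^2$, and for $\delta>0$ let $\Omega_\delta=\{x\in B: d(x,\partial B)\le\delta\}$. For $K\ge 1$ let $M_K(B)$ be the set of $\sigma\in L^\infty(B;\mathbb R^{2\times 2})$ with $\frac1K|\xi|^2\le\sigma(x)\xi\cdot\xi\le K|\xi|^2$ for a.e. $x\in B$ and all $\xi\in\mathbb R^2$. Let $\lambda(K)=\inf\{\frac1K\int_B|\nabla u|^2: u\in H^1_0(B),\ \int_B|u|^2=1\}$ and write $L_\sigma=-\nabla\cdot(\sigma\nabla\,\cdot\,)$. A sequence $\sigma_n\in M_K(B)$ *$G$-converges* to $\sigma\in M_K(B)$ if $(L_{\sigma_n}-\lambda)^{-1}f\rightharpoonup(L_\sigma-\lambda)^{-1}f$ weakly in $H^1_0(B)$ for all $f\in H^{-1}(B)$ and all real $\lambda<\lambda(K)$. For $s=\pm\frac12$, $H^s(\partial B)$ is the space of distributions $\varphi=\sum_{k\in\mathbb Z}\varphi_ke^{ik\theta}$ with $\|\varphi\|_{H^s}^2=|\varphi_0|^2+\sum_{k\ne0}|k|^{2s}|\varphi_k|^2<\infty$.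 For $\sigma\in M_K(B)$ the Dirichlet-to-Neumann map $\Lambda_\sigma:H^{1/2}(\partial B)\to H^{-1/2}(\partial B)$ is the bounded operator given by $\langle\Lambda_\sigma\varphi,\psi\rangle=\int_B\sigma\nabla u\cdot\overline{\nabla\tilde\psi}\,dx$, where $u\in H^1(B)$ solves $\nabla\cdot(\sigma\nabla u)=0$ in $B$, $u|_{\partial B}=\varphi$, and $\tilde\psi\in H^1(B)$ is any extension of $\psi$; here $\langle g,\psi\rangle=\int_0^{2\pi}g\,\overline\psi\,d\theta=2\pi\sum_kg_k\overline{\psi_k}$. Then for every $\alpha>0$ there are $\sigma_n\in M_{1+\alpha}(B)$ and $\delta_n>0$ with $\delta_n\to0$ such that $\sigma_n=I$ on $\Omega_{\delta_n}$ for all $n$, $\sigma_n$ $G$-converges to $I$, and nevertheless $$\limsup_{n\to\infty}\|\Lambda_{\sigma_n}-\Lambda_I\|_{H^{1/2}(\partial B)\to H^{-1/2}(\partial B)}>\frac{\alpha}{16(2+\alpha)}.$$ Moreover, the $\sigma_n$ can be chosen isotropic, radial and piecewise constant, of the form $\sigma_n=(1+\alpha\chi_{B(0,R_n)\setminus B(0,R_n^2)})I$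 with $0<R_n<1$ and $R_n\to1$. -/

import Mathlib

open MeasureTheory Filter Topology
open scoped ContDiff ENNReal Matrix

/-! ### The plane, Sobolev spaces on a domain -/

/-- The Euclidean plane. -/
abbrev Plane : Type := EuclideanSpace ℝ (Fin 2)

/-- The standard basis vectors of the plane. -/
noncomputable def planeBasis (i : Fin 2) : Plane := EuclideanSpace.single i (1 : ℝ)

/-- Real-valued test functions on the open set `Ω`: smooth, with compact support inside `Ω`. -/
structure IsTestFunction (Ω : Set Plane) (φ : Plane → ℝ) : Prop where
  smooth : ContDiff ℝ ∞ φ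
  compact : HasCompactSupport φ
  subset : tsupport φ ⊆ Ω

/-- Pairs (complex function, complex vector field) of class `L²(Ω)`, with the Hilbert norm
`(‖u‖² + ‖g‖²)^{1/2}`. -/
abbrev L2Pair (Ω : Set Plane) : Type :=
  WithLp 2 (Lp ℂ 2 (volume.restrict Ω) × Lp (EuclideanSpace ℂ (Fin 2)) 2 (volume.restrict Ω))

/-- `g` is the weak gradient of `u` in `Ω`: `∫_Ω u ∂ᵢφ = - ∫_Ω gᵢ φ` for all test functions. -/
def IsWeakGradient (Ω : Set Plane) (u : Plane → ℂ) (g : Plane → EuclideanSpace ℂ (Fin 2)) :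
    Prop :=
  ∀ φ : Plane → ℝ, IsTestFunction Ω φ → ∀ i : Fin 2,
    ∫ x in Ω, ((fderiv ℝ φ x (planeBasis i) : ℝ) : ℂ) * u x =
      - ∫ x in Ω, (φ x : ℂ) * g x i

theorem integrable_test_mul {Ω : Set Plane} {ψ : Plane → ℝ} (hc : Continuous ψ)
    (hs : HasCompactSupport ψ) {u : Plane → ℂ} (hu : MemLp u 2 (volume.restrict Ω)) :
    Integrable (fun x => (ψ x : ℂ) * u x) (volume.restrict Ω) := by
  have h1 : MemLp (fun x => (ψ x : ℂ)) 2 (volume.restrict Ω) :=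
    Continuous.memLp_of_hasCompactSupport (Complex.continuous_ofReal.comp hc)
      (hs.comp_left (g := fun r : ℝ => (r : ℂ)) Complex.ofReal_zero)
  exact h1.integrable_mul hu

theorem memLp_coord {μ : Measure Plane} (g : Lp (EuclideanSpace ℂ (Fin 2)) 2 μ) (i : Fin 2) :
    MemLp (fun x => g x i) 2 μ :=
  (EuclideanSpace.proj (𝕜 := ℂ) i).comp_memLp' (Lp.memLp g)

theorem IsTestFunction.continuous_fderiv {Ω : Set Plane} {φ : Plane → ℝ}
    (h : IsTestFunction Ω φ) (i : Fin 2) :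
    Continuous (fun x => fderiv ℝ φ x (planeBasis i)) :=
  (h.smooth.continuous_fderiv (by simp)).clm_apply continuous_const

theorem IsTestFunction.compact_fderiv {Ω : Set Plane} {φ : Plane → ℝ}
    (h : IsTestFunction Ω φ) (i : Fin 2) :
    HasCompactSupport (fun x => fderiv ℝ φ x (planeBasis i)) :=
  h.compact.fderiv_apply (𝕜 := ℝ) (planeBasis i)

/-- The Sobolev space `H¹(Ω) = H¹(Ω; ℂ)`: its elements are the pairs `(u, ∇u)` with `u ∈ L²(Ω)`
and weak gradient `∇u ∈ L²(Ω)`; the norm is `(‖u‖² + ‖∇u‖²)^{1/2}`. -/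
noncomputable def sobolevH1 (Ω : Set Plane) : Submodule ℂ (L2Pair Ω) where
  carrier := {w | IsWeakGradient Ω w.fst w.snd}
  zero_mem' := by
    intro φ hφ i
    have e1 := Lp.coeFn_zero ℂ 2 (volume.restrict Ω)
    have e2 := Lp.coeFn_zero (EuclideanSpace ℂ (Fin 2)) 2 (volume.restrict Ω)
    have a1 : ∫ x in Ω, ((fderiv ℝ φ x (planeBasis i) : ℝ) : ℂ) *
        (0 : L2Pair Ω).fst x = 0 := by
      apply integral_eq_zero_of_ae
      filter_upwards [e1] with x hx
      rw [WithLp.zero_fst, hx]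
      simp
    have a2 : ∫ x in Ω, (φ x : ℂ) * (0 : L2Pair Ω).snd x i = 0 := by
      apply integral_eq_zero_of_ae
      filter_upwards [e2] with x hx
      rw [WithLp.zero_snd, hx]
      simp
    rw [a1, a2, neg_zero]
  add_mem' := by
    intro a b ha hb φ hφ i
    have e1 := Lp.coeFn_add a.fst b.fst
    have e2 := Lp.coeFn_add a.snd b.snd
    have a1 : ∫ x in Ω, ((fderiv ℝ φ x (planeBasis i) : ℝ) : ℂ) * (a + b).fst x =
        (∫ x in Ω, ((fderiv ℝ φ x (planeBasis i) : ℝ) : ℂ) * a.fst x) +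
        ∫ x in Ω, ((fderiv ℝ φ x (planeBasis i) : ℝ) : ℂ) * b.fst x := by
      rw [← integral_add
        (integrable_test_mul (hφ.continuous_fderiv i) (hφ.compact_fderiv i) (Lp.memLp a.fst))
        (integrable_test_mul (hφ.continuous_fderiv i) (hφ.compact_fderiv i) (Lp.memLp b.fst))]
      apply integral_congr_ae
      filter_upwards [e1] with x hx
      rw [WithLp.add_fst, hx, Pi.add_apply, mul_add]
    have a2 : ∫ x in Ω, (φ x : ℂ) * (a + b).snd x i =
        (∫ x in Ω, (φ x : ℂ) * a.snd x i) + ∫ x in Ω, (φ x : ℂ) * b.snd x i := by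
      rw [← integral_add
        (integrable_test_mul hφ.smooth.continuous hφ.compact (memLp_coord a.snd i))
        (integrable_test_mul hφ.smooth.continuous hφ.compact (memLp_coord b.snd i))]
      apply integral_congr_ae
      filter_upwards [e2] with x hx
      rw [WithLp.add_snd, hx, Pi.add_apply, PiLp.add_apply, mul_add]
    rw [a1, a2, ha φ hφ i, hb φ hφ i]
    ring
  smul_mem' := by
    intro c a ha φ hφ i
    have e1 := Lp.coeFn_smul c a.fst
    have e2 := Lp.coeFn_smul c a.snd
    have a1 : ∫ x in Ω, ((fderiv ℝ φ x (planeBasis i) : ℝ) : ℂ) * (c • a).fst x =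
        c * ∫ x in Ω, ((fderiv ℝ φ x (planeBasis i) : ℝ) : ℂ) * a.fst x := by
      rw [← integral_const_mul]
      apply integral_congr_ae
      filter_upwards [e1] with x hx
      rw [WithLp.smul_fst, hx, Pi.smul_apply, smul_eq_mul]
      ring
    have a2 : ∫ x in Ω, (φ x : ℂ) * (c • a).snd x i =
        c * ∫ x in Ω, (φ x : ℂ) * a.snd x i := by
      rw [← integral_const_mul]
      apply integral_congr_ae
      filter_upwards [e2] with x hx
      rw [WithLp.smul_snd, hx, Pi.smul_apply, PiLp.smul_apply, smul_eq_mul]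
      ring
    rw [a1, a2, ha φ hφ i]
    ring

/-- The function underlying an element of `H¹(Ω)`. -/
noncomputable def sobolevFun {Ω : Set Plane} (u : sobolevH1 Ω) : Lp ℂ 2 (volume.restrict Ω) :=
  (u : L2Pair Ω).fst

/-- The weak gradient of an element of `H¹(Ω)`. -/
noncomputable def sobolevGrad {Ω : Set Plane} (u : sobolevH1 Ω) :
    Lp (EuclideanSpace ℂ (Fin 2)) 2 (volume.restrict Ω) :=
  (u : L2Pair Ω).snd

/-- `H¹₀(Ω)`: the closure in `H¹(Ω)` of the smooth complex functions with compact support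
in `Ω`. -/
noncomputable def sobolevH10 (Ω : Set Plane) : Submodule ℂ (sobolevH1 Ω) :=
  (Submodule.span ℂ {w : sobolevH1 Ω | ∃ φ : Plane → ℂ, ContDiff ℝ ∞ φ ∧ HasCompactSupport φ ∧
    tsupport φ ⊆ Ω ∧ sobolevFun w =ᵐ[volume.restrict Ω] φ}).topologicalClosure

/-! ### Conductivities and G-convergence -/

/-- A conductivity: a field of real `2 × 2` matrices. -/
abbrev Conductivity : Type := Plane → Matrix (Fin 2) (Fin 2) ℝ

/-- The class `M_K(Ω)`: matrix fields in `L^∞(Ω)` with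
`K⁻¹|ξ|² ≤ σ(x)ξ·ξ ≤ K|ξ|²` for almost every `x ∈ Ω` and all `ξ`. -/
structure IsElliptic (K : ℝ) (Ω : Set Plane) (σ : Conductivity) : Prop where
  memLp_top : ∀ i j, MemLp (fun x => σ x i j) ⊤ (volume.restrict Ω)
  bounds : ∀ᵐ x ∂(volume.restrict Ω), ∀ ξ : Fin 2 → ℝ,
    K⁻¹ * (ξ ⬝ᵥ ξ) ≤ (σ x *ᵥ ξ) ⬝ᵥ ξ ∧ (σ x *ᵥ ξ) ⬝ᵥ ξ ≤ K * (ξ ⬝ᵥ ξ)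

/-- The energy form `∫_Ω σ∇u · conj(∇v)`. -/
noncomputable def energyForm {Ω : Set Plane} (σ : Conductivity) (u v : sobolevH1 Ω) : ℂ :=
  ∫ x in Ω, ∑ i : Fin 2, ∑ j : Fin 2,
    (σ x i j : ℂ) * sobolevGrad u x j * (starRingEnd ℂ) (sobolevGrad v x i)

/-- `u ∈ H¹₀(Ω)` is a weak solution of `-∇·(σ∇u) - λu = f`, where `f ∈ H⁻¹(Ω)` is a bounded
antilinear functional on `H¹₀(Ω)`; here `inner ℂ v u = ∫_Ω u · conj v`. -/
def IsResolventSolution {Ω : Set Plane} (σ : Conductivity) (lam : ℝ)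
    (f : sobolevH10 Ω →L⋆[ℂ] ℂ) (u : sobolevH10 Ω) : Prop :=
  ∀ v : sobolevH10 Ω,
    energyForm σ (u : sobolevH1 Ω) (v : sobolevH1 Ω)
      - (lam : ℂ) * inner ℂ (sobolevFun (v : sobolevH1 Ω)) (sobolevFun (u : sobolevH1 Ω)) = f v

/-- `λ(K)`, the optimal common lower bound of the Dirichlet spectra of the operators
`-∇·(σ∇·)`, `σ ∈ M_K(Ω)`: it is `K⁻¹` times the first Dirichlet eigenvalue of `-Δ`, that is, the
infimum of `K⁻¹ ∫_Ω |∇u|²` over `u ∈ H¹₀(Ω)` with `∫_Ω |u|² = 1`.  For bounded `Ω` it is positive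
by Poincaré's inequality. -/
noncomputable def spectralBound (K : ℝ) (Ω : Set Plane) : ℝ :=
  sInf {r : ℝ | ∃ u : sobolevH10 Ω, ‖sobolevFun (u : sobolevH1 Ω)‖ = 1 ∧
    r = K⁻¹ * ‖sobolevGrad (u : sobolevH1 Ω)‖ ^ 2}

/-- G-convergence in `M_K(Ω)`: for all `λ < λ(K)` and all `f ∈ H⁻¹(Ω)`, the resolvents
`u_n = (L_{σ_n} - λ)⁻¹ f` and `u = (L_σ - λ)⁻¹ f` exist (as unique weak solutions in `H¹₀(Ω)`),
and `u_n → u` weakly in `H¹₀(Ω)`. -/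
def GConverges (K : ℝ) (Ω : Set Plane) (σ : ℕ → Conductivity) (σlim : Conductivity) : Prop :=
  ∀ lam : ℝ, lam < spectralBound K Ω → ∀ f : sobolevH10 Ω →L⋆[ℂ] ℂ,
    ∃ (u : ℕ → sobolevH10 Ω) (ulim : sobolevH10 Ω),
      (∀ n w, IsResolventSolution (σ n) lam f w ↔ w = u n) ∧
      (∀ w, IsResolventSolution σlim lam f w ↔ w = ulim) ∧
      ∀ ℓ : StrongDual ℂ (sobolevH10 Ω), Tendsto (fun n => ℓ (u n)) atTop (𝓝 (ℓ ulim))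

/-! ### Sobolev spaces on the unit circle -/

/-- Fourier weights: `1` for `k = 0` and `|k|^s` for `k ≠ 0`. -/
noncomputable def fourierWeight (s : ℝ) (k : ℤ) : ℝ := if k = 0 then 1 else |(k : ℝ)| ^ s

theorem fourierWeight_pos (s : ℝ) (k : ℤ) : 0 < fourierWeight s k := by
  unfold fourierWeight
  split_ifs with h
  · exact one_pos
  · exact Real.rpow_pos_of_pos (abs_pos.mpr (Int.cast_ne_zero.mpr h)) s

/-- Coefficient sequences `c` with `|c_0|² + ∑_{k ≠ 0} |k|^{2s} |c_k|² < ∞`. -/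
noncomputable def circleSobolevSubmodule (s : ℝ) : Submodule ℂ (ℤ → ℂ) where
  carrier := {c | Memℓp (fun k => (fourierWeight s k : ℂ) * c k) 2}
  zero_mem' := by
    have h : (fun k => (fourierWeight s k : ℂ) * (0 : ℤ → ℂ) k) = 0 := by
      funext k; simp
    change Memℓp (fun k => (fourierWeight s k : ℂ) * (0 : ℤ → ℂ) k) 2
    rw [h]
    exact zero_memℓp
  add_mem' := by
    intro a b ha hb
    have h : (fun k => (fourierWeight s k : ℂ) * (a + b) k) =
        (fun k => (fourierWeight s k : ℂ) * a k) + fun k => (fourierWeight s k : ℂ) * b k := by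
      funext k; simp [mul_add]
    change Memℓp (fun k => (fourierWeight s k : ℂ) * (a + b) k) 2
    rw [h]
    exact Memℓp.add ha hb
  smul_mem' := by
    intro c a ha
    have h : (fun k => (fourierWeight s k : ℂ) * (c • a) k) =
        c • fun k => (fourierWeight s k : ℂ) * a k := by
      funext k; simp [mul_left_comm]
    change Memℓp (fun k => (fourierWeight s k : ℂ) * (c • a) k) 2
    rw [h]
    exact Memℓp.const_smul ha c

/-- `H^s(∂B(0,1))`: the periodic distributions `∑ c_k e^{ikθ}` with
`|c_0|² + ∑_{k ≠ 0} |k|^{2s} |c_k|² < ∞`, recorded by their Fourier coefficients `c_k`. -/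
def CircleSobolev (s : ℝ) : Type := circleSobolevSubmodule s

noncomputable instance (s : ℝ) : AddCommGroup (CircleSobolev s) :=
  inferInstanceAs (AddCommGroup (circleSobolevSubmodule s))

noncomputable instance (s : ℝ) : Module ℂ (CircleSobolev s) :=
  inferInstanceAs (Module ℂ (circleSobolevSubmodule s))

/-- The `k`-th Fourier coefficient. -/
def circleCoeff {s : ℝ} (c : CircleSobolev s) (k : ℤ) : ℂ := c.1 k

/-- The linear map `c ↦ (w_k c_k)_k` into `ℓ²(ℤ)`. -/
noncomputable def circleSobolevToLp (s : ℝ) : CircleSobolev s →ₗ[ℂ] lp (fun _ : ℤ => ℂ) 2 where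
  toFun c := ⟨fun k => (fourierWeight s k : ℂ) * circleCoeff c k, c.2⟩
  map_add' a b := by
    ext k
    exact mul_add _ _ _
  map_smul' r a := by
    ext k
    exact mul_left_comm _ _ _

theorem circleSobolevToLp_injective (s : ℝ) : Function.Injective (circleSobolevToLp s) := by
  intro a b h
  apply Subtype.ext
  funext k
  have h1 : (fourierWeight s k : ℂ) * circleCoeff a k = (fourierWeight s k : ℂ) * circleCoeff b k :=
    congrFun (congrArg Subtype.val h) k
  exact mul_left_cancel₀ (Complex.ofReal_ne_zero.mpr (fourierWeight_pos s k).ne') h1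

noncomputable instance (s : ℝ) : NormedAddCommGroup (CircleSobolev s) :=
  NormedAddCommGroup.induced (CircleSobolev s) (lp (fun _ : ℤ => ℂ) 2) (circleSobolevToLp s)
    (circleSobolevToLp_injective s)

noncomputable instance (s : ℝ) : NormedSpace ℂ (CircleSobolev s) :=
  NormedSpace.induced ℂ (CircleSobolev s) (lp (fun _ : ℤ => ℂ) 2) (circleSobolevToLp s)

/-- The norm of `H^s` of the circle is `‖c‖² = |c_0|² + ∑_{k ≠ 0} |k|^{2s} |c_k|²`. -/
theorem circleSobolev_norm_sq {s : ℝ} (c : CircleSobolev s) :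
    HasSum (fun k : ℤ => fourierWeight s k ^ 2 * ‖circleCoeff c k‖ ^ 2) (‖c‖ ^ 2) := by
  have h := lp.hasSum_norm (p := 2) (by norm_num) (circleSobolevToLp s c)
  have e : ‖c‖ = ‖circleSobolevToLp s c‖ := rfl
  rw [e]
  convert h using 1
  · funext k
    have e2 : (circleSobolevToLp s c) k = (fourierWeight s k : ℂ) * circleCoeff c k := rfl
    rw [e2]
    simp [mul_pow]
  · simp

/-! ### The Dirichlet-to-Neumann map of the unit disc -/

/-- The open unit disc `B(0,1)`. -/
abbrev unitDisc : Set Plane := Metric.ball 0 1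

/-- The `k`-th Fourier coefficient `(1/2π) ∫₀^{2π} v(cos θ, sin θ) e^{-ikθ} dθ` of the restriction
of `v` to the unit circle. -/
noncomputable def boundaryCoeff (v : Plane → ℂ) (k : ℤ) : ℂ :=
  (2 * (Real.pi : ℂ))⁻¹ * ∫ θ in (0 : ℝ)..(2 * Real.pi),
    v (!₂[Real.cos θ, Real.sin θ]) * Complex.exp (-(Complex.I * (k : ℂ) * (θ : ℂ)))

/-- `u ∈ H¹(B(0,1))` has boundary trace with Fourier coefficients `c`: the trace is the continuous
extension of the restriction map `v ↦ v|_∂B` from functions smooth up to the boundary, i.e. some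
smooth `v_j` converge to `u` in `H¹(B(0,1))` while `v_j|_∂B → ∑ c_k e^{ikθ}` as distributions on
the circle. -/
def HasTrace (u : sobolevH1 unitDisc) (c : ℤ → ℂ) : Prop :=
  ∃ (w : ℕ → sobolevH1 unitDisc) (v : ℕ → Plane → ℂ),
    (∀ j, ContDiff ℝ ∞ (v j)) ∧
    (∀ j, sobolevFun (w j) =ᵐ[volume.restrict unitDisc] v j) ∧
    Tendsto w atTop (𝓝 u) ∧
    ∀ k : ℤ, Tendsto (fun j => boundaryCoeff (v j) k) atTop (𝓝 (c k))

/-- `u ∈ H¹(B(0,1))` solves `∇·(σ∇u) = 0` weakly in the disc, with `u = φ` on the boundary. -/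
def IsDirichletSolution (σ : Conductivity) (φ : CircleSobolev (1 / 2))
    (u : sobolevH1 unitDisc) : Prop :=
  HasTrace u (circleCoeff φ) ∧
    ∀ v : sobolevH10 unitDisc, energyForm σ u (v : sobolevH1 unitDisc) = 0

/-- `Λ` is the Dirichlet-to-Neumann map `H^{1/2} → H^{-1/2}` of `σ` on the unit disc: for every
`φ`, `⟨Λφ, ψ⟩ = ∫ σ∇u · conj(∇v)`, where `u` solves the Dirichlet problem with data `φ` and `v`
is any `H¹` extension of `ψ`.  The boundary pairing is `∫₀^{2π} (Λφ) conj ψ dθ`, which in terms of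
Fourier coefficients is `2π ∑ (Λφ)_k conj ψ_k`. -/
def IsDirichletToNeumann (σ : Conductivity)
    (Λ : CircleSobolev (1 / 2) →L[ℂ] CircleSobolev (-(1 / 2))) : Prop :=
  ∀ φ : CircleSobolev (1 / 2), ∃ u : sobolevH1 unitDisc, IsDirichletSolution σ φ u ∧
    ∀ (ψ : CircleSobolev (1 / 2)) (v : sobolevH1 unitDisc), HasTrace v (circleCoeff ψ) →
      HasSum (fun k : ℤ => 2 * (Real.pi : ℂ) *
        (circleCoeff (Λ φ) k * (starRingEnd ℂ) (circleCoeff ψ k))) (energyForm σ u v)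

/-! ### Annular conductivities and boundary layers -/

/-- The boundary layer `Ω_δ = {x ∈ Ω : d(x, ∂Ω) ≤ δ}`. -/
def boundaryLayer (Ω : Set Plane) (δ : ℝ) : Set Plane :=
  {x ∈ Ω | Metric.infDist x (frontier Ω) ≤ δ}

open Classical in
/-- The radial, piecewise constant, isotropic conductivity equal to `(1 + α) I` on the annulus
`B(0,R) \ B(0,R²)` and to `I` elsewhere. -/
noncomputable def annularConductivity (α R : ℝ) : Conductivity := fun x =>
  (if x ∈ Metric.ball (0 : Plane) R \ Metric.ball (0 : Plane) (R ^ 2) then 1 + α else 1) •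
    (1 : Matrix (Fin 2) (Fin 2) ℝ)

/-! ### Dominated convergence in `L²` -/

/-! A radial conductivity is diagonalised by Fourier modes. For the value `1 + α` on the annulus `R²
≤ |x| < R`, separation of variables gives the Dirichlet-to-Neumann eigenvalue `|k| (1 + α(2+α)
t(1-t) / N(t))`, where `t = R^(2|k|)` and `N = transmissionDenom α` (see `dnEigen`). Its relative
deviation from `|k|`, the eigenvalue of `Λ_I`, depends on `R` and `k` only through `t`. Hence it
need not shrink as `R → 1`: if `R` and the frequency `k` are tied by `t = 1/2`, the deviation is the
same at every stage. Testing the difference of the two maps on `e^{ikθ}`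
(`le_norm_circleMultiplier_sub`) bounds its norm below by `α(2+α) / (4 N(1/2))`, which exceeds `α /
(16(2+α))`.

The same annuli are invisible to `G`-convergence. They move out to the circle, so the coefficients
are bounded and tend to `I` pointwise in the disc, and multiplication by them converges strongly on
`L²` (`tendsto_annularMul`). Uniform coercivity on `H¹₀` below the spectral bound turns this into
norm convergence of the resolvents (`exists_tendsto_solutions`, `gConverges_annular`).

Most of the work identifies the Dirichlet-to-Neumann map in the weak setting. The solution with
boundary value `e^{ikθ}` is a harmonic monomial plus two continuous modes with a kink, one on each
interface (`exists_kinkMode`). Kink modes are `H¹` limits of smooth functions, which also yields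
their traces. Green's formula for `z^m` (`green_annulus`) turns the energy against a smooth `v` into
moments of `v` on the circles of radius `R²`, `R` and `1`. The coefficients solve the flux
conditions, so the two inner moments cancel (`transmission_balance`). What remains is `2π λ_k
conj(v_k)`, with `λ_k` the eigenvalue and `v_k` the boundary coefficient. By density this holds for
all `v` with a trace, so one identity contains both the weak equation and the Dirichlet-to-Neumann
formula (`exists_dnMode`). General boundary data follow by superposition (`summable_modes`,
`isDirichletToNeumann_of_modes`). -/

theorem tendsto_eLpNorm_two_zero_of_dominated {X E : Type*} [MeasurableSpace X] {μ : Measure X}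
    [NormedAddCommGroup E] {h : ℕ → X → E} {b : X → ℝ}
    (hm : ∀ j, AEStronglyMeasurable (h j) μ) (hb : MemLp b 2 μ)
    (hle : ∀ j, ∀ᵐ x ∂μ, ‖h j x‖ ≤ b x)
    (hlim : ∀ᵐ x ∂μ, Tendsto (fun j => h j x) atTop (𝓝 0)) :
    Tendsto (fun j => eLpNorm (h j) 2 μ) atTop (𝓝 0) := by
  have key : Tendsto (fun j => ∫⁻ x, ‖h j x‖ₑ ^ (2 : ℝ) ∂μ) atTop (𝓝 (∫⁻ _, 0 ∂μ)) := by
    refine tendsto_lintegral_of_dominated_convergence' (fun x => ‖b x‖ₑ ^ (2 : ℝ))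
      (fun j => (hm j).enorm.pow_const _) ?_ ?_ ?_
    · intro j
      filter_upwards [hle j] with x hx
      refine ENNReal.rpow_le_rpow ?_ (by norm_num)
      rw [← ofReal_norm, ← ofReal_norm]
      exact ENNReal.ofReal_le_ofReal (hx.trans (le_abs_self _))
    · have := hb.2
      rw [eLpNorm_lt_top_iff_lintegral_rpow_enorm_lt_top (by norm_num) (by norm_num)] at this
      simpa using this.ne
    · filter_upwards [hlim] with x hx
      have h1 : Tendsto (fun j => ‖h j x‖ₑ) atTop (𝓝 0) := by simpa using hx.enorm
      have h2 := (ENNReal.continuous_rpow_const (y := 2)).tendsto 0 |>.comp h1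
      simpa [Function.comp_def] using h2
  have h3 := (ENNReal.continuous_rpow_const (y := 1 / 2)).tendsto (∫⁻ _, 0 ∂μ) |>.comp key
  simp only [lintegral_zero, one_div] at h3
  rw [ENNReal.zero_rpow_of_pos (by norm_num)] at h3
  refine h3.congr fun j => ?_
  rw [eLpNorm_eq_lintegral_rpow_enorm_toReal (by norm_num) (by norm_num)]
  simp

theorem tendsto_toLp_of_dominated {X E : Type*} [MeasurableSpace X] {μ : Measure X}
    [NormedAddCommGroup E] {h : ℕ → X → E} {g : X → E} {b : X → ℝ}
    (hm : ∀ j, MemLp (h j) 2 μ) (hg : MemLp g 2 μ) (hb : MemLp b 2 μ)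
    (hle : ∀ j, ∀ᵐ x ∂μ, ‖h j x‖ ≤ b x)
    (hlim : ∀ᵐ x ∂μ, Tendsto (fun j => h j x) atTop (𝓝 (g x))) :
    Tendsto (fun j => (hm j).toLp (h j)) atTop (𝓝 (hg.toLp g)) := by
  rw [Lp.tendsto_Lp_iff_tendsto_eLpNorm'']
  have hgb : ∀ᵐ x ∂μ, ‖g x‖ ≤ b x := by
    filter_upwards [hlim, ae_all_iff.2 hle] with x hx hx2
    exact le_of_tendsto hx.norm (Eventually.of_forall hx2)
  refine tendsto_eLpNorm_two_zero_of_dominated (b := fun x => b x + b x)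
    (fun j => ((hm j).sub hg).1) (hb.add hb) ?_ ?_
  · intro j
    filter_upwards [hle j, hgb] with x h1 h2
    exact (norm_sub_le _ _).trans (add_le_add h1 h2)
  · filter_upwards [hlim] with x hx
    simpa using hx.sub_const (g x)

/-! ### The Hilbert space `H¹` -/

/-- The function part of `H¹(Ω)` as a continuous linear map. -/
noncomputable def sobolevFunL (Ω : Set Plane) :
    sobolevH1 Ω →L[ℂ] Lp ℂ 2 (volume.restrict Ω) :=
  (WithLp.fstL 2 ℂ _ _).comp (sobolevH1 Ω).subtypeL

/-- The gradient part of `H¹(Ω)` as a continuous linear map. -/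
noncomputable def sobolevGradL (Ω : Set Plane) :
    sobolevH1 Ω →L[ℂ] Lp (EuclideanSpace ℂ (Fin 2)) 2 (volume.restrict Ω) :=
  (WithLp.sndL 2 ℂ _ _).comp (sobolevH1 Ω).subtypeL

theorem sobolevFunL_apply {Ω : Set Plane} (u : sobolevH1 Ω) : sobolevFunL Ω u = sobolevFun u := rfl

theorem sobolevH1_norm_sq {Ω : Set Plane} (u : sobolevH1 Ω) :
    ‖u‖ ^ 2 = ‖sobolevFun u‖ ^ 2 + ‖sobolevGrad u‖ ^ 2 :=
  WithLp.prod_norm_sq_eq_of_L2 (u : L2Pair Ω)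

theorem sobolevH1_norm_le {Ω : Set Plane} (u : sobolevH1 Ω) :
    ‖u‖ ≤ ‖sobolevFun u‖ + ‖sobolevGrad u‖ := by
  refine abs_le_of_sq_le_sq' ?_ (by positivity) |>.2
  rw [sobolevH1_norm_sq]
  nlinarith [norm_nonneg (sobolevFun u), norm_nonneg (sobolevGrad u)]

theorem continuous_integral_test_mul {Ω : Set Plane} {ψ : Plane → ℝ} (hc : Continuous ψ)
    (hs : HasCompactSupport ψ) :
    Continuous fun u : Lp ℂ 2 (volume.restrict Ω) => ∫ x in Ω, (ψ x : ℂ) * u x := by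
  have h1 : MemLp (fun x => (ψ x : ℂ)) 2 (volume.restrict Ω) :=
    Continuous.memLp_of_hasCompactSupport (Complex.continuous_ofReal.comp hc)
      (hs.comp_left (g := fun r : ℝ => (r : ℂ)) Complex.ofReal_zero)
  have : (fun u : Lp ℂ 2 (volume.restrict Ω) => ∫ x in Ω, (ψ x : ℂ) * u x) =
      fun u => inner ℂ (h1.toLp _) u := by
    funext u
    rw [L2.inner_def]
    refine integral_congr_ae ?_
    filter_upwards [h1.coeFn_toLp] with x hx
    rw [hx]
    simp [mul_comm]
  rw [this]
  exact continuous_const.inner continuous_id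

/-- The `i`-th coordinate of an `L²` vector field. -/
noncomputable def lpCoord (μ : Measure Plane) (i : Fin 2) :
    Lp (EuclideanSpace ℂ (Fin 2)) 2 μ →L[ℂ] Lp ℂ 2 μ :=
  (EuclideanSpace.proj (𝕜 := ℂ) i).compLpL 2 μ

theorem lpCoord_ae {μ : Measure Plane} (i : Fin 2) (g : Lp (EuclideanSpace ℂ (Fin 2)) 2 μ) :
    lpCoord μ i g =ᵐ[μ] fun x => g x i :=
  (EuclideanSpace.proj (𝕜 := ℂ) i).coeFn_compLpL g

/-- Each test function imposes an `L²`-continuous condition, so `H¹` is an intersection of closed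
sets. This gives the completeness behind the Riesz representation and the limits of smooth functions
below. -/
theorem isClosed_sobolevH1 (Ω : Set Plane) : IsClosed (sobolevH1 Ω : Set (L2Pair Ω)) := by
  have : (sobolevH1 Ω : Set (L2Pair Ω)) = ⋂ (φ : Plane → ℝ) (_ : IsTestFunction Ω φ) (i : Fin 2),
      {w : L2Pair Ω | ∫ x in Ω, ((fderiv ℝ φ x (planeBasis i) : ℝ) : ℂ) * w.fst x =
        - ∫ x in Ω, (φ x : ℂ) * lpCoord _ i w.snd x} := by
    ext w
    simp only [Set.mem_iInter, Set.mem_ofPred_eq]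
    refine forall_congr' fun φ => forall_congr' fun hφ => forall_congr' fun i => ?_
    have : ∫ x in Ω, (φ x : ℂ) * lpCoord _ i w.snd x = ∫ x in Ω, (φ x : ℂ) * w.snd x i := by
      refine integral_congr_ae ?_
      filter_upwards [lpCoord_ae i w.snd] with x hx
      rw [hx]
    rw [this]
  rw [this]
  refine isClosed_iInter fun φ => isClosed_iInter fun hφ => isClosed_iInter fun i =>
    isClosed_eq ?_ ?_
  · exact (continuous_integral_test_mul (hφ.continuous_fderiv i) (hφ.compact_fderiv i)).comp
      (WithLp.fstL 2 ℂ _ _).continuous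
  · exact ((continuous_integral_test_mul hφ.smooth.continuous hφ.compact).comp
      ((lpCoord _ i).continuous.comp (WithLp.sndL 2 ℂ _ _).continuous)).neg

noncomputable instance (Ω : Set Plane) : CompleteSpace (sobolevH1 Ω) :=
  (isClosed_sobolevH1 Ω).completeSpace_coe

noncomputable instance (Ω : Set Plane) : CompleteSpace (sobolevH10 Ω) :=
  (Submodule.isClosed_topologicalClosure _).completeSpace_coe

/-- A difference with zero function part has a gradient that integrates to zero against every test
function, hence vanishes almost everywhere. This is needed because `HasTrace` and `sobolevH10`
constrain only the function part. -/
theorem sobolevH1_ext_of_fun {Ω : Set Plane} (hΩ : IsOpen Ω) {u w : sobolevH1 Ω}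
    (h : sobolevFun u = sobolevFun w) : u = w := by
  have h0 : sobolevFun (u - w) = 0 := by
    rw [← sobolevFunL_apply, map_sub, sobolevFunL_apply, sobolevFunL_apply, h, sub_self]
  have hd : (u - w : L2Pair Ω) ∈ sobolevH1 Ω := (u - w).2
  set d : sobolevH1 Ω := u - w with hdef
  have hcoord : ∀ i, ∀ᵐ x ∂(volume.restrict Ω), sobolevGrad d x i = 0 := by
    intro i
    have hmem := memLp_coord (sobolevGrad d) i
    have hloc : LocallyIntegrableOn (fun x => sobolevGrad d x i) Ω volume := by
      rw [locallyIntegrableOn_iff hΩ.isLocallyClosed]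
      intro k hk hkc
      have h1 : MemLp (fun x => sobolevGrad d x i) 2 (volume.restrict k) :=
        hmem.mono_measure (Measure.restrict_mono hk le_rfl)
      have : IsFiniteMeasure (volume.restrict k) := ⟨by simpa using hkc.measure_lt_top⟩
      exact h1.integrable (by norm_num)
    have := hΩ.ae_eq_zero_of_integral_contDiff_smul_eq_zero hloc ?_
    · rw [ae_restrict_iff' hΩ.measurableSet]
      exact this
    intro g hg hgc hgs
    have hw := d.2 g ⟨hg, hgc, hgs⟩ i
    have hz : ∫ x in Ω, ((fderiv ℝ g x (planeBasis i) : ℝ) : ℂ) * (d : L2Pair Ω).fst x = 0 := by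
      refine integral_eq_zero_of_ae ?_
      have e : (d : L2Pair Ω).fst = 0 := h0
      rw [e]
      filter_upwards [Lp.coeFn_zero ℂ 2 (volume.restrict Ω)] with x hx
      rw [hx]
      simp
    rw [hz, zero_eq_neg] at hw
    rw [← setIntegral_eq_integral_of_forall_compl_eq_zero (s := Ω), ← hw]
    · refine integral_congr_ae (Eventually.of_forall fun x => ?_)
      simp only [Complex.real_smul]
      rfl
    · intro x hx
      rw [image_eq_zero_of_notMem_tsupport (fun h => hx (hgs h)), zero_smul]
  have hgrad : sobolevGrad d = 0 := by
    refine Lp.ext ?_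
    filter_upwards [hcoord 0, hcoord 1,
      Lp.coeFn_zero (EuclideanSpace ℂ (Fin 2)) 2 (volume.restrict Ω)] with x h0 h1 hz
    rw [hz]
    ext i
    fin_cases i
    · exact h0
    · exact h1
  have : ‖d‖ ^ 2 = 0 := by
    rw [sobolevH1_norm_sq, hgrad, h0]
    simp
  exact sub_eq_zero.1 (norm_eq_zero.1 (pow_eq_zero_iff (by norm_num) |>.1 this))

/-! ### Smooth functions as elements of `H¹` -/

/-- The classical gradient of a complex function on the plane. -/
noncomputable def classicalGrad (v : Plane → ℂ) (x : Plane) : EuclideanSpace ℂ (Fin 2) :=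
  WithLp.toLp 2 fun i => fderiv ℝ v x (planeBasis i)

theorem classicalGrad_apply (v : Plane → ℂ) (x : Plane) (i : Fin 2) :
    classicalGrad v x i = fderiv ℝ v x (planeBasis i) := rfl

theorem continuous_classicalGrad {v : Plane → ℂ} (hv : ContDiff ℝ ∞ v) :
    Continuous (classicalGrad v) := by
  refine (PiLp.continuous_toLp 2 _).comp (continuous_pi fun i => ?_)
  exact (hv.continuous_fderiv (by simp)).clm_apply continuous_const

theorem memLp_unitDisc_of_continuous {E : Type*} [NormedAddCommGroup E]
    {f : Plane → E} (hf : Continuous f) (p : ℝ≥0∞) : MemLp f p (volume.restrict unitDisc) := by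
  obtain ⟨C, hC⟩ := (isCompact_closedBall (0 : Plane) 1).exists_bound_of_continuousOn
    hf.continuousOn
  have : IsFiniteMeasure (volume.restrict unitDisc) :=
    ⟨by simp⟩
  refine MemLp.of_bound hf.aestronglyMeasurable C ?_
  filter_upwards [ae_restrict_mem Metric.isOpen_ball.measurableSet] with x hx
  exact hC x (Metric.ball_subset_closedBall hx)

/-- The test function is supported inside `Ω`, so the integration by parts takes place on the whole
plane and no regularity of `Ω` enters. -/
theorem isWeakGradient_classicalGrad {Ω : Set Plane} {v : Plane → ℂ}
    (hv : ContDiff ℝ ∞ v) : IsWeakGradient Ω v (classicalGrad v) := by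
  intro φ hφ i
  have hφ' : ContDiff ℝ ∞ (fun x => (φ x : ℂ)) := Complex.ofRealCLM.contDiff.comp hφ.smooth
  have hs' : HasCompactSupport (fun x => (φ x : ℂ)) :=
    hφ.compact.comp_left (g := fun r : ℝ => (r : ℂ)) Complex.ofReal_zero
  have hd : ∀ x, fderiv ℝ (fun x => (φ x : ℂ)) x (planeBasis i) =
      ((fderiv ℝ φ x (planeBasis i) : ℝ) : ℂ) := by
    intro x
    have := (Complex.ofRealCLM.hasFDerivAt (x := φ x)).comp x
      ((hφ.smooth.differentiable (by simp)) x).hasFDerivAt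
    have h2 : fderiv ℝ (fun x => (φ x : ℂ)) x = _ := this.fderiv
    rw [h2]
    rfl
  have c1 : Continuous fun x => fderiv ℝ (fun x => (φ x : ℂ)) x (planeBasis i) :=
    (hφ'.continuous_fderiv (by simp)).clm_apply continuous_const
  have c2 : Continuous fun x => fderiv ℝ v x (planeBasis i) :=
    (hv.continuous_fderiv (by simp)).clm_apply continuous_const
  have hs2 : HasCompactSupport fun x => fderiv ℝ (fun x => (φ x : ℂ)) x (planeBasis i) :=
    hs'.fderiv_apply (𝕜 := ℝ) _
  have key := integral_mul_fderiv_eq_neg_fderiv_mul_of_integrable (μ := volume)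
    (f := fun x => (φ x : ℂ)) (g := v) (v := planeBasis i)
    ((c1.mul hv.continuous).integrable_of_hasCompactSupport hs2.mul_right)
    ((hφ'.continuous.mul c2).integrable_of_hasCompactSupport hs'.mul_right)
    ((hφ'.continuous.mul hv.continuous).integrable_of_hasCompactSupport hs'.mul_right)
    (fun x _ => hφ'.differentiable (by simp) x) (fun x _ => hv.differentiable (by simp) x)
  have z : ∀ x, x ∉ Ω → φ x = 0 := fun x hx =>
    image_eq_zero_of_notMem_tsupport fun h => hx (hφ.subset h)
  have z' : ∀ x, x ∉ Ω → fderiv ℝ φ x = 0 := fun x hx =>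
    image_eq_zero_of_notMem_tsupport
      fun h => hx (hφ.subset (tsupport_fderiv_subset ℝ h))
  rw [setIntegral_eq_integral_of_forall_compl_eq_zero,
    setIntegral_eq_integral_of_forall_compl_eq_zero]
  · simp only [hd] at key
    simp only [classicalGrad_apply]
    rw [key, neg_neg]
  · intro x hx
    simp [z x hx]
  · intro x hx
    simp [z' x hx]

theorem IsWeakGradient.congr_ae {Ω : Set Plane} {u u' : Plane → ℂ}
    {g g' : Plane → EuclideanSpace ℂ (Fin 2)} (h : IsWeakGradient Ω u g)
    (hu : u =ᵐ[volume.restrict Ω] u') (hg : g =ᵐ[volume.restrict Ω] g') :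
    IsWeakGradient Ω u' g' := by
  intro φ hφ i
  have h1 : ∫ x in Ω, ((fderiv ℝ φ x (planeBasis i) : ℝ) : ℂ) * u' x =
      ∫ x in Ω, ((fderiv ℝ φ x (planeBasis i) : ℝ) : ℂ) * u x := by
    refine integral_congr_ae ?_
    filter_upwards [hu] with x hx
    rw [hx]
  have h2 : ∫ x in Ω, (φ x : ℂ) * g' x i = ∫ x in Ω, (φ x : ℂ) * g x i := by
    refine integral_congr_ae ?_
    filter_upwards [hg] with x hx
    rw [hx]
  rw [h1, h2]
  exact h φ hφ i

/-- A smooth function on the plane, restricted to the unit disc, as an element of `H¹`. -/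
noncomputable def smoothH1 (v : Plane → ℂ) (hv : ContDiff ℝ ∞ v) : sobolevH1 unitDisc :=
  ⟨WithLp.toLp 2 ((memLp_unitDisc_of_continuous hv.continuous 2).toLp v,
    (memLp_unitDisc_of_continuous (continuous_classicalGrad hv) 2).toLp (classicalGrad v)),
    (isWeakGradient_classicalGrad hv).congr_ae
      (memLp_unitDisc_of_continuous hv.continuous 2).coeFn_toLp.symm
      (memLp_unitDisc_of_continuous (continuous_classicalGrad hv) 2).coeFn_toLp.symm⟩

theorem sobolevFun_smoothH1 {v : Plane → ℂ} (hv : ContDiff ℝ ∞ v) :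
    sobolevFun (smoothH1 v hv) =ᵐ[volume.restrict unitDisc] v :=
  (memLp_unitDisc_of_continuous hv.continuous 2).coeFn_toLp

theorem sobolevGrad_smoothH1 {v : Plane → ℂ} (hv : ContDiff ℝ ∞ v) :
    sobolevGrad (smoothH1 v hv) =ᵐ[volume.restrict unitDisc] classicalGrad v :=
  (memLp_unitDisc_of_continuous (continuous_classicalGrad hv) 2).coeFn_toLp

theorem eq_smoothH1 {v : Plane → ℂ} (hv : ContDiff ℝ ∞ v) {w : sobolevH1 unitDisc}
    (h : sobolevFun w =ᵐ[volume.restrict unitDisc] v) : w = smoothH1 v hv :=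
  sobolevH1_ext_of_fun Metric.isOpen_ball
    (Lp.ext (h.trans (sobolevFun_smoothH1 hv).symm))

instance : IsFiniteMeasure (volume.restrict unitDisc) :=
  ⟨by simp⟩

/-- Bounded pointwise limits of smooth functions with bounded convergent gradients. -/
theorem exists_sobolevH1_limit {v : ℕ → Plane → ℂ} (hv : ∀ j, ContDiff ℝ ∞ (v j))
    {u : Plane → ℂ} {G : Plane → EuclideanSpace ℂ (Fin 2)} (C : ℝ)
    (hb : ∀ j, ∀ x ∈ unitDisc, ‖v j x‖ ≤ C)
    (hbg : ∀ j, ∀ x ∈ unitDisc, ‖classicalGrad (v j) x‖ ≤ C)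
    (hu : ∀ᵐ x ∂(volume.restrict unitDisc), Tendsto (fun j => v j x) atTop (𝓝 (u x)))
    (hG : ∀ᵐ x ∂(volume.restrict unitDisc),
      Tendsto (fun j => classicalGrad (v j) x) atTop (𝓝 (G x))) :
    ∃ U : sobolevH1 unitDisc, sobolevFun U =ᵐ[volume.restrict unitDisc] u ∧
      sobolevGrad U =ᵐ[volume.restrict unitDisc] G ∧
      Tendsto (fun j => smoothH1 (v j) (hv j)) atTop (𝓝 U) := by
  have hmem := ae_restrict_mem (μ := (volume : Measure Plane))
    (Metric.isOpen_ball (x := (0 : Plane)) (ε := 1)).measurableSet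
  have bae : ∀ᵐ x ∂(volume.restrict unitDisc), ‖u x‖ ≤ C := by
    filter_upwards [hu, hmem] with x hx hxm
    exact le_of_tendsto hx.norm (Eventually.of_forall fun j => hb j x hxm)
  have bgae : ∀ᵐ x ∂(volume.restrict unitDisc), ‖G x‖ ≤ C := by
    filter_upwards [hG, hmem] with x hx hxm
    exact le_of_tendsto hx.norm (Eventually.of_forall fun j => hbg j x hxm)
  have mu : MemLp u 2 (volume.restrict unitDisc) :=
    MemLp.of_bound (aestronglyMeasurable_of_tendsto_ae atTop
      (fun j => (hv j).continuous.aestronglyMeasurable) hu) C bae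
  have mG : MemLp G 2 (volume.restrict unitDisc) :=
    MemLp.of_bound (aestronglyMeasurable_of_tendsto_ae atTop
      (fun j => (continuous_classicalGrad (hv j)).aestronglyMeasurable) hG) C bgae
  have t1 := tendsto_toLp_of_dominated (b := fun _ => C)
    (fun j => memLp_unitDisc_of_continuous (hv j).continuous 2) mu (memLp_const C)
    (fun j => by filter_upwards [hmem] with x hx using hb j x hx) hu
  have t2 := tendsto_toLp_of_dominated (b := fun _ => C)
    (fun j => memLp_unitDisc_of_continuous (continuous_classicalGrad (hv j)) 2) mG (memLp_const C)
    (fun j => by filter_upwards [hmem] with x hx using hbg j x hx) hG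
  have t3 : Tendsto (fun j => ((smoothH1 (v j) (hv j) : sobolevH1 unitDisc) : L2Pair unitDisc))
      atTop (𝓝 (WithLp.toLp 2 (mu.toLp u, mG.toLp G))) := by
    have := ((WithLp.prod_continuous_toLp 2 _ _).tendsto _).comp (t1.prodMk_nhds t2)
    exact this
  refine ⟨⟨_, (isClosed_sobolevH1 unitDisc).mem_of_tendsto t3
    (Eventually.of_forall fun j => (smoothH1 (v j) (hv j)).2)⟩, mu.coeFn_toLp, mG.coeFn_toLp, ?_⟩
  exact tendsto_subtype_rng.2 t3

/-! ### The energy form of annular conductivities -/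

open Classical in
/-- The scalar weight `1 + α` on `B(0,R) \ B(0,R²)` and `1` elsewhere. -/
noncomputable def annularWeight (α R : ℝ) (x : Plane) : ℝ :=
  if x ∈ Metric.ball (0 : Plane) R \ Metric.ball (0 : Plane) (R ^ 2) then 1 + α else 1

theorem annularConductivity_eq (α R : ℝ) (x : Plane) :
    annularConductivity α R x = annularWeight α R x • (1 : Matrix (Fin 2) (Fin 2) ℝ) := rfl

theorem measurable_annularWeight (α R : ℝ) : Measurable (annularWeight α R) :=
  Measurable.ite (Metric.isOpen_ball.measurableSet.diff Metric.isOpen_ball.measurableSet)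
    measurable_const measurable_const

theorem one_le_annularWeight {α : ℝ} (hα : 0 ≤ α) (R : ℝ) (x : Plane) :
    1 ≤ annularWeight α R x := by
  unfold annularWeight
  split_ifs <;> linarith

theorem annularWeight_le {α : ℝ} (hα : 0 ≤ α) (R : ℝ) (x : Plane) :
    annularWeight α R x ≤ 1 + α := by
  unfold annularWeight
  split_ifs <;> linarith

theorem memLp_annularWeight {α : ℝ} (hα : 0 ≤ α) (R : ℝ) (μ : Measure Plane) :
    MemLp (fun x => (annularWeight α R x : ℂ)) ∞ μ := by
  refine memLp_top_of_bound
    (Complex.measurable_ofReal.comp (measurable_annularWeight α R)).aestronglyMeasurable (1 + α)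
    (Eventually.of_forall fun x => ?_)
  rw [Complex.norm_real, Real.norm_of_nonneg (by linarith [one_le_annularWeight hα R x])]
  exact annularWeight_le hα R x

/-- Multiplication of `L²` vector fields by the annular weight. -/
noncomputable def annularMul {α : ℝ} (hα : 0 ≤ α) (R : ℝ) (μ : Measure Plane) :
    Lp (EuclideanSpace ℂ (Fin 2)) 2 μ →L[ℂ] Lp (EuclideanSpace ℂ (Fin 2)) 2 μ :=
  (ContinuousLinearMap.lsmul ℂ ℂ).holderL μ ∞ 2 2 ((memLp_annularWeight hα R μ).toLp _)

theorem annularMul_ae {α : ℝ} (hα : 0 ≤ α) (R : ℝ) {μ : Measure Plane}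
    (g : Lp (EuclideanSpace ℂ (Fin 2)) 2 μ) :
    annularMul hα R μ g =ᵐ[μ] fun x => (annularWeight α R x : ℂ) • g x := by
  have h1 := (ContinuousLinearMap.lsmul ℂ ℂ).coeFn_holder (r := 2)
    ((memLp_annularWeight hα R μ).toLp _) g
  filter_upwards [h1, (memLp_annularWeight hα R μ).coeFn_toLp] with x hx h2
  refine Eq.trans hx ?_
  rw [h2]
  rfl

theorem energyForm_annular {Ω : Set Plane} {α : ℝ} (hα : 0 ≤ α) (R : ℝ) (u v : sobolevH1 Ω) :
    energyForm (annularConductivity α R) u v =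
      inner ℂ (sobolevGrad v) (annularMul hα R _ (sobolevGrad u)) := by
  rw [L2.inner_def, energyForm]
  refine integral_congr_ae ?_
  filter_upwards [annularMul_ae hα R (sobolevGrad u)] with x hx
  rw [hx, annularConductivity_eq]
  simp [Fin.sum_univ_two, PiLp.inner_apply]

theorem energyForm_one {Ω : Set Plane} (u v : sobolevH1 Ω) :
    energyForm (fun _ => 1) u v = inner ℂ (sobolevGrad v) (sobolevGrad u) := by
  rw [L2.inner_def, energyForm]
  refine integral_congr_ae (Eventually.of_forall fun x => ?_)
  simp [Fin.sum_univ_two, PiLp.inner_apply]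

theorem annularConductivity_zero (R : ℝ) : annularConductivity 0 R = fun _ => 1 := by
  funext x
  simp [annularConductivity]

theorem norm_sq_le_re_inner_annularMul {α : ℝ} (hα : 0 ≤ α) (R : ℝ) {μ : Measure Plane}
    (g : Lp (EuclideanSpace ℂ (Fin 2)) 2 μ) :
    ‖g‖ ^ 2 ≤ (inner ℂ g (annularMul hα R μ g) : ℂ).re := by
  rw [← @inner_self_eq_norm_sq ℂ, L2.inner_def, L2.inner_def]
  have i1 := L2.integrable_inner (𝕜 := ℂ) g g
  have i2 := L2.integrable_inner (𝕜 := ℂ) g (annularMul hα R μ g)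
  have e1 := integral_re i1
  have e2 := integral_re i2
  rw [← e1]
  refine le_trans ?_ (le_of_eq e2)
  refine integral_mono_ae i1.re i2.re ?_
  filter_upwards [annularMul_ae hα R g] with x hx
  rw [hx, inner_smul_right]
  have h0 : (inner ℂ (g x) (g x) : ℂ) = ((‖g x‖ ^ 2 : ℝ) : ℂ) := by
    rw [inner_self_eq_norm_sq_to_K]; simp
  rw [h0, ← Complex.ofReal_mul]
  simp only [RCLike.re_to_complex, Complex.ofReal_re]
  nlinarith [one_le_annularWeight hα R x, sq_nonneg ‖g x‖]

/-- A fixed point of the open disc lies in the inner ball `|x| < R²` as soon as `R²` exceeds its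
norm, and there the weight is `1`. Dominated convergence then gives strong convergence, though in
general not convergence in operator norm. -/
theorem tendsto_annularMul {α : ℝ} (hα : 0 ≤ α) {R : ℕ → ℝ}
    (hR1 : Tendsto R atTop (𝓝 1))
    (g : Lp (EuclideanSpace ℂ (Fin 2)) 2 (volume.restrict unitDisc)) :
    Tendsto (fun n => annularMul hα (R n) _ g) atTop (𝓝 g) := by
  have hm : ∀ n, MemLp (fun x => (annularWeight α (R n) x : ℂ) • g x) 2
      (volume.restrict unitDisc) :=
    fun n => (Lp.memLp (annularMul hα (R n) _ g)).ae_eq (annularMul_ae hα (R n) g)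
  have hb : MemLp (fun x => (1 + α) * ‖g x‖) 2 (volume.restrict unitDisc) :=
    (Lp.memLp g).norm.const_mul _
  have key := tendsto_toLp_of_dominated hm (Lp.memLp g) hb
    (fun n => Eventually.of_forall fun x => by
      rw [norm_smul, Complex.norm_real,
        Real.norm_of_nonneg (by linarith [one_le_annularWeight hα (R n) x])]
      exact mul_le_mul_of_nonneg_right (annularWeight_le hα _ x) (norm_nonneg _)) ?_
  · rw [Lp.toLp_coeFn] at key
    refine key.congr fun n => ?_
    exact Lp.ext ((hm n).coeFn_toLp.trans (annularMul_ae hα (R n) g).symm)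
  filter_upwards [ae_restrict_mem Metric.isOpen_ball.measurableSet] with x hx
  have hx1 : ‖x‖ < 1 := by simpa using hx
  have hR2 : Tendsto (fun n => R n ^ 2) atTop (𝓝 1) := by simpa using hR1.pow 2
  have : ∀ᶠ n in atTop, annularWeight α (R n) x = 1 := by
    filter_upwards [hR2.eventually_const_lt hx1] with n hn
    have : x ∈ Metric.ball (0 : Plane) (R n ^ 2) := by simpa using hn
    simp [annularWeight, -Metric.mem_ball, this]
  refine tendsto_const_nhds.congr' ?_
  filter_upwards [this] with n hn
  simp [hn]

/-! ### G-convergence -/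

theorem spectralBound_nonneg {K : ℝ} (hK : 1 ≤ K) (Ω : Set Plane) : 0 ≤ spectralBound K Ω := by
  refine Real.sInf_nonneg ?_
  rintro r ⟨u, -, rfl⟩
  positivity

theorem spectralBound_mul_le {K : ℝ} (hK : 1 ≤ K) {Ω : Set Plane} (u : sobolevH10 Ω) :
    spectralBound K Ω * ‖sobolevFun (u : sobolevH1 Ω)‖ ^ 2 ≤
      ‖sobolevGrad (u : sobolevH1 Ω)‖ ^ 2 := by
  set a := ‖sobolevFun (u : sobolevH1 Ω)‖ with ha
  rcases eq_or_ne a 0 with h0 | h0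
  · rw [h0]
    simp
  have hpos : 0 < a := lt_of_le_of_ne (norm_nonneg _) (Ne.symm h0)
  let w : sobolevH10 Ω := ((a⁻¹ : ℝ) : ℂ) • u
  have hf : sobolevFun (w : sobolevH1 Ω) = ((a⁻¹ : ℝ) : ℂ) • sobolevFun (u : sobolevH1 Ω) := rfl
  have hg : sobolevGrad (w : sobolevH1 Ω) = ((a⁻¹ : ℝ) : ℂ) • sobolevGrad (u : sobolevH1 Ω) := rfl
  have hle : spectralBound K Ω ≤ K⁻¹ * ‖sobolevGrad (w : sobolevH1 Ω)‖ ^ 2 := by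
    refine csInf_le ⟨0, ?_⟩ ⟨w, ?_, rfl⟩
    · rintro r ⟨u, -, rfl⟩
      positivity
    · rw [hf, norm_smul, Complex.norm_real, Real.norm_of_nonneg (by positivity), ← ha]
      field_simp
  rw [hg, norm_smul, Complex.norm_real, Real.norm_of_nonneg (by positivity)] at hle
  -- The factor `K⁻¹` can be thrown away: the weights used here are at least `1`, so coercivity
  -- relative to the plain Dirichlet energy is enough.
  have hK1 : K⁻¹ ≤ 1 := inv_le_one_of_one_le₀ hK
  have h2 : spectralBound K Ω ≤ (a⁻¹ * ‖sobolevGrad (u : sobolevH1 Ω)‖) ^ 2 :=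
    hle.trans (mul_le_of_le_one_left (sq_nonneg _) hK1)
  calc spectralBound K Ω * a ^ 2 ≤ (a⁻¹ * ‖sobolevGrad (u : sobolevH1 Ω)‖) ^ 2 * a ^ 2 :=
        mul_le_mul_of_nonneg_right h2 (sq_nonneg _)
    _ = _ := by field_simp

/-- Positivity of the spectral bound is never proved: for `lam < 0` it is not needed, and for `lam ≥
0` it follows from `lam` lying below the bound. -/
theorem exists_coercivity_const {K : ℝ} (hK : 1 ≤ K) {Ω : Set Plane} {lam : ℝ}
    (hlam : lam < spectralBound K Ω) :
    ∃ c : ℝ, 0 < c ∧ ∀ u : sobolevH10 Ω, c * ‖u‖ ^ 2 ≤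
      ‖sobolevGrad (u : sobolevH1 Ω)‖ ^ 2 - lam * ‖sobolevFun (u : sobolevH1 Ω)‖ ^ 2 := by
  have hn : ∀ u : sobolevH10 Ω, ‖u‖ ^ 2 =
      ‖sobolevFun (u : sobolevH1 Ω)‖ ^ 2 + ‖sobolevGrad (u : sobolevH1 Ω)‖ ^ 2 :=
    fun u => sobolevH1_norm_sq (u : sobolevH1 Ω)
  have hs := spectralBound_nonneg hK Ω
  have hP := fun u : sobolevH10 Ω => spectralBound_mul_le hK u
  generalize spectralBound K Ω = s at hs hP hlam
  obtain ⟨c, hc, hreal⟩ : ∃ c : ℝ, 0 < c ∧ ∀ a b n : ℝ, 0 ≤ a → 0 ≤ b → s * a ≤ b → n = a + b →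
      c * n ≤ b - lam * a := by
    rcases lt_or_ge lam 0 with hneg | hpos
    · refine ⟨min 1 (-lam), lt_min one_pos (neg_pos.2 hneg), ?_⟩
      rintro a b n ha hb - rfl
      nlinarith [min_le_left 1 (-lam), min_le_right 1 (-lam)]
    · have hs0 : 0 < s := hpos.trans_lt hlam
      -- This is the value of the quotient `(b - lam a) / (a + b)` at the extremal case `b = s a`.
      refine ⟨(s - lam) / (1 + s), by apply div_pos <;> linarith, ?_⟩
      rintro a b n ha hb h rfl
      rw [div_mul_eq_mul_div, div_le_iff₀ (by linarith)]
      nlinarith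
  exact ⟨c, hc, fun u => hreal _ _ _ (sq_nonneg _) (sq_nonneg _) (hP u) (hn u)⟩

theorem exists_riesz_antilinear {H : Type*} [NormedAddCommGroup H] [InnerProductSpace ℂ H]
    [CompleteSpace H] (f : H →L⋆[ℂ] ℂ) : ∃ y : H, ∀ v, f v = inner ℂ v y := by
  let g : H →L[ℂ] ℂ := LinearMap.mkContinuous
    { toFun := fun v => (starRingEnd ℂ) (f v)
      map_add' := fun a b => by simp
      map_smul' := fun a b => by simp } ‖f‖ (fun v => by simpa using f.le_opNorm v)
  refine ⟨(InnerProductSpace.toDual ℂ H).symm g, fun v => ?_⟩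
  rw [← inner_conj_symm, InnerProductSpace.toDual_symm_apply]
  exact (Complex.conj_conj _).symm

/-- Coercivity makes every operator bijective. Since `A n (u n - u') = A' u' - A n u'`, it also
bounds `‖u n - u'‖` by `c⁻¹` times the residual of the limit solution, which tends to zero by strong
convergence. -/
theorem exists_tendsto_solutions {H : Type*} [NormedAddCommGroup H] [InnerProductSpace ℂ H]
    [CompleteSpace H] {A : ℕ → H →L[ℂ] H} {A' : H →L[ℂ] H} {c : ℝ} (hc : 0 < c)
    (hA : ∀ n x, c * ‖x‖ ^ 2 ≤ ‖(inner ℂ x (A n x) : ℂ)‖)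
    (hA' : ∀ x, c * ‖x‖ ^ 2 ≤ ‖(inner ℂ x (A' x) : ℂ)‖)
    (hlim : ∀ x, Tendsto (fun n => A n x) atTop (𝓝 (A' x))) (y : H) :
    ∃ (u : ℕ → H) (u' : H), (∀ n w, A n w = y ↔ w = u n) ∧ (∀ w, A' w = y ↔ w = u') ∧
      Tendsto u atTop (𝓝 u') := by
  have bij : ∀ B : H →L[ℂ] H, (∀ x, c * ‖x‖ ^ 2 ≤ ‖(inner ℂ x (B x) : ℂ)‖) →
      Function.Bijective B := by
    intro B hB
    refine ContinuousLinearMap.isUnit_iff_bijective.1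
      (ContinuousLinearMap.isUnit_of_forall_le_norm_inner_map B (c := ⟨c, hc.le⟩)
        (by exact_mod_cast hc) fun x => ?_)
    rw [norm_inner_symm, mul_comm]
    exact hB x
  choose u hu using fun n => (bij (A n) (hA n)).2 y
  obtain ⟨u', hu'⟩ := (bij A' hA').2 y
  refine ⟨u, u', fun n w => ⟨fun h => (bij _ (hA n)).1 (h.trans (hu n).symm), ?_⟩,
    fun w => ⟨fun h => (bij _ hA').1 (h.trans hu'.symm), ?_⟩, ?_⟩
  · rintro rfl; exact hu n
  · rintro rfl; exact hu'
  rw [tendsto_iff_norm_sub_tendsto_zero]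
  have h1 : Tendsto (fun n => c⁻¹ * ‖A' u' - A n u'‖) atTop (𝓝 0) := by
    have : Tendsto (fun n => A' u' - A n u') atTop (𝓝 0) := by
      simpa using (hlim u').const_sub (A' u')
    simpa using this.norm.const_mul c⁻¹
  refine squeeze_zero (fun n => norm_nonneg _) (fun n => ?_) h1
  have h2 := hA n (u n - u')
  have h3 : A n (u n - u') = A' u' - A n u' := by rw [map_sub, hu, hu']
  rw [h3] at h2
  have h4 := h2.trans (norm_inner_le_norm _ _)
  rcases eq_or_ne ‖u n - u'‖ 0 with h0 | h0
  · rw [h0]; positivity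
  have hp : 0 < ‖u n - u'‖ := lt_of_le_of_ne (norm_nonneg _) (Ne.symm h0)
  rw [inv_mul_eq_div, le_div_iff₀ hc]
  refine le_of_mul_le_mul_left ?_ hp
  nlinarith

/-- The operator representing the form `⟨MGu, Gv⟩ - λ⟨Fu, Fv⟩`. -/
noncomputable def formOp {H V W : Type*} [NormedAddCommGroup H] [InnerProductSpace ℂ H]
    [CompleteSpace H] [NormedAddCommGroup V] [InnerProductSpace ℂ V] [CompleteSpace V]
    [NormedAddCommGroup W] [InnerProductSpace ℂ W] [CompleteSpace W]
    (F : H →L[ℂ] V) (G : H →L[ℂ] W) (lam : ℝ) (M : W →L[ℂ] W) : H →L[ℂ] H :=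
  G.adjoint ∘L M ∘L G - (lam : ℂ) • (F.adjoint ∘L F)

theorem inner_formOp {H V W : Type*} [NormedAddCommGroup H] [InnerProductSpace ℂ H]
    [CompleteSpace H] [NormedAddCommGroup V] [InnerProductSpace ℂ V] [CompleteSpace V]
    [NormedAddCommGroup W] [InnerProductSpace ℂ W] [CompleteSpace W]
    (F : H →L[ℂ] V) (G : H →L[ℂ] W) (lam : ℝ) (M : W →L[ℂ] W) (u v : H) :
    (inner ℂ v (formOp F G lam M u) : ℂ) =
      inner ℂ (G v) (M (G u)) - (lam : ℂ) * inner ℂ (F v) (F u) := by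
  rw [formOp, sub_apply, inner_sub_right,
    smul_apply, inner_smul_right, ContinuousLinearMap.comp_apply,
    ContinuousLinearMap.adjoint_inner_right, ContinuousLinearMap.comp_apply,
    ContinuousLinearMap.comp_apply, ContinuousLinearMap.adjoint_inner_right]

theorem tendsto_formOp {H V W : Type*} [NormedAddCommGroup H] [InnerProductSpace ℂ H]
    [CompleteSpace H] [NormedAddCommGroup V] [InnerProductSpace ℂ V] [CompleteSpace V]
    [NormedAddCommGroup W] [InnerProductSpace ℂ W] [CompleteSpace W]
    (F : H →L[ℂ] V) (G : H →L[ℂ] W) (lam : ℝ) {M : ℕ → W →L[ℂ] W} {M' : W →L[ℂ] W} {u : H}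
    (h : Tendsto (fun n => M n (G u)) atTop (𝓝 (M' (G u)))) :
    Tendsto (fun n => formOp F G lam (M n) u) atTop (𝓝 (formOp F G lam M' u)) := by
  simp only [formOp, sub_apply]
  exact ((G.adjoint.continuous.tendsto _).comp h).sub_const _

theorem forall_eq_iff_of_inner {H : Type*} [NormedAddCommGroup H] [InnerProductSpace ℂ H]
    {e f : H → ℂ} {x y : H} (he : ∀ v, e v = inner ℂ v x) (hf : ∀ v, f v = inner ℂ v y) :
    (∀ v, e v = f v) ↔ x = y := by
  simp only [he, hf]
  exact ⟨fun h => ext_inner_left ℂ h, fun h v => by rw [h]⟩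

theorem norm_sq_eq_re_inner_self {H : Type*} [NormedAddCommGroup H] [InnerProductSpace ℂ H]
    (x : H) : (inner ℂ x x : ℂ).re = ‖x‖ ^ 2 := inner_self_eq_norm_sq (𝕜 := ℂ) x

/-- Convergence of the weak solutions of `⟨MₙGu, Gv⟩ - λ⟨Fu, Fv⟩ = f v` in a closed subspace, for
uniformly coercive forms with strongly convergent coefficients. -/
theorem exists_tendsto_weak_solutions {E V W : Type*}
    [NormedAddCommGroup E] [InnerProductSpace ℂ E]
    [NormedAddCommGroup V] [InnerProductSpace ℂ V] [CompleteSpace V]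
    [NormedAddCommGroup W] [InnerProductSpace ℂ W] [CompleteSpace W]
    (S : Submodule ℂ E) [CompleteSpace S] (F : E →L[ℂ] V) (G : E →L[ℂ] W) {lam : ℝ}
    (hcoer : ∃ c : ℝ, 0 < c ∧ ∀ u : S, c * ‖u‖ ^ 2 ≤ ‖G u‖ ^ 2 - lam * ‖F u‖ ^ 2)
    {M : ℕ → W →L[ℂ] W} (hM : ∀ n g, ‖g‖ ^ 2 ≤ (inner ℂ g (M n g) : ℂ).re)
    (hlim : ∀ g, Tendsto (fun n => M n g) atTop (𝓝 g)) (f : S →L⋆[ℂ] ℂ) :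
    ∃ (u : ℕ → S) (u' : S),
      (∀ n (w : S), (∀ v : S, inner ℂ (G v) (M n (G w)) - (lam : ℂ) * inner ℂ (F v) (F w) = f v) ↔
        w = u n) ∧
      (∀ w : S, (∀ v : S, inner ℂ (G v) (G w) - (lam : ℂ) * inner ℂ (F v) (F w) = f v) ↔ w = u') ∧
      ∀ ℓ : StrongDual ℂ S, Tendsto (fun n => ℓ (u n)) atTop (𝓝 (ℓ u')) := by
  obtain ⟨c, hc, hcoer⟩ := hcoer
  obtain ⟨y, hy⟩ := exists_riesz_antilinear f
  set F' : S →L[ℂ] V := F ∘L S.subtypeL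
  set G' : S →L[ℂ] W := G ∘L S.subtypeL
  have hco : ∀ (N : W →L[ℂ] W), (∀ g, ‖g‖ ^ 2 ≤ (inner ℂ g (N g) : ℂ).re) → ∀ u : S,
      c * ‖u‖ ^ 2 ≤ ‖(inner ℂ u (formOp F' G' lam N u) : ℂ)‖ := by
    intro N hN u
    refine (hcoer u).trans (le_trans ?_ (Complex.re_le_norm _))
    rw [inner_formOp, Complex.sub_re, Complex.re_ofReal_mul, norm_sq_eq_re_inner_self]
    exact sub_le_sub_right (hN (G u)) _
  have hiff : ∀ (N : W →L[ℂ] W) (w : S),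
      (∀ v : S, inner ℂ (G v) (N (G w)) - (lam : ℂ) * inner ℂ (F v) (F w) = f v) ↔
        formOp F' G' lam N w = y := fun N w =>
    forall_eq_iff_of_inner (fun v => (inner_formOp F' G' lam N w v).symm) hy
  obtain ⟨u, u', h1, h2, h3⟩ := exists_tendsto_solutions hc (fun n => hco (M n) (hM n))
    (hco (ContinuousLinearMap.id ℂ W) fun g => (norm_sq_eq_re_inner_self g).ge)
    (fun x => tendsto_formOp F' G' lam (hlim (G' x))) y
  exact ⟨u, u', fun n w => (hiff _ w).trans (h1 n w),
    fun w => (hiff (ContinuousLinearMap.id ℂ W) w).trans (h2 w),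
    fun ℓ => (ℓ.continuous.tendsto _).comp h3⟩

theorem gConverges_annular {α : ℝ} (hα : 0 ≤ α) {R : ℕ → ℝ} (hR1 : Tendsto R atTop (𝓝 1)) :
    GConverges (1 + α) unitDisc (fun n => annularConductivity α (R n)) (fun _ => 1) := by
  intro lam hlam f
  have hcoer : ∃ c : ℝ, 0 < c ∧ ∀ u : sobolevH10 unitDisc, c * ‖u‖ ^ 2 ≤
      ‖sobolevGradL unitDisc u‖ ^ 2 - lam * ‖sobolevFunL unitDisc u‖ ^ 2 :=
    exists_coercivity_const (by linarith) hlam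
  have h := exists_tendsto_weak_solutions (sobolevH10 unitDisc) (sobolevFunL unitDisc)
    (sobolevGradL unitDisc) (lam := lam) (M := fun n => annularMul hα (R n) _) hcoer
    (fun n g => norm_sq_le_re_inner_annularMul hα (R n) g) (tendsto_annularMul hα hR1) f
  refine h.imp fun u => Exists.imp fun u' => And.imp ?_ (And.imp ?_ id)
  · refine fun h1 n w => Iff.trans (forall_congr' fun v => ?_) (h1 n w)
    exact Eq.congr_left (congrArg₂ HSub.hSub
      (energyForm_annular hα (R n) (w : sobolevH1 unitDisc) (v : sobolevH1 unitDisc)) rfl)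
  · refine fun h1 w => Iff.trans (forall_congr' fun v => ?_) (h1 w)
    exact Eq.congr_left (congrArg₂ HSub.hSub
      (energyForm_one (w : sobolevH1 unitDisc) (v : sobolevH1 unitDisc)) rfl)

/-! ### Polar coordinates -/

/-- The point of the plane with polar coordinates `(r, θ)`. -/
noncomputable def polarPoint (r θ : ℝ) : Plane := !₂[r * Real.cos θ, r * Real.sin θ]

theorem norm_polarPoint {r : ℝ} (hr : 0 ≤ r) (θ : ℝ) : ‖polarPoint r θ‖ = r := by
  rw [EuclideanSpace.norm_eq, Fin.sum_univ_two]
  simp only [polarPoint, Real.norm_eq_abs, sq_abs]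
  change √((r * Real.cos θ) ^ 2 + (r * Real.sin θ) ^ 2) = r
  rw [show (r * Real.cos θ) ^ 2 + (r * Real.sin θ) ^ 2 = r ^ 2 by
    linear_combination r ^ 2 * Real.sin_sq_add_cos_sq θ, Real.sqrt_sq hr]

theorem integral_plane_eq_polar (f : Plane → ℂ) :
    ∫ x, f x = ∫ p in Set.Ioi (0 : ℝ) ×ˢ Set.Ioo (-Real.pi) Real.pi,
      (p.1 : ℂ) * f (polarPoint p.1 p.2) := by
  have h1 : ∫ x, f x = ∫ y : Fin 2 → ℝ, f (WithLp.toLp 2 y) :=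
    ((PiLp.volume_preserving_toLp (Fin 2)).integral_comp
      (MeasurableEquiv.toLp 2 (Fin 2 → ℝ)).measurableEmbedding f).symm
  have h2 : ∫ y : Fin 2 → ℝ, f (WithLp.toLp 2 y) =
      ∫ p : ℝ × ℝ, f (WithLp.toLp 2 (MeasurableEquiv.finTwoArrow.symm p)) :=
    ((volume_preserving_finTwoArrow ℝ).symm.integral_comp
      (MeasurableEquiv.measurableEmbedding _) (fun y => f (WithLp.toLp 2 y))).symm
  rw [h1, h2, ← integral_comp_polarCoord_symm]
  refine setIntegral_congr_fun polarCoord.open_target.measurableSet fun p hp => ?_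
  rw [Complex.real_smul]
  rfl

/-- `Ψ` absorbs the Jacobian and has to agree with the integrand only for `r > 0`; this admits `a =
0`, where the annulus is a disc. -/
theorem integral_annulus_eq_polar {a b : ℝ} (ha : 0 ≤ a) (hab : a ≤ b) {Φ : Plane → ℂ}
    {Ψ : ℝ → ℝ → ℂ}
    (hΨ : ContinuousOn (Function.uncurry Ψ) (Set.Icc a b ×ˢ Set.Icc (-Real.pi) Real.pi))
    (h : ∀ r θ, 0 < r → a ≤ r → r < b → (r : ℂ) * Φ (polarPoint r θ) = Ψ r θ) :
    ∫ x in Metric.ball (0 : Plane) b \ Metric.ball (0 : Plane) a, Φ x =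
      ∫ r in a..b, ∫ θ in (-Real.pi)..Real.pi, Ψ r θ := by
  have hA : MeasurableSet (Metric.ball (0 : Plane) b \ Metric.ball (0 : Plane) a) :=
    Metric.isOpen_ball.measurableSet.diff Metric.isOpen_ball.measurableSet
  have hpi : -Real.pi ≤ Real.pi := by linarith [Real.pi_pos]
  have hS : MeasurableSet (Set.Ico a b ×ˢ (Set.univ : Set ℝ)) :=
    measurableSet_Ico.prod MeasurableSet.univ
  rw [← integral_indicator hA, integral_plane_eq_polar]
  have e1 : Set.EqOn (fun p : ℝ × ℝ => (p.1 : ℂ) *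
      (Metric.ball (0 : Plane) b \ Metric.ball (0 : Plane) a).indicator Φ (polarPoint p.1 p.2))
      ((Set.Ico a b ×ˢ (Set.univ : Set ℝ)).indicator (Function.uncurry Ψ))
      (Set.Ioi (0 : ℝ) ×ˢ Set.Ioo (-Real.pi) Real.pi) := by
    rintro ⟨r, θ⟩ ⟨hr, -⟩
    have hr0 : 0 < r := hr
    by_cases hm : a ≤ r ∧ r < b
    · have m1 : polarPoint r θ ∈ Metric.ball (0 : Plane) b \ Metric.ball (0 : Plane) a := by
        simp [norm_polarPoint hr0.le, hm]
      have m2 : (r, θ) ∈ Set.Ico a b ×ˢ (Set.univ : Set ℝ) := ⟨hm, trivial⟩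
      simp only [Set.indicator_of_mem m1, Set.indicator_of_mem m2]
      exact h r θ hr0 hm.1 hm.2
    · have m1 : polarPoint r θ ∉ Metric.ball (0 : Plane) b \ Metric.ball (0 : Plane) a := by
        simp only [Set.mem_sdiff, mem_ball_zero_iff, norm_polarPoint hr0.le, not_lt]
        tauto
      have m2 : (r, θ) ∉ Set.Ico a b ×ˢ (Set.univ : Set ℝ) := fun hh => hm hh.1
      simp only [Set.indicator_of_notMem m1, Set.indicator_of_notMem m2, mul_zero]
  rw [setIntegral_congr_fun (measurableSet_Ioi.prod measurableSet_Ioo) e1,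
    setIntegral_indicator hS]
  have hset : ((Set.Ioi (0 : ℝ) ×ˢ Set.Ioo (-Real.pi) Real.pi) ∩
      (Set.Ico a b ×ˢ (Set.univ : Set ℝ)) : Set (ℝ × ℝ)) =
      (Set.Ioi 0 ∩ Set.Ico a b) ×ˢ Set.Ioo (-Real.pi) Real.pi := by
    rw [Set.prod_inter_prod, Set.inter_univ]
  -- The radial set left by polar coordinates and the half-open interval of an interval integral
  -- differ only in endpoints; for `a = 0` the origin is already missing.
  have hae1 : (Set.Ioi 0 ∩ Set.Ico a b : Set ℝ) =ᵐ[volume] Set.Ioc a b := by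
    have : Set.Ioo a b ⊆ Set.Ioi 0 ∩ Set.Ico a b := fun x hx =>
      ⟨ha.trans_lt hx.1, hx.1.le, hx.2⟩
    refine EventuallyLE.antisymm ?_ ?_
    · exact (LE.le.eventuallyLE Set.inter_subset_right).trans Ico_ae_eq_Ioc.le
    · exact Ioo_ae_eq_Ioc.symm.le.trans (LE.le.eventuallyLE this)
  have hae : ((Set.Ioi 0 ∩ Set.Ico a b) ×ˢ Set.Ioo (-Real.pi) Real.pi : Set (ℝ × ℝ))
      =ᵐ[volume] (Set.Ioc a b ×ˢ Set.Ioc (-Real.pi) Real.pi : Set (ℝ × ℝ)) :=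
    Measure.set_prod_ae_eq hae1 Ioo_ae_eq_Ioc
  rw [hset, setIntegral_congr_set hae, Measure.volume_eq_prod, setIntegral_prod,
    intervalIntegral.integral_of_le hab]
  · refine setIntegral_congr_fun measurableSet_Ioc fun r _ => ?_
    simp only [intervalIntegral.integral_of_le hpi]
    rfl
  · exact (hΨ.integrableOn_compact (isCompact_Icc.prod isCompact_Icc)).mono_set
      (Set.prod_mono Set.Ioc_subset_Icc_self Set.Ioc_subset_Icc_self)

theorem continuous_polarPoint : Continuous fun p : ℝ × ℝ => polarPoint p.1 p.2 := by
  refine (PiLp.continuous_toLp 2 _).comp (continuous_pi fun i => ?_)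
  fin_cases i
  · exact continuous_fst.mul (Real.continuous_cos.comp continuous_snd)
  · exact continuous_fst.mul (Real.continuous_sin.comp continuous_snd)

theorem hasDerivAt_polarPoint_radial (r θ : ℝ) :
    HasDerivAt (fun r => polarPoint r θ) (polarPoint 1 θ) r := by
  have h : (fun r => polarPoint r θ) = fun r => r • polarPoint 1 θ := by
    funext r
    ext i
    fin_cases i <;> simp [polarPoint]
  rw [h]
  simpa using (hasDerivAt_id r).smul_const (polarPoint 1 θ)

theorem polarPoint_eq (r θ : ℝ) : polarPoint r θ =
    (r * Real.cos θ) • planeBasis 0 + (r * Real.sin θ) • planeBasis 1 := by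
  ext i
  fin_cases i <;> simp [polarPoint, planeBasis]

theorem hasDerivAt_polarPoint_angular (r θ : ℝ) :
    HasDerivAt (fun θ => polarPoint r θ)
      (-(r * Real.sin θ) • planeBasis 0 + (r * Real.cos θ) • planeBasis 1) θ := by
  have h : (fun θ => polarPoint r θ) = fun θ =>
      (r * Real.cos θ) • planeBasis 0 + (r * Real.sin θ) • planeBasis 1 :=
    funext fun θ => polarPoint_eq r θ
  rw [h]
  refine HasDerivAt.add ?_ ?_
  · convert ((Real.hasDerivAt_cos θ).const_mul r).smul_const (planeBasis 0) using 2
    ring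
  · exact ((Real.hasDerivAt_sin θ).const_mul r).smul_const (planeBasis 1)

/-- The radial derivative of `w` in polar coordinates. -/
theorem hasDerivAt_radial {w : Plane → ℂ} (hw : Differentiable ℝ w) (r θ : ℝ) :
    HasDerivAt (fun r => w (polarPoint r θ))
      (Real.cos θ * fderiv ℝ w (polarPoint r θ) (planeBasis 0) +
        Real.sin θ * fderiv ℝ w (polarPoint r θ) (planeBasis 1)) r := by
  have := (hw (polarPoint r θ)).hasFDerivAt.comp_hasDerivAt r (hasDerivAt_polarPoint_radial r θ)
  refine this.congr_deriv ?_
  rw [polarPoint_eq 1 θ]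
  simp

/-- The angular derivative of `w` in polar coordinates. -/
theorem hasDerivAt_angular {w : Plane → ℂ} (hw : Differentiable ℝ w) (r θ : ℝ) :
    HasDerivAt (fun θ => w (polarPoint r θ))
      (-(r * Real.sin θ) * fderiv ℝ w (polarPoint r θ) (planeBasis 0) +
        r * Real.cos θ * fderiv ℝ w (polarPoint r θ) (planeBasis 1)) θ := by
  have := (hw (polarPoint r θ)).hasFDerivAt.comp_hasDerivAt θ (hasDerivAt_polarPoint_angular r θ)
  refine this.congr_deriv ?_
  simp

/-! ### Green's formula for harmonic monomials on annuli -/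

/-- The complex coordinate `x₀ + i κ x₁`. -/
noncomputable def zCoord (κ : ℝ) (x : Plane) : ℂ := x 0 + Complex.I * κ * x 1

theorem exp_I_mul_sign {κ : ℝ} (hκ : κ = 1 ∨ κ = -1) (θ : ℝ) :
    Complex.exp (Complex.I * κ * θ) = Real.cos θ + Complex.I * κ * Real.sin θ := by
  rcases hκ with rfl | rfl
  · rw [Complex.ofReal_one, mul_one, mul_comm, Complex.exp_mul_I]
    push_cast
    ring
  · rw [show Complex.I * ((-1 : ℝ) : ℂ) * θ = (-θ : ℂ) * Complex.I by push_cast; ring,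
      Complex.exp_mul_I, Complex.cos_neg, Complex.sin_neg]
    push_cast
    ring

theorem zCoord_polarPoint {κ : ℝ} (hκ : κ = 1 ∨ κ = -1) (r θ : ℝ) :
    zCoord κ (polarPoint r θ) = r * Complex.exp (Complex.I * κ * θ) := by
  rw [exp_I_mul_sign hκ]
  simp [zCoord, polarPoint]
  ring

/-- The integral of `w` against `e^{iκmθ}` over the circle of radius `r`. -/
noncomputable def circleMoment (κ : ℝ) (m : ℤ) (w : Plane → ℂ) (r : ℝ) : ℂ :=
  ∫ θ in (-Real.pi)..Real.pi, Complex.exp (Complex.I * κ * θ) ^ m * w (polarPoint r θ)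

/-- With `W0`, `W1` the partial derivatives of `w`, the brackets on the right are its radial and
angular derivatives. The identity is the chain rule combined with `e^{iκθ} = cos θ + iκ sin θ` and
`(iκ)² = -1`. -/
theorem polar_gradient_identity {κ : ℝ} (hκ : κ = 1 ∨ κ = -1) (m : ℤ) {r : ℝ} (hr : 0 < r) (θ : ℝ)
    (W0 W1 : ℂ) :
    (r : ℂ) * (m * zCoord κ (polarPoint r θ) ^ (m - 1) * (W0 + Complex.I * κ * W1)) =
      m * (r : ℂ) ^ m * Complex.exp (Complex.I * κ * θ) ^ m *
          (Real.cos θ * W0 + Real.sin θ * W1) +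
        m * (r : ℂ) ^ (m - 1) * (Complex.I * κ) * Complex.exp (Complex.I * κ * θ) ^ m *
          (-(r * Real.sin θ) * W0 + r * Real.cos θ * W1) := by
  have hr' : (r : ℂ) ≠ 0 := Complex.ofReal_ne_zero.2 hr.ne'
  have hE := Complex.exp_ne_zero (Complex.I * κ * θ)
  rw [zCoord_polarPoint hκ, mul_zpow]
  have e1 : (r : ℂ) ^ m = (r : ℂ) ^ (m - 1) * r := by rw [← zpow_add_one₀ hr']; ring_nf
  have e2 : Complex.exp (Complex.I * κ * θ) ^ m =
      Complex.exp (Complex.I * κ * θ) ^ (m - 1) * Complex.exp (Complex.I * κ * θ) := by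
    rw [← zpow_add_one₀ hE]; ring_nf
  rw [e1, e2]
  generalize (r : ℂ) ^ (m - 1) = P
  generalize Complex.exp (Complex.I * κ * θ) ^ (m - 1) = Q
  rw [exp_I_mul_sign hκ]
  have hcs : (Real.sin θ : ℂ) ^ 2 + (Real.cos θ : ℂ) ^ 2 = 1 := by
    exact_mod_cast Real.sin_sq_add_cos_sq θ
  have hI : Complex.I ^ 2 = -1 := Complex.I_sq
  have hk : (κ : ℂ) ^ 2 = 1 := by
    rcases hκ with rfl | rfl <;> norm_num
  generalize (Real.sin θ : ℂ) = S at *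
  generalize (Real.cos θ : ℂ) = C at *
  have hIk : (Complex.I * κ) ^ 2 = -1 := by rw [mul_pow, hI, hk]; ring
  generalize Complex.I * (κ : ℂ) = J at *
  linear_combination (-(r * m * P * Q * (W0 + J * W1))) * hcs +
    (r * m * P * Q * (S ^ 2 * W0 - S * C * W1)) * hIk

theorem continuousOn_ofReal_zpow {a b : ℝ} {m : ℤ} (ha : 0 < a ∨ 0 ≤ m) :
    ContinuousOn (fun r : ℝ => (r : ℂ) ^ m) (Set.Icc a b) := by
  intro r hr
  refine (ContinuousAt.zpow₀ Complex.continuous_ofReal.continuousAt m ?_).continuousWithinAt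
  rcases ha with h | h
  · exact Or.inl (Complex.ofReal_ne_zero.2 (h.trans_le hr.1).ne')
  · exact Or.inr h

theorem hasDerivAt_exp_zpow (κ : ℝ) (m : ℤ) (θ : ℝ) :
    HasDerivAt (fun θ : ℝ => Complex.exp (Complex.I * κ * θ) ^ m)
      (m * (Complex.I * κ) * Complex.exp (Complex.I * κ * θ) ^ m) θ := by
  have h : (fun θ : ℝ => Complex.exp (Complex.I * κ * θ) ^ m) =
      fun θ : ℝ => Complex.exp (m * (Complex.I * κ) * θ) := by
    funext θ
    rw [← Complex.exp_int_mul]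
    ring_nf
  rw [h, congrFun h θ]
  have h1 : HasDerivAt (fun θ : ℝ => (m * (Complex.I * κ) * θ : ℂ)) (m * (Complex.I * κ)) θ := by
    simpa using (Complex.ofRealCLM.hasDerivAt (x := θ)).const_mul (m * (Complex.I * κ : ℂ))
  convert h1.cexp using 1
  ring

theorem exp_zpow_pi {κ : ℝ} (hκ : κ = 1 ∨ κ = -1) :
    Complex.exp (Complex.I * κ * (Real.pi : ℝ)) =
      Complex.exp (Complex.I * κ * ((-Real.pi : ℝ) : ℂ)) := by
  rw [exp_I_mul_sign hκ, exp_I_mul_sign hκ]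
  simp

theorem polarPoint_pi (r : ℝ) : polarPoint r Real.pi = polarPoint r (-Real.pi) := by
  simp [polarPoint]

/-- Green's formula for the harmonic function `zCoord κ ^ m` on an annulus. -/
theorem green_annulus {κ : ℝ} (hκ : κ = 1 ∨ κ = -1) (m : ℤ) {a b : ℝ} (ha : 0 ≤ a) (hab : a ≤ b)
    (hm : 0 < a ∨ 0 ≤ m) {w : Plane → ℂ} (hw : ContDiff ℝ ∞ w) :
    ∫ x in Metric.ball (0 : Plane) b \ Metric.ball (0 : Plane) a,
      m * zCoord κ x ^ (m - 1) *
        (fderiv ℝ w x (planeBasis 0) + Complex.I * κ * fderiv ℝ w x (planeBasis 1)) =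
      m * ((b : ℂ) ^ m * circleMoment κ m w b - (a : ℂ) ^ m * circleMoment κ m w a) := by
  -- The case `m = 0` is split off because `r^(m-1)` would be singular at `a = 0`; for the other
  -- exponents `0 ≤ m` implies `0 ≤ m - 1`.
  rcases eq_or_ne m 0 with rfl | hm0
  · simp
  have hm1 : 0 < a ∨ 0 ≤ m - 1 := hm.imp id fun h => by omega
  have hwd : Differentiable ℝ w := hw.differentiable (by simp)
  set E : ℝ → ℂ := fun θ => Complex.exp (Complex.I * κ * θ) ^ m with hE
  set Wr : ℝ → ℝ → ℂ := fun r θ => Real.cos θ * fderiv ℝ w (polarPoint r θ) (planeBasis 0) +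
    Real.sin θ * fderiv ℝ w (polarPoint r θ) (planeBasis 1) with hWr
  set Wt : ℝ → ℝ → ℂ := fun r θ =>
    -(r * Real.sin θ) * fderiv ℝ w (polarPoint r θ) (planeBasis 0) +
      r * Real.cos θ * fderiv ℝ w (polarPoint r θ) (planeBasis 1) with hWt
  have cE : Continuous E := by
    rw [continuous_iff_continuousAt]
    exact fun θ => (hasDerivAt_exp_zpow κ m θ).continuousAt
  have cD : ∀ i, Continuous fun p : ℝ × ℝ => fderiv ℝ w (polarPoint p.1 p.2) (planeBasis i) :=
    fun i => ((hw.continuous_fderiv (by simp)).clm_apply continuous_const).comp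
      continuous_polarPoint
  have cw : Continuous fun p : ℝ × ℝ => w (polarPoint p.1 p.2) :=
    hw.continuous.comp continuous_polarPoint
  have cE2 : Continuous fun p : ℝ × ℝ => E p.2 := cE.comp continuous_snd
  have cWr : Continuous fun p : ℝ × ℝ => Wr p.1 p.2 := by
    have := cD 0
    have := cD 1
    simp only [hWr]
    fun_prop
  have cWt : Continuous fun p : ℝ × ℝ => Wt p.1 p.2 := by
    have := cD 0
    have := cD 1
    simp only [hWt]
    fun_prop
  have cz : ∀ k : ℤ, (0 < a ∨ 0 ≤ k) → ContinuousOn (fun p : ℝ × ℝ => (p.1 : ℂ) ^ k)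
      (Set.Icc a b ×ˢ Set.Icc (-Real.pi) Real.pi) := fun k hk =>
    (continuousOn_ofReal_zpow hk).comp continuousOn_fst fun p hp => hp.1
  have cA : ContinuousOn (fun p : ℝ × ℝ => m * (p.1 : ℂ) ^ m * E p.2 * Wr p.1 p.2)
      (Set.Icc a b ×ˢ Set.Icc (-Real.pi) Real.pi) :=
    ((continuousOn_const.mul (cz m hm)).mul cE2.continuousOn).mul cWr.continuousOn
  have cB : ContinuousOn (fun p : ℝ × ℝ => m * (p.1 : ℂ) ^ (m - 1) * (Complex.I * κ) * E p.2 *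
      Wt p.1 p.2) (Set.Icc a b ×ˢ Set.Icc (-Real.pi) Real.pi) :=
    (((continuousOn_const.mul (cz _ hm1)).mul continuousOn_const).mul cE2.continuousOn).mul
      cWt.continuousOn
  have cC : ContinuousOn (fun p : ℝ × ℝ => m * (m * (p.1 : ℂ) ^ (m - 1)) * E p.2 *
      w (polarPoint p.1 p.2)) (Set.Icc a b ×ˢ Set.Icc (-Real.pi) Real.pi) :=
    ((continuousOn_const.mul (continuousOn_const.mul (cz _ hm1))).mul cE2.continuousOn).mul
      cw.continuousOn
  rw [integral_annulus_eq_polar ha hab (Ψ := fun r θ => m * (r : ℂ) ^ m * E θ * Wr r θ +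
    m * (r : ℂ) ^ (m - 1) * (Complex.I * κ) * E θ * Wt r θ) (cA.add cB)
    (fun r θ hr _ _ => polar_gradient_identity hκ m hr θ _ _)]
  have hpi : -Real.pi ≤ Real.pi := by linarith [Real.pi_pos]
  have slice : ∀ {F : ℝ × ℝ → ℂ}, ContinuousOn F (Set.Icc a b ×ˢ Set.Icc (-Real.pi) Real.pi) →
      ∀ r ∈ Set.Icc a b, IntervalIntegrable (fun θ => F (r, θ)) volume (-Real.pi) Real.pi := by
    intro F hF r hr
    refine ContinuousOn.intervalIntegrable ?_
    rw [Set.uIcc_of_le hpi]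
    exact hF.comp (by fun_prop) fun θ hθ => ⟨hr, hθ⟩
  -- Integration by parts in `θ`, with no boundary terms by periodicity. The two factors `iκ`
  -- multiply to `-1`, so the angular derivative of `w` is traded for `m w`.
  have angular : ∀ r ∈ Set.Icc a b,
      ∫ θ in (-Real.pi)..Real.pi, (m * (r : ℂ) ^ m * E θ * Wr r θ +
        m * (r : ℂ) ^ (m - 1) * (Complex.I * κ) * E θ * Wt r θ) =
      ∫ θ in (-Real.pi)..Real.pi, (m * (r : ℂ) ^ m * E θ * Wr r θ +
        m * (m * (r : ℂ) ^ (m - 1)) * E θ * w (polarPoint r θ)) := by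
    intro r hr
    rw [← sub_eq_zero, ← intervalIntegral.integral_sub ((slice cA r hr).add (slice cB r hr))
      ((slice cA r hr).add (slice cC r hr))]
    have hd : ∀ θ ∈ Set.uIcc (-Real.pi) Real.pi, HasDerivAt
        (fun θ => m * (r : ℂ) ^ (m - 1) * (Complex.I * κ) * (E θ * w (polarPoint r θ)))
        (m * (r : ℂ) ^ m * E θ * Wr r θ +
          m * (r : ℂ) ^ (m - 1) * (Complex.I * κ) * E θ * Wt r θ -
          (m * (r : ℂ) ^ m * E θ * Wr r θ +
            m * (m * (r : ℂ) ^ (m - 1)) * E θ * w (polarPoint r θ))) θ := by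
      intro θ _
      refine (((hasDerivAt_exp_zpow κ m θ).mul (hasDerivAt_angular hwd r θ)).const_mul
        (m * (r : ℂ) ^ (m - 1) * (Complex.I * κ))).congr_deriv ?_
      have hIk : (Complex.I * κ) ^ 2 = -1 := by
        rw [mul_pow, Complex.I_sq]
        rcases hκ with rfl | rfl <;> norm_num
      simp only [hE, hWr, hWt]
      linear_combination (m * (r : ℂ) ^ (m - 1) * m * Complex.exp (Complex.I * κ * θ) ^ m *
        w (polarPoint r θ)) * hIk
    rw [intervalIntegral.integral_eq_sub_of_hasDerivAt hd
      (((slice cA r hr).add (slice cB r hr)).sub ((slice cA r hr).add (slice cC r hr)))]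
    simp only [hE, exp_zpow_pi hκ, polarPoint_pi, sub_self]
  -- After that trade the integrand is the exact radial derivative of `m r^m E w`.
  have radial : ∀ θ ∈ Set.Icc (-Real.pi) Real.pi,
      ∫ r in a..b, (m * (r : ℂ) ^ m * E θ * Wr r θ +
        m * (m * (r : ℂ) ^ (m - 1)) * E θ * w (polarPoint r θ)) =
      m * ((b : ℂ) ^ m * (E θ * w (polarPoint b θ)) -
        (a : ℂ) ^ m * (E θ * w (polarPoint a θ))) := by
    intro θ hθ
    have cs : ∀ {F : ℝ × ℝ → ℂ}, ContinuousOn F (Set.Icc a b ×ˢ Set.Icc (-Real.pi) Real.pi) →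
        ContinuousOn (fun r => F (r, θ)) (Set.Icc a b) := fun hF =>
      hF.comp (by fun_prop) fun r hr => ⟨hr, hθ⟩
    rw [intervalIntegral.integral_eq_sub_of_hasDerivAt_of_le hab
      (f := fun r => m * (r : ℂ) ^ m * E θ * w (polarPoint r θ))]
    · ring
    · exact cs (F := fun p => m * (p.1 : ℂ) ^ m * E p.2 * w (polarPoint p.1 p.2))
        (((continuousOn_const.mul (cz m hm)).mul cE2.continuousOn).mul cw.continuousOn)
    · intro r hr
      have hr0 : (r : ℂ) ≠ 0 := Complex.ofReal_ne_zero.2 (ha.trans_lt hr.1).ne'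
      have h1 : HasDerivAt (fun r : ℝ => (r : ℂ) ^ m) (m * (r : ℂ) ^ (m - 1)) r := by
        simpa using (hasDerivAt_zpow m (r : ℂ) (Or.inl hr0)).comp_ofReal
      refine (((h1.const_mul (m : ℂ)).mul_const (E θ)).mul
        (hasDerivAt_radial hwd r θ)).congr_deriv ?_
      simp only [hWr]
      ring
    · refine ContinuousOn.intervalIntegrable ?_
      rw [Set.uIcc_of_le hab]
      exact cs (cA.add cC)
  calc _ = ∫ r in a..b, ∫ θ in (-Real.pi)..Real.pi, (m * (r : ℂ) ^ m * E θ * Wr r θ +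
        m * (m * (r : ℂ) ^ (m - 1)) * E θ * w (polarPoint r θ)) := by
        refine intervalIntegral.integral_congr fun r hr => ?_
        rw [Set.uIcc_of_le hab] at hr
        exact angular r hr
    _ = ∫ θ in (-Real.pi)..Real.pi, ∫ r in a..b, (m * (r : ℂ) ^ m * E θ * Wr r θ +
        m * (m * (r : ℂ) ^ (m - 1)) * E θ * w (polarPoint r θ)) := by
        refine intervalIntegral_intervalIntegral_swap ?_
        rw [Set.uIoc_of_le hab, Set.uIoc_of_le hpi]
        exact ((cA.add cC).integrableOn_compact (isCompact_Icc.prod isCompact_Icc)).mono_set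
          (Set.prod_mono Set.Ioc_subset_Icc_self Set.Ioc_subset_Icc_self)
    _ = ∫ θ in (-Real.pi)..Real.pi, m * ((b : ℂ) ^ m * (E θ * w (polarPoint b θ)) -
        (a : ℂ) ^ m * (E θ * w (polarPoint a θ))) := by
        refine intervalIntegral.integral_congr fun θ hθ => ?_
        rw [Set.uIcc_of_le hpi] at hθ
        exact radial θ hθ
    _ = _ := by
        have ii : ∀ r : ℝ, IntervalIntegrable (fun θ => E θ * w (polarPoint r θ)) volume
            (-Real.pi) Real.pi := fun r =>
          (cE.mul (cw.comp (by fun_prop : Continuous fun θ : ℝ => (r, θ)))).intervalIntegrable _ _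
        rw [intervalIntegral.integral_const_mul, intervalIntegral.integral_sub
          ((ii b).const_mul _) ((ii a).const_mul _), intervalIntegral.integral_const_mul,
          intervalIntegral.integral_const_mul]
        rfl

theorem integral_unitDisc_norm_pow (n : ℕ) :
    ∫ x in unitDisc, (‖x‖ : ℂ) ^ (2 * n) = Real.pi / (n + 1) := by
  have h := integral_annulus_eq_polar (a := 0) (b := 1) le_rfl zero_le_one
    (Φ := fun x => (‖x‖ : ℂ) ^ (2 * n)) (Ψ := fun r _ => (r : ℂ) ^ (2 * n + 1))
    (by unfold Function.uncurry; fun_prop) (fun r θ hr _ _ => by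
      rw [norm_polarPoint hr.le]; ring)
  rw [Metric.ball_zero, Set.sdiff_empty] at h
  rw [h]
  simp only [intervalIntegral.integral_const]
  rw [intervalIntegral.integral_smul]
  have : ∫ r in (0 : ℝ)..1, (r : ℂ) ^ (2 * n + 1) = ((1 / (2 * n + 2) : ℝ) : ℂ) := by
    have h2 := integral_pow (a := 0) (b := 1) (2 * n + 1)
    have h3 : ∫ r in (0 : ℝ)..1, (r : ℂ) ^ (2 * n + 1) =
        ((∫ r in (0 : ℝ)..1, r ^ (2 * n + 1) : ℝ) : ℂ) := by
      rw [← intervalIntegral.integral_ofReal]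
      push_cast
      rfl
    rw [h3, h2]
    congr 1
    push_cast
    norm_num
    ring
  rw [this, Complex.real_smul]
  have hn : (n : ℂ) + 1 ≠ 0 := Nat.cast_add_one_ne_zero n
  push_cast
  field_simp
  ring

/-- Both sides integrate the same `2π`-periodic function up to conjugation; only the window `[-π,
π]` has to be moved to `[0, 2π]`. -/
theorem circleMoment_one {κ : ℝ} {m k : ℤ} (hk : (k : ℝ) = κ * m)
    (v : Plane → ℂ) : circleMoment κ m (fun x => (starRingEnd ℂ) (v x)) 1 =
      2 * Real.pi * (starRingEnd ℂ) (boundaryCoeff v k) := by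
  have hpi : (Real.pi : ℂ) ≠ 0 := Complex.ofReal_ne_zero.2 Real.pi_ne_zero
  have hk' : (k : ℂ) = κ * m := by exact_mod_cast congrArg (fun x : ℝ => (x : ℂ)) hk
  set g : ℝ → ℂ := fun θ => v (polarPoint 1 θ) * Complex.exp (-(Complex.I * (k : ℂ) * (θ : ℂ)))
    with hg
  have hper : Function.Periodic g (2 * Real.pi) := by
    intro θ
    simp only [hg, polarPoint, Real.cos_add_two_pi, Real.sin_add_two_pi]
    congr 1
    rw [Complex.exp_eq_exp_iff_exists_int]
    exact ⟨-k, by push_cast; ring⟩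
  have h1 : boundaryCoeff v k = (2 * (Real.pi : ℂ))⁻¹ * ∫ θ in (-Real.pi)..Real.pi, g θ := by
    have := hper.intervalIntegral_add_eq 0 (-Real.pi)
    rw [zero_add, show -Real.pi + 2 * Real.pi = Real.pi by ring] at this
    rw [← this, boundaryCoeff]
    simp only [hg, polarPoint, one_mul]
  have hle : -Real.pi ≤ Real.pi := by linarith [Real.pi_pos]
  rw [h1, map_mul, intervalIntegral.integral_of_le hle, ← integral_conj, circleMoment,
    intervalIntegral.integral_of_le hle]
  rw [map_inv₀, map_mul, Complex.conj_ofReal, map_ofNat, mul_inv_cancel_left₀ (by simp [hpi])]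
  refine integral_congr_ae (Eventually.of_forall fun θ => ?_)
  simp only [hg, map_mul]
  rw [← Complex.exp_conj, mul_comm, ← Complex.exp_int_mul]
  congr 2
  simp only [map_neg, map_mul, Complex.conj_I, Complex.conj_ofReal, map_intCast]
  rw [hk']
  ring

/-! ### Boundary traces -/

theorem boundaryCoeff_integrable {v : Plane → ℂ} (hv : Continuous v) (k : ℤ) :
    IntervalIntegrable (fun θ : ℝ => v (!₂[Real.cos θ, Real.sin θ]) *
      Complex.exp (-(Complex.I * (k : ℂ) * (θ : ℂ)))) volume 0 (2 * Real.pi) := by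
  refine Continuous.intervalIntegrable ?_ _ _
  have h : Continuous fun θ : ℝ => polarPoint 1 θ :=
    continuous_polarPoint.comp (by fun_prop : Continuous fun θ : ℝ => ((1 : ℝ), θ))
  simp only [polarPoint, one_mul] at h
  exact (hv.comp h).mul (by fun_prop)

theorem boundaryCoeff_add {v v' : Plane → ℂ} (hv : Continuous v) (hv' : Continuous v') :
    boundaryCoeff (v + v') = boundaryCoeff v + boundaryCoeff v' := by
  funext k
  simp only [boundaryCoeff, Pi.add_apply, add_mul]
  rw [intervalIntegral.integral_add (boundaryCoeff_integrable hv k)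
    (boundaryCoeff_integrable hv' k), mul_add]

theorem boundaryCoeff_smul (c : ℂ) (v : Plane → ℂ) :
    boundaryCoeff (c • v) = c • boundaryCoeff v := by
  funext k
  simp only [boundaryCoeff, Pi.smul_apply, smul_eq_mul, mul_assoc]
  rw [intervalIntegral.integral_const_mul]
  ring

/-- The graph of the trace map on smooth functions. -/
noncomputable def smoothTraceGraph : Submodule ℂ (sobolevH1 unitDisc × (ℤ → ℂ)) where
  carrier := {p | ∃ v : Plane → ℂ, ContDiff ℝ ∞ v ∧
    sobolevFun p.1 =ᵐ[volume.restrict unitDisc] v ∧ p.2 = boundaryCoeff v}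
  zero_mem' := by
    refine ⟨0, contDiff_const, Lp.coeFn_zero ℂ 2 (volume.restrict unitDisc), ?_⟩
    funext k
    simp [boundaryCoeff]
  add_mem' := by
    rintro ⟨a, c⟩ ⟨a', c'⟩ ⟨v, hv, h1, h2⟩ ⟨v', hv', h1', h2'⟩
    refine ⟨v + v', hv.add hv', ?_, ?_⟩
    · exact (Lp.coeFn_add (sobolevFun a) (sobolevFun a')).trans (h1.add h1')
    · rw [boundaryCoeff_add hv.continuous hv'.continuous, ← h2, ← h2']
      rfl
  smul_mem' := by
    rintro r ⟨a, c⟩ ⟨v, hv, h1, h2⟩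
    refine ⟨r • v, hv.const_smul r, ?_, ?_⟩
    · refine (Lp.coeFn_smul r (sobolevFun a)).trans ?_
      filter_upwards [h1] with x hx
      simp only [Pi.smul_apply]
      exact congrArg (r • ·) hx
    · rw [boundaryCoeff_smul, ← h2]
      rfl

/-- Sequences suffice because the product topology on `ℤ → ℂ` is first countable. As the closure of
a submodule, the trace relation is automatically linear and stable under limits along arbitrary
filters, in particular under unconditional sums. -/
theorem hasTrace_iff (u : sobolevH1 unitDisc) (c : ℤ → ℂ) :
    HasTrace u c ↔ (u, c) ∈ closure (smoothTraceGraph : Set (sobolevH1 unitDisc × (ℤ → ℂ))) := by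
  rw [mem_closure_iff_seq_limit]
  constructor
  · rintro ⟨w, v, h1, h2, h3, h4⟩
    exact ⟨fun j => (w j, boundaryCoeff (v j)), fun j => ⟨v j, h1 j, h2 j, rfl⟩,
      h3.prodMk_nhds (tendsto_pi_nhds.2 h4)⟩
  · rintro ⟨p, hp, hlim⟩
    choose v hv h1 h2 using hp
    refine ⟨fun j => (p j).1, v, hv, h1, (continuous_fst.tendsto _).comp hlim, fun k => ?_⟩
    have := tendsto_pi_nhds.1 ((continuous_snd.tendsto _).comp hlim) k
    refine this.congr fun j => ?_
    exact congrFun (h2 j) k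

theorem HasTrace.of_mem_closure {u : sobolevH1 unitDisc} {c : ℤ → ℂ}
    (h : (u, c) ∈ smoothTraceGraph.topologicalClosure) : HasTrace u c :=
  (hasTrace_iff u c).2 h

theorem HasTrace.mem_closure {u : sobolevH1 unitDisc} {c : ℤ → ℂ} (h : HasTrace u c) :
    (u, c) ∈ smoothTraceGraph.topologicalClosure :=
  (hasTrace_iff u c).1 h

theorem HasTrace.add {u u' : sobolevH1 unitDisc} {c c' : ℤ → ℂ} (h : HasTrace u c)
    (h' : HasTrace u' c') : HasTrace (u + u') (c + c') :=
  .of_mem_closure (smoothTraceGraph.topologicalClosure.add_mem h.mem_closure h'.mem_closure)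

theorem HasTrace.smul {u : sobolevH1 unitDisc} {c : ℤ → ℂ} (r : ℂ) (h : HasTrace u c) :
    HasTrace (r • u) (r • c) :=
  .of_mem_closure (smoothTraceGraph.topologicalClosure.smul_mem r h.mem_closure)

theorem HasTrace.sum {ι : Type*} (s : Finset ι) {u : ι → sobolevH1 unitDisc} {c : ι → ℤ → ℂ}
    (h : ∀ i, HasTrace (u i) (c i)) : HasTrace (∑ i ∈ s, u i) (∑ i ∈ s, c i) := by
  refine .of_mem_closure ?_
  have e : (∑ i ∈ s, u i, ∑ i ∈ s, c i) = ∑ i ∈ s, (u i, c i) :=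
    Prod.ext (by simp [Prod.fst_sum]) (by simp [Prod.snd_sum])
  rw [e]
  exact Submodule.sum_mem _ fun i _ => (h i).mem_closure

theorem HasTrace.of_tendsto {ι : Type*} {l : Filter ι} [l.NeBot] {u : ι → sobolevH1 unitDisc}
    {c : ι → ℤ → ℂ} {u' : sobolevH1 unitDisc} {c' : ℤ → ℂ} (h : ∀ i, HasTrace (u i) (c i))
    (hu : Tendsto u l (𝓝 u')) (hc : Tendsto c l (𝓝 c')) : HasTrace u' c' :=
  .of_mem_closure ((Submodule.isClosed_topologicalClosure _).mem_of_tendsto (hu.prodMk_nhds hc)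
    (Eventually.of_forall fun i => (h i).mem_closure))

theorem hasTrace_smoothH1 {v : Plane → ℂ} (hv : ContDiff ℝ ∞ v) :
    HasTrace (smoothH1 v hv) (boundaryCoeff v) :=
  .of_mem_closure (Submodule.le_topologicalClosure _ ⟨v, hv, sobolevFun_smoothH1 hv, rfl⟩)

/-- A continuous relation between elements of `H¹` and their traces may be checked on smooth
functions. -/
theorem HasTrace.induction {p : sobolevH1 unitDisc → (ℤ → ℂ) → Prop}
    (hp : IsClosed {q : sobolevH1 unitDisc × (ℤ → ℂ) | p q.1 q.2})
    (hs : ∀ (v : Plane → ℂ) (hv : ContDiff ℝ ∞ v), p (smoothH1 v hv) (boundaryCoeff v))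
    {u : sobolevH1 unitDisc} {c : ℤ → ℂ} (h : HasTrace u c) : p u c := by
  have hsub : (smoothTraceGraph : Set (sobolevH1 unitDisc × (ℤ → ℂ))) ⊆
      {q | p q.1 q.2} := by
    rintro ⟨u, c⟩ ⟨v, hv, h1, h2⟩
    have e : u = smoothH1 v hv := eq_smoothH1 hv h1
    have e2 : c = boundaryCoeff v := h2
    subst e e2
    exact hs v hv
  exact closure_minimal hsub hp ((hasTrace_iff u c).1 h)

/-- Functions supported in the open disc vanish on the circle, and having zero trace is a closed
linear condition. -/
theorem hasTrace_zero_of_mem_sobolevH10 {u : sobolevH1 unitDisc} (hu : u ∈ sobolevH10 unitDisc) :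
    HasTrace u 0 := by
  have hcl : IsClosed {u : sobolevH1 unitDisc | HasTrace u 0} := by
    have : {u : sobolevH1 unitDisc | HasTrace u 0} =
        (fun u => (u, (0 : ℤ → ℂ))) ⁻¹'
          closure (smoothTraceGraph : Set (sobolevH1 unitDisc × (ℤ → ℂ))) := by
      ext u
      exact hasTrace_iff u 0
    rw [this]
    exact isClosed_closure.preimage (by fun_prop)
  refine closure_minimal ?_ hcl hu
  intro w hw
  refine Submodule.span_induction (p := fun w _ => HasTrace w 0) ?_ ?_ ?_ ?_ hw
  · rintro w ⟨φ, h1, -, h3, h4⟩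
    have hb : boundaryCoeff φ = 0 := by
      funext k
      have : ∀ θ : ℝ, φ (!₂[Real.cos θ, Real.sin θ]) = 0 := by
        intro θ
        refine image_eq_zero_of_notMem_tsupport fun h => ?_
        have h5 := h3 h
        have h6 : ‖polarPoint 1 θ‖ = 1 := norm_polarPoint zero_le_one θ
        simp only [polarPoint, one_mul] at h6
        rw [mem_ball_zero_iff, h6] at h5
        exact lt_irrefl _ h5
      simp [boundaryCoeff, this]
    rw [eq_smoothH1 h1 h4, ← hb]
    exact hasTrace_smoothH1 h1
  · simpa using (hasTrace_smoothH1 (v := 0) contDiff_const).smul 0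
  · intro x y _ _ hx hy
    simpa using hx.add hy
  · intro a x _ hx
    simpa using hx.smul a

/-! ### Modes with smooth radial profile -/

theorem contDiff_zCoord (κ : ℝ) : ContDiff ℝ ∞ (zCoord κ) := by
  have h : ∀ i : Fin 2, ContDiff ℝ ∞ fun x : Plane => ((x i : ℝ) : ℂ) := fun i =>
    Complex.ofRealCLM.contDiff.comp (EuclideanSpace.proj (𝕜 := ℝ) i).contDiff
  exact (h 0).add (contDiff_const.mul (h 1))

/-- The derivative of `zCoord κ` in the `i`-th direction. -/
noncomputable def zDir (κ : ℝ) (i : Fin 2) : ℂ := if i = 0 then 1 else Complex.I * κ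

theorem zCoord_add_smul (κ : ℝ) (x : Plane) (t : ℝ) (i : Fin 2) :
    zCoord κ (x + t • planeBasis i) = zCoord κ x + t * zDir κ i := by
  fin_cases i <;> simp [zCoord, planeBasis, zDir] <;> ring

theorem norm_zCoord {κ : ℝ} (hκ : κ = 1 ∨ κ = -1) (x : Plane) : ‖zCoord κ x‖ = ‖x‖ := by
  have h1 : ‖zCoord κ x‖ ^ 2 = ‖x‖ ^ 2 := by
    rw [EuclideanSpace.norm_sq_eq, Fin.sum_univ_two, ← Complex.normSq_eq_norm_sq, Complex.normSq_apply]
    rcases hκ with rfl | rfl <;> simp [zCoord] <;> ring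
  exact (sq_eq_sq₀ (norm_nonneg _) (norm_nonneg _)).1 h1

theorem zCoord_mul_neg {κ : ℝ} (hκ : κ = 1 ∨ κ = -1) (x : Plane) :
    zCoord κ x * zCoord (-κ) x = ((‖x‖ ^ 2 : ℝ) : ℂ) := by
  rw [EuclideanSpace.norm_sq_eq, Fin.sum_univ_two]
  have hI : Complex.I ^ 2 = -1 := Complex.I_sq
  have hk : (κ : ℂ) ^ 2 = 1 := by rcases hκ with rfl | rfl <;> norm_num
  simp only [zCoord, Real.norm_eq_abs, sq_abs]
  push_cast
  linear_combination (-(x 1 : ℂ) ^ 2 * κ ^ 2) * hI + (x 1 : ℂ) ^ 2 * hk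

/-- The mode `g(|x|²) zⁿ`. -/
noncomputable def radialMode (κ : ℝ) (n : ℕ) (g : ℝ → ℝ) (x : Plane) : ℂ :=
  (g (‖x‖ ^ 2) : ℂ) * zCoord κ x ^ n

theorem contDiff_radialMode (κ : ℝ) (n : ℕ) {g : ℝ → ℝ} (hg : ContDiff ℝ ∞ g) :
    ContDiff ℝ ∞ (radialMode κ n g) :=
  (Complex.ofRealCLM.contDiff.comp (hg.comp (contDiff_norm_sq ℝ))).mul ((contDiff_zCoord κ).pow n)

theorem classicalGrad_radialMode (κ : ℝ) (n : ℕ) {g : ℝ → ℝ} (hg : ContDiff ℝ ∞ g) (x : Plane)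
    (i : Fin 2) : classicalGrad (radialMode κ n g) x i =
      (deriv g (‖x‖ ^ 2) * (2 * x i) : ℝ) * zCoord κ x ^ n +
        g (‖x‖ ^ 2) * (n * zCoord κ x ^ (n - 1) * zDir κ i) := by
  have hsm := contDiff_radialMode κ n hg
  have hline : HasDerivAt (fun t : ℝ => x + t • planeBasis i) (planeBasis i) 0 := by
    simpa using ((hasDerivAt_id (0 : ℝ)).smul_const (planeBasis i)).const_add x
  have h1 : HasDerivAt (fun t : ℝ => radialMode κ n g (x + t • planeBasis i))
      (classicalGrad (radialMode κ n g) x i) 0 := by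
    have h := (hsm.differentiable (by simp) (x + (0 : ℝ) • planeBasis i)).hasFDerivAt
    have := h.comp_hasDerivAt (0 : ℝ) hline
    rw [zero_smul, add_zero] at this
    exact this
  have h2 : HasDerivAt (fun t : ℝ => ‖x + t • planeBasis i‖ ^ 2) (2 * x i) 0 := by
    have := hline.norm_sq
    rw [zero_smul, add_zero] at this
    refine this.congr_deriv ?_
    rw [planeBasis, EuclideanSpace.inner_single_right]
    simp
  have h3 : HasDerivAt (fun t : ℝ => ((g (‖x + t • planeBasis i‖ ^ 2) : ℝ) : ℂ))
      ((deriv g (‖x‖ ^ 2) * (2 * x i) : ℝ) : ℂ) 0 := by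
    have hgd : HasDerivAt g (deriv g (‖x‖ ^ 2)) (‖x + (0 : ℝ) • planeBasis i‖ ^ 2) := by
      rw [zero_smul, add_zero]
      exact (hg.differentiable (by simp) _).hasDerivAt
    exact (hgd.comp (0 : ℝ) h2).ofReal_comp
  have h4 : HasDerivAt (fun t : ℝ => zCoord κ (x + t • planeBasis i)) (zDir κ i) 0 := by
    simp only [zCoord_add_smul]
    simpa using ((hasDerivAt_id (0 : ℝ)).ofReal_comp.mul_const (zDir κ i)).const_add (zCoord κ x)
  have h5 := h3.mul (h4.pow n)
  refine h1.unique (h5.congr_deriv ?_)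
  simp

theorem integral_exp_int_mul (j : ℤ) :
    ∫ θ in (0 : ℝ)..(2 * Real.pi), Complex.exp (Complex.I * j * θ) =
      if j = 0 then 2 * (Real.pi : ℂ) else 0 := by
  split_ifs with h
  · simp [h]
  · have hj : Complex.I * j ≠ 0 := mul_ne_zero Complex.I_ne_zero (Int.cast_ne_zero.2 h)
    rw [integral_exp_mul_complex hj]
    have : Complex.exp (Complex.I * j * ((2 * Real.pi : ℝ) : ℂ)) = 1 := by
      rw [Complex.exp_eq_one_iff]
      exact ⟨j, by push_cast; ring⟩
    rw [this]
    simp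

theorem boundaryCoeff_radialMode {κ : ℝ} (hκ : κ = 1 ∨ κ = -1) {n : ℕ} {k : ℤ}
    (hk : (k : ℝ) = κ * n) (g : ℝ → ℝ) :
    boundaryCoeff (radialMode κ n g) = Pi.single k (g 1 : ℂ) := by
  have hk' : (k : ℂ) = κ * n := by exact_mod_cast congrArg (fun x : ℝ => (x : ℂ)) hk
  funext l
  have e : ∀ θ : ℝ, radialMode κ n g (!₂[Real.cos θ, Real.sin θ]) *
      Complex.exp (-(Complex.I * (l : ℂ) * (θ : ℂ))) =
      g 1 * Complex.exp (Complex.I * ((k - l : ℤ) : ℂ) * θ) := by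
    intro θ
    have h1 : (!₂[Real.cos θ, Real.sin θ] : Plane) = polarPoint 1 θ := by simp [polarPoint]
    rw [h1, radialMode, norm_polarPoint zero_le_one, zCoord_polarPoint hκ, Complex.ofReal_one,
      one_mul, one_pow, mul_assoc, ← Complex.exp_nat_mul, ← Complex.exp_add]
    congr 2
    push_cast
    rw [hk']
    ring
  rw [boundaryCoeff]
  simp only [e]
  rw [intervalIntegral.integral_const_mul, integral_exp_int_mul]
  have hpi : (Real.pi : ℂ) ≠ 0 := Complex.ofReal_ne_zero.2 Real.pi_ne_zero
  by_cases h : l = k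
  · subst h
    simp only [sub_self, if_true, Pi.single_eq_same]
    field_simp
  · rw [if_neg (by omega), Pi.single_eq_of_ne h]
    simp

theorem norm_le_add_coords (g : EuclideanSpace ℂ (Fin 2)) : ‖g‖ ≤ ‖g 0‖ + ‖g 1‖ := by
  rw [EuclideanSpace.norm_eq, Fin.sum_univ_two]
  refine Real.sqrt_le_iff.2 ⟨by positivity, ?_⟩
  nlinarith [norm_nonneg (g 0), norm_nonneg (g 1)]

theorem norm_zDir {κ : ℝ} (hκ : κ = 1 ∨ κ = -1) (i : Fin 2) : ‖zDir κ i‖ = 1 := by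
  unfold zDir
  split_ifs
  · simp
  · rcases hκ with rfl | rfl <;> simp

theorem norm_radialMode_le {κ : ℝ} (hκ : κ = 1 ∨ κ = -1) (n : ℕ) {g : ℝ → ℝ} {B : ℝ}
    (hB : ∀ s, |g s| ≤ B) {x : Plane} (hx : x ∈ unitDisc) : ‖radialMode κ n g x‖ ≤ B := by
  have hx1 : ‖x‖ ≤ 1 := (mem_ball_zero_iff.1 hx).le
  rw [radialMode, norm_mul, norm_pow, norm_zCoord hκ, Complex.norm_real, Real.norm_eq_abs]
  exact (mul_le_of_le_one_right (abs_nonneg _) (pow_le_one₀ (norm_nonneg _) hx1)).trans (hB _)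

theorem norm_classicalGrad_radialMode_le {κ : ℝ} (hκ : κ = 1 ∨ κ = -1) (n : ℕ) {g : ℝ → ℝ}
    (hg : ContDiff ℝ ∞ g) {B B' : ℝ} (hB : ∀ s, |g s| ≤ B) (hB' : ∀ s, |deriv g s| ≤ B')
    {x : Plane} (hx : x ∈ unitDisc) :
    ‖classicalGrad (radialMode κ n g) x‖ ≤ 2 * (2 * B' + B * n) := by
  have hx1 : ‖x‖ ≤ 1 := (mem_ball_zero_iff.1 hx).le
  have key : ∀ i, ‖classicalGrad (radialMode κ n g) x i‖ ≤ 2 * B' + B * n := by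
    intro i
    rw [classicalGrad_radialMode κ n hg]
    refine (norm_add_le _ _).trans (add_le_add ?_ ?_)
    · have hxi : |x i| ≤ 1 := (PiLp.norm_apply_le x i).trans hx1
      rw [norm_mul, norm_pow, norm_zCoord hκ, Complex.norm_real, Real.norm_eq_abs, abs_mul,
        abs_mul, abs_two]
      have h1 : ‖x‖ ^ n ≤ 1 := pow_le_one₀ (norm_nonneg _) hx1
      calc |deriv g (‖x‖ ^ 2)| * (2 * |x i|) * ‖x‖ ^ n
          ≤ |deriv g (‖x‖ ^ 2)| * (2 * |x i|) := mul_le_of_le_one_right (by positivity) h1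
        _ ≤ B' * (2 * 1) := by
            refine mul_le_mul (hB' _) (by linarith) (by positivity) ((abs_nonneg _).trans (hB' 0))
        _ = 2 * B' := by ring
    · rw [norm_mul, norm_mul, norm_mul, norm_pow, norm_zCoord hκ, norm_zDir hκ,
        Complex.norm_real, Real.norm_eq_abs, Complex.norm_natCast, mul_one]
      have h1 : ‖x‖ ^ (n - 1) ≤ 1 := pow_le_one₀ (norm_nonneg _) hx1
      exact mul_le_mul (hB _) (mul_le_of_le_one_right (Nat.cast_nonneg n) h1) (by positivity)
        ((abs_nonneg _).trans (hB 0))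
  exact (norm_le_add_coords _).trans (by linarith [key 0, key 1])

/-! ### Modes with a kink in the radial profile -/

/-- A smooth approximation of `max s c`. -/
noncomputable def smoothMax (c ε s : ℝ) : ℝ := c + (s - c + √((s - c) ^ 2 + ε)) / 2

/-- The strict bound holds for every real `s`. It keeps the inverse powers in `kinkProfile` smooth
on all of `ℝ`, with bounds independent of `ε`. -/
theorem smoothMax_gt {c ε : ℝ} (hε : 0 < ε) (s : ℝ) : c < smoothMax c ε s := by
  have : |s - c| < √((s - c) ^ 2 + ε) := by
    rw [← Real.sqrt_sq_eq_abs]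
    exact Real.sqrt_lt_sqrt (sq_nonneg _) (by linarith)
  unfold smoothMax
  linarith [neg_abs_le (s - c)]

theorem contDiff_smoothMax (c : ℝ) {ε : ℝ} (hε : 0 < ε) : ContDiff ℝ ∞ (smoothMax c ε) := by
  unfold smoothMax
  have h : ContDiff ℝ ∞ fun s : ℝ => √((s - c) ^ 2 + ε) := by
    refine ContDiff.sqrt (by fun_prop) fun s => ?_
    positivity
  fun_prop

theorem hasDerivAt_smoothMax (c : ℝ) {ε : ℝ} (hε : 0 < ε) (s : ℝ) :
    HasDerivAt (smoothMax c ε) ((1 + (s - c) / √((s - c) ^ 2 + ε)) / 2) s := by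
  have hne : (s - c) ^ 2 + ε ≠ 0 := by positivity
  have h1 : HasDerivAt (fun s : ℝ => s - c) 1 s := (hasDerivAt_id s).sub_const c
  have h2 := ((h1.pow 2).add_const ε).sqrt hne
  refine (((h1.add h2).div_const 2).const_add c).congr_deriv ?_
  have : √((s - c) ^ 2 + ε) ≠ 0 := by positivity
  simp only [Pi.pow_apply]
  push_cast
  field_simp

theorem abs_deriv_smoothMax_le (c : ℝ) {ε : ℝ} (hε : 0 < ε) (s : ℝ) :
    |(1 + (s - c) / √((s - c) ^ 2 + ε)) / 2| ≤ 1 := by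
  have h0 : 0 < √((s - c) ^ 2 + ε) := by positivity
  have h1 : |s - c| ≤ √((s - c) ^ 2 + ε) := by
    rw [← Real.sqrt_sq_eq_abs]
    exact Real.sqrt_le_sqrt (by linarith)
  have h2 : |(s - c) / √((s - c) ^ 2 + ε)| ≤ 1 := by
    rw [abs_div, abs_of_pos h0]
    exact (div_le_one h0).2 h1
  rw [abs_le] at h2 ⊢
  constructor <;> linarith [h2.1, h2.2]

theorem tendsto_sqrt_sq_add {a : ℝ} {ε : ℕ → ℝ} (hε : Tendsto ε atTop (𝓝 0)) :
    Tendsto (fun j => √(a ^ 2 + ε j)) atTop (𝓝 |a|) := by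
  rw [← Real.sqrt_sq_eq_abs]
  have := (hε.const_add (a ^ 2))
  rw [add_zero] at this
  exact (Real.continuous_sqrt.tendsto _).comp this

theorem tendsto_smoothMax (c s : ℝ) {ε : ℕ → ℝ} (hε : Tendsto ε atTop (𝓝 0)) :
    Tendsto (fun j => smoothMax c (ε j) s) atTop (𝓝 (max s c)) := by
  have h := (((tendsto_sqrt_sq_add (a := s - c) hε).const_add (s - c)).div_const 2).const_add c
  have e : c + (s - c + |s - c|) / 2 = max s c := by
    rcases le_total s c with h | h
    · rw [abs_of_nonpos (by linarith), max_eq_right h]; ring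
    · rw [abs_of_nonneg (by linarith), max_eq_left h]; ring
  rw [e] at h
  exact h

theorem tendsto_deriv_smoothMax {c s : ℝ} (hs : s ≠ c) {ε : ℕ → ℝ} (hε : Tendsto ε atTop (𝓝 0)) :
    Tendsto (fun j => (1 + (s - c) / √((s - c) ^ 2 + ε j)) / 2) atTop
      (𝓝 (if c < s then 1 else 0)) := by
  have hne : |s - c| ≠ 0 := abs_ne_zero.2 (sub_ne_zero.2 hs)
  have h := (((tendsto_const_nhds (x := s - c)).div (tendsto_sqrt_sq_add (a := s - c) hε)
    hne).const_add 1).div_const 2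
  have e : (1 + (s - c) / |s - c|) / 2 = if c < s then 1 else 0 := by
    split_ifs with h
    · rw [abs_of_pos (by linarith), div_self (by linarith)]; norm_num
    · have : s - c < 0 := by
        have := lt_of_le_of_ne (not_lt.1 h) hs
        linarith
      rw [abs_of_neg this, div_neg, div_self this.ne]; norm_num
  rw [e] at h
  exact h

/-- The smooth profile `m⁻ⁿ - c⁻ⁿ`, `m ≈ max s c`. -/
noncomputable def kinkProfile (n : ℕ) (c ε s : ℝ) : ℝ := (smoothMax c ε s ^ n)⁻¹ - (c ^ n)⁻¹

theorem contDiff_kinkProfile (n : ℕ) {c ε : ℝ} (hc : 0 < c) (hε : 0 < ε) :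
    ContDiff ℝ ∞ (kinkProfile n c ε) :=
  (((contDiff_smoothMax c hε).pow n).inv fun s =>
    (pow_pos (hc.trans (smoothMax_gt hε s)) n).ne').sub contDiff_const

theorem hasDerivAt_inv_pow (n : ℕ) {y : ℝ} (hy : 0 < y) :
    HasDerivAt (fun y : ℝ => (y ^ n)⁻¹) (-n * (y ^ (n + 1))⁻¹) y := by
  refine ((hasDerivAt_pow n y).inv (pow_pos hy n).ne').congr_deriv ?_
  cases n with
  | zero => simp
  | succ n =>
    simp only [Nat.add_sub_cancel]
    field_simp
    ring

theorem deriv_kinkProfile (n : ℕ) {c ε : ℝ} (hc : 0 < c) (hε : 0 < ε) (s : ℝ) :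
    deriv (kinkProfile n c ε) s =
      -n * (smoothMax c ε s ^ (n + 1))⁻¹ * ((1 + (s - c) / √((s - c) ^ 2 + ε)) / 2) :=
  (((hasDerivAt_inv_pow n (hc.trans (smoothMax_gt hε s))).comp s
    (hasDerivAt_smoothMax c hε s)).sub_const _).deriv

theorem abs_kinkProfile_le (n : ℕ) {c ε : ℝ} (hc : 0 < c) (hε : 0 < ε) (s : ℝ) :
    |kinkProfile n c ε s| ≤ (c ^ n)⁻¹ := by
  have h1 := smoothMax_gt (c := c) hε s
  have h2 : (smoothMax c ε s ^ n)⁻¹ ≤ (c ^ n)⁻¹ :=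
    inv_anti₀ (pow_pos hc n) (pow_le_pow_left₀ hc.le h1.le n)
  have h3 : 0 < (smoothMax c ε s ^ n)⁻¹ := inv_pos.2 (pow_pos (hc.trans h1) n)
  rw [kinkProfile, abs_le]
  constructor <;> linarith

theorem abs_deriv_kinkProfile_le (n : ℕ) {c ε : ℝ} (hc : 0 < c) (hε : 0 < ε) (s : ℝ) :
    |deriv (kinkProfile n c ε) s| ≤ n * (c ^ (n + 1))⁻¹ := by
  have h1 := smoothMax_gt (c := c) hε s
  have h2 : (smoothMax c ε s ^ (n + 1))⁻¹ ≤ (c ^ (n + 1))⁻¹ :=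
    inv_anti₀ (pow_pos hc _) (pow_le_pow_left₀ hc.le h1.le _)
  have h3 : 0 < (smoothMax c ε s ^ (n + 1))⁻¹ := inv_pos.2 (pow_pos (hc.trans h1) _)
  rw [deriv_kinkProfile n hc hε, abs_mul, abs_mul, abs_neg, Nat.abs_cast, abs_of_pos h3]
  exact (mul_le_of_le_one_right (by positivity) (abs_deriv_smoothMax_le c hε s)).trans
    (mul_le_mul_of_nonneg_left h2 (Nat.cast_nonneg n))

theorem tendsto_kinkProfile (n : ℕ) {c : ℝ} (hc : 0 < c) (s : ℝ) {ε : ℕ → ℝ}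
    (hε : Tendsto ε atTop (𝓝 0)) :
    Tendsto (fun j => kinkProfile n c (ε j) s) atTop (𝓝 ((max s c ^ n)⁻¹ - (c ^ n)⁻¹)) :=
  (((tendsto_smoothMax c s hε).pow n).inv₀ (pow_pos (lt_max_of_lt_right hc) n).ne').sub_const _

theorem tendsto_deriv_kinkProfile (n : ℕ) {c : ℝ} (hc : 0 < c) {s : ℝ} (hs : s ≠ c) {ε : ℕ → ℝ}
    (hε0 : ∀ j, 0 < ε j) (hε : Tendsto ε atTop (𝓝 0)) :
    Tendsto (fun j => deriv (kinkProfile n c (ε j)) s) atTop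
      (𝓝 (-n * (max s c ^ (n + 1))⁻¹ * (if c < s then 1 else 0))) := by
  simp only [fun j => deriv_kinkProfile n hc (hε0 j) s]
  exact ((((tendsto_smoothMax c s hε).pow (n + 1)).inv₀
    (pow_pos (lt_max_of_lt_right hc) _).ne').const_mul _).mul (tendsto_deriv_smoothMax hs hε)

/-- The gradient of the harmonic function `zCoord κ ^ m`. -/
noncomputable def harmonicGrad (κ : ℝ) (m : ℤ) (x : Plane) : EuclideanSpace ℂ (Fin 2) :=
  WithLp.toLp 2 fun i => m * zCoord κ x ^ (m - 1) * zDir κ i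

theorem harmonicGrad_natCast (κ : ℝ) (n : ℕ) (x : Plane) (i : Fin 2) :
    harmonicGrad κ n x i = n * zCoord κ x ^ (n - 1) * zDir κ i := by
  cases n with
  | zero => simp [harmonicGrad]
  | succ n =>
    simp only [harmonicGrad, Nat.add_sub_cancel]
    rw [show ((n + 1 : ℕ) : ℤ) - 1 = (n : ℤ) by push_cast; ring, zpow_natCast]
    push_cast
    rfl

/-- Since `|x|² = z z̄`, one has `|x|⁻²ⁿ zⁿ = z̄⁻ⁿ`. The left side is the product rule for the first
form, the right side the gradient of the second. -/
theorem kink_gradient_identity {κ : ℝ} (hκ : κ = 1 ∨ κ = -1) (n : ℕ) {x : Plane} (hx : x ≠ 0)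
    (i : Fin 2) : ((-n * ((‖x‖ ^ 2) ^ (n + 1))⁻¹ * (2 * x i) : ℝ) : ℂ) * zCoord κ x ^ n +
      (((‖x‖ ^ 2) ^ n)⁻¹ : ℝ) * (n * zCoord κ x ^ (n - 1) * zDir κ i) =
      harmonicGrad (-κ) (-n) x i := by
  have hz : zCoord κ x ≠ 0 := by
    rw [← norm_ne_zero_iff, norm_zCoord hκ]
    exact norm_ne_zero_iff.2 hx
  have hκ' : -κ = 1 ∨ -κ = -1 := by rcases hκ with rfl | rfl <;> simp
  have hz' : zCoord (-κ) x ≠ 0 := by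
    rw [← norm_ne_zero_iff, norm_zCoord hκ']
    exact norm_ne_zero_iff.2 hx
  have hs := zCoord_mul_neg hκ x
  -- The `i`-th derivative of `|x|² = z z̄`, computed in two ways.
  have hx2 : (2 * (x i : ℂ)) = zDir κ i * zCoord (-κ) x + zCoord κ x * zDir (-κ) i := by
    have hI : Complex.I ^ 2 = -1 := Complex.I_sq
    have hk : (κ : ℂ) ^ 2 = 1 := by rcases hκ with rfl | rfl <;> norm_num
    fin_cases i
    · simp [zDir, zCoord]; ring
    · simp [zDir, zCoord]
      linear_combination (2 * (x 1 : ℂ) * κ ^ 2) * hI - (2 * (x 1 : ℂ)) * hk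
  have e : harmonicGrad (-κ) (-n) x i =
      -n * ((zCoord (-κ) x) ^ (n + 1))⁻¹ * zDir (-κ) i := by
    simp only [harmonicGrad]
    rw [show (-(n : ℤ) - 1) = -((n + 1 : ℕ) : ℤ) by push_cast; ring, zpow_neg, zpow_natCast]
    push_cast
    ring
  rw [e]
  push_cast at hs ⊢
  rw [hx2, ← hs]
  cases n with
  | zero => simp
  | succ n =>
    simp only [Nat.add_sub_cancel]
    push_cast
    field_simp
    ring

/-- The mode `(|x|⁻²ⁿ - c⁻ⁿ) 1_{|x|² > c} zⁿ`. -/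
theorem exists_kinkMode {κ : ℝ} (hκ : κ = 1 ∨ κ = -1) {n : ℕ} {k : ℤ} (hk : (k : ℝ) = κ * n)
    {c : ℝ} (hc : 0 < c) (hc1 : c < 1) :
    ∃ U : sobolevH1 unitDisc,
      sobolevFun U =ᵐ[volume.restrict unitDisc] (fun x =>
        (((max (‖x‖ ^ 2) c ^ n)⁻¹ - (c ^ n)⁻¹ : ℝ) : ℂ) * zCoord κ x ^ n) ∧
      sobolevGrad U =ᵐ[volume.restrict unitDisc] (fun x => if c < ‖x‖ ^ 2 then
        harmonicGrad (-κ) (-n) x - (((c ^ n)⁻¹ : ℝ) : ℂ) • harmonicGrad κ n x else 0) ∧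
      HasTrace U (Pi.single k ((1 - (c ^ n)⁻¹ : ℝ) : ℂ)) := by
  set ε : ℕ → ℝ := fun j => 1 / ((j : ℝ) + 1) with hεdef
  have hε0 : ∀ j, 0 < ε j := fun j => by positivity
  have hε : Tendsto ε atTop (𝓝 0) := tendsto_one_div_add_atTop_nhds_zero_nat
  have hsm := fun j => contDiff_kinkProfile n hc (hε0 j)
  set B := (c ^ n)⁻¹
  set B' := n * (c ^ (n + 1))⁻¹
  have hB0 : 0 ≤ B := by positivity
  have hB0' : 0 ≤ B' := by positivity
  -- The derivative of `max s c` jumps on the circle `|x|² = c`, a null set, so the gradients need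
  -- to converge only off it.
  have hsphere : ∀ᵐ x ∂(volume.restrict unitDisc), ‖x‖ ^ 2 ≠ c := by
    refine ae_restrict_of_ae ?_
    have h0 : volume (Metric.sphere (0 : Plane) (√c)) = 0 := Measure.addHaar_sphere _ _ _
    filter_upwards [compl_mem_ae_iff.2 h0] with x hx h
    refine hx ?_
    rw [mem_sphere_zero_iff_norm, ← h, Real.sqrt_sq (norm_nonneg _)]
  have hG : ∀ᵐ x ∂(volume.restrict unitDisc),
      Tendsto (fun j => classicalGrad (radialMode κ n (kinkProfile n c (ε j))) x) atTop
        (𝓝 (if c < ‖x‖ ^ 2 then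
          harmonicGrad (-κ) (-n) x - (((c ^ n)⁻¹ : ℝ) : ℂ) • harmonicGrad κ n x else 0)) := by
    filter_upwards [hsphere] with x hx
    have hx' : ‖x‖ ^ 2 ≠ c := hx
    have h5 := tendsto_deriv_kinkProfile n hc hx' hε0 hε
    have h6 := tendsto_kinkProfile n hc (‖x‖ ^ 2) hε
    have key : ∀ i, Tendsto (fun j => classicalGrad (radialMode κ n (kinkProfile n c (ε j))) x i)
        atTop (𝓝 ((if c < ‖x‖ ^ 2 then harmonicGrad (-κ) (-n) x -
          (((c ^ n)⁻¹ : ℝ) : ℂ) • harmonicGrad κ n x else 0 : EuclideanSpace ℂ (Fin 2)) i)) := by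
      intro i
      simp only [fun j => classicalGrad_radialMode κ n (hsm j) x i]
      have h7 := (((Complex.continuous_ofReal.tendsto _).comp
        (h5.mul_const (2 * x i))).mul_const (zCoord κ x ^ n)).add
        (((Complex.continuous_ofReal.tendsto _).comp h6).mul_const
          (n * zCoord κ x ^ (n - 1) * zDir κ i))
      convert h7 using 2
      · rfl
      split_ifs with h
      · have hx0 : x ≠ 0 := by
          rintro rfl
          simp at h
          linarith
        rw [max_eq_left h.le, PiLp.sub_apply, PiLp.smul_apply, smul_eq_mul,
          ← kink_gradient_identity hκ n hx0, harmonicGrad_natCast]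
        push_cast
        ring
      · rw [max_eq_right (not_lt.1 h)]
        simp
    have := (PiLp.continuous_toLp 2 (fun _ : Fin 2 => ℂ)).tendsto _ |>.comp
      (tendsto_pi_nhds.2 key)
    exact this
  obtain ⟨U, h1, h2, h3⟩ := exists_sobolevH1_limit
    (v := fun j => radialMode κ n (kinkProfile n c (ε j)))
    (fun j => contDiff_radialMode κ n (hsm j))
    (u := fun x => (((max (‖x‖ ^ 2) c ^ n)⁻¹ - (c ^ n)⁻¹ : ℝ) : ℂ) * zCoord κ x ^ n)
    (G := fun x => if c < ‖x‖ ^ 2 then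
        harmonicGrad (-κ) (-n) x - (((c ^ n)⁻¹ : ℝ) : ℂ) • harmonicGrad κ n x else 0)
    (B + 2 * (2 * B' + B * n))
    (fun j x hx => (norm_radialMode_le hκ n (abs_kinkProfile_le n hc (hε0 j)) hx).trans
      (le_add_of_nonneg_right (by positivity)))
    (fun j x hx => (norm_classicalGrad_radialMode_le hκ n (hsm j)
      (abs_kinkProfile_le n hc (hε0 j)) (abs_deriv_kinkProfile_le n hc (hε0 j)) hx).trans
      (le_add_of_nonneg_left hB0))
    (Eventually.of_forall fun x => ((Complex.continuous_ofReal.tendsto _).comp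
      (tendsto_kinkProfile n hc _ hε)).mul_const _) hG
  refine ⟨U, h1, h2, ?_⟩
  -- The approximations are smooth across the unit circle with a single Fourier coefficient, the
  -- profile at `s = 1`. Its limit is `1 - c⁻ⁿ` because `c < 1`.
  refine HasTrace.of_tendsto (fun j => hasTrace_smoothH1 (contDiff_radialMode κ n (hsm j)))
    h3 ?_
  simp only [boundaryCoeff_radialMode hκ hk]
  have h4 := tendsto_kinkProfile n hc 1 hε
  rw [max_eq_left hc1.le, one_pow, inv_one] at h4
  rw [tendsto_pi_nhds]
  intro l
  by_cases hl : l = k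
  · subst hl
    simp only [Pi.single_eq_same]
    exact (Complex.continuous_ofReal.tendsto _).comp h4
  · simp only [Pi.single_eq_of_ne hl]
    exact tendsto_const_nhds

/-! ### Energy of piecewise harmonic modes -/

/-- The pairing of the gradient of `zCoord κ ^ m` with the gradient of `w`. -/
noncomputable def harmonicPairing (κ : ℝ) (m : ℤ) (w : Plane → ℂ) (x : Plane) : ℂ :=
  m * zCoord κ x ^ (m - 1) *
    (fderiv ℝ w x (planeBasis 0) + Complex.I * κ * fderiv ℝ w x (planeBasis 1))

theorem harmonicGrad_pairing (κ : ℝ) (m : ℤ) (w : Plane → ℂ) (x : Plane) :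
    harmonicGrad κ m x 0 * fderiv ℝ w x (planeBasis 0) +
      harmonicGrad κ m x 1 * fderiv ℝ w x (planeBasis 1) = harmonicPairing κ m w x := by
  simp only [harmonicGrad, harmonicPairing, zDir]
  simp
  ring

theorem integrableOn_harmonicPairing_nat (κ : ℝ) (n : ℕ) {w : Plane → ℂ} (hw : ContDiff ℝ ∞ w)
    {s : Set Plane} (hs : s ⊆ unitDisc) : IntegrableOn (harmonicPairing κ n w) s := by
  have e : harmonicPairing κ n w = fun x => n * zCoord κ x ^ (n - 1) *
      (fderiv ℝ w x (planeBasis 0) + Complex.I * κ * fderiv ℝ w x (planeBasis 1)) := by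
    funext x
    have h := harmonicGrad_natCast κ n x 0
    simp only [harmonicGrad, zDir, if_true, mul_one] at h
    rw [harmonicPairing, h]
  have cD : ∀ i, Continuous fun x => fderiv ℝ w x (planeBasis i) := fun i =>
    (hw.continuous_fderiv (by simp)).clm_apply continuous_const
  have c : Continuous (harmonicPairing κ n w) := by
    rw [e]
    exact (continuous_const.mul ((contDiff_zCoord κ).continuous.pow _)).mul
      ((cD 0).add (continuous_const.mul (cD 1)))
  exact (c.continuousOn.integrableOn_compact (isCompact_closedBall (0 : Plane) 1)).mono_set
    (hs.trans Metric.ball_subset_closedBall)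

theorem integrableOn_harmonicPairing {κ : ℝ} (hκ : κ = 1 ∨ κ = -1) (m : ℤ) {w : Plane → ℂ}
    (hw : ContDiff ℝ ∞ w) {a b : ℝ} (ha : 0 < a) :
    IntegrableOn (harmonicPairing κ m w)
      (Metric.ball (0 : Plane) b \ Metric.ball (0 : Plane) a) := by
  have cD : ∀ i, Continuous fun x => fderiv ℝ w x (planeBasis i) := fun i =>
    (hw.continuous_fderiv (by simp)).clm_apply continuous_const
  have c : ContinuousOn (harmonicPairing κ m w)
      (Metric.closedBall (0 : Plane) b \ Metric.ball (0 : Plane) a) := by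
    refine (continuousOn_const.mul ?_).mul
      ((cD 0).add (continuous_const.mul (cD 1))).continuousOn
    refine (contDiff_zCoord κ).continuous.continuousOn.zpow₀ _ fun x hx => Or.inl ?_
    rw [← norm_ne_zero_iff, norm_zCoord hκ]
    have : a ≤ ‖x‖ := by simpa using hx.2
    exact (ha.trans_le this).ne'
  exact (c.integrableOn_compact ((isCompact_closedBall _ _).diff Metric.isOpen_ball)).mono_set
    (Set.sdiff_subset_sdiff_left Metric.ball_subset_closedBall)

/-- On a circle `zⁿ` and `z̄⁻ⁿ` have the same angular factor, so the growing and the decaying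
harmonic test the same moment of `w`. -/
theorem circleMoment_neg_neg (κ : ℝ) (m : ℤ) (w : Plane → ℂ) (r : ℝ) :
    circleMoment (-κ) (-m) w r = circleMoment κ m w r := by
  unfold circleMoment
  congr 1
  funext θ
  congr 1
  rw [zpow_neg, ← inv_zpow, ← Complex.exp_neg]
  congr 2
  push_cast
  ring

/-- The integral of a function that is a combination of the two harmonic pairings. -/
theorem integral_combination_annulus {κ : ℝ} (hκ : κ = 1 ∨ κ = -1) (n : ℕ) {a b : ℝ} (ha : 0 < a)
    (hab : a ≤ b) {w : Plane → ℂ} (hw : ContDiff ℝ ∞ w) (p q : ℂ) :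
    IntegrableOn (fun x => p * harmonicPairing κ n w x + q * harmonicPairing (-κ) (-n) w x)
        (Metric.ball (0 : Plane) b \ Metric.ball (0 : Plane) a) ∧
    ∫ x in Metric.ball (0 : Plane) b \ Metric.ball (0 : Plane) a,
        (p * harmonicPairing κ n w x + q * harmonicPairing (-κ) (-n) w x) =
      n * (p * ((b : ℂ) ^ n * circleMoment κ n w b - (a : ℂ) ^ n * circleMoment κ n w a) -
        q * (((b : ℂ) ^ n)⁻¹ * circleMoment κ n w b - ((a : ℂ) ^ n)⁻¹ * circleMoment κ n w a)) := by
  have hκ' : -κ = 1 ∨ -κ = -1 := by rcases hκ with rfl | rfl <;> simp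
  have i1 := integrableOn_harmonicPairing hκ n hw (b := b) ha
  have i2 := integrableOn_harmonicPairing hκ' (-n) hw (b := b) ha
  refine ⟨(i1.const_mul p).add (i2.const_mul q), ?_⟩
  have g1 := green_annulus hκ n ha.le hab (Or.inl ha) hw
  have g2 := green_annulus hκ' (-n) ha.le hab (Or.inl ha) hw
  rw [integral_add (i1.const_mul p) (i2.const_mul q), integral_const_mul, integral_const_mul]
  simp only [harmonicPairing]
  rw [g1, g2, circleMoment_neg_neg, circleMoment_neg_neg, zpow_neg, zpow_neg, zpow_natCast,
    zpow_natCast]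
  push_cast
  ring

theorem integral_harmonicPairing_ball {κ : ℝ} (hκ : κ = 1 ∨ κ = -1) (n : ℕ) {b : ℝ} (hb : 0 ≤ b)
    {w : Plane → ℂ} (hw : ContDiff ℝ ∞ w) :
    ∫ x in Metric.ball (0 : Plane) b, harmonicPairing κ n w x =
      n * ((b : ℂ) ^ n * circleMoment κ n w b) := by
  have g := green_annulus hκ n le_rfl hb (Or.inr (Int.natCast_nonneg n)) hw
  rw [Metric.ball_zero, Set.sdiff_empty] at g
  simp only [harmonicPairing]
  rw [g]
  rcases n.eq_zero_or_pos with rfl | hn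
  · simp
  · rw [zpow_natCast, zpow_natCast, Complex.ofReal_zero, zero_pow hn.ne']
    push_cast
    ring

theorem energyForm_annular_smooth {α : ℝ} (R : ℝ) {u : sobolevH1 unitDisc}
    {G : Plane → EuclideanSpace ℂ (Fin 2)} (hG : sobolevGrad u =ᵐ[volume.restrict unitDisc] G)
    {v : Plane → ℂ} (hv : ContDiff ℝ ∞ v) :
    energyForm (annularConductivity α R) u (smoothH1 v hv) =
      ∫ x in unitDisc, (annularWeight α R x : ℂ) *
        (G x 0 * fderiv ℝ (fun y => (starRingEnd ℂ) (v y)) x (planeBasis 0) +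
          G x 1 * fderiv ℝ (fun y => (starRingEnd ℂ) (v y)) x (planeBasis 1)) := by
  rw [energyForm]
  refine integral_congr_ae ?_
  filter_upwards [hG, sobolevGrad_smoothH1 hv] with x h1 h2
  have hd : ∀ i, fderiv ℝ (fun y => (starRingEnd ℂ) (v y)) x (planeBasis i) =
      (starRingEnd ℂ) (fderiv ℝ v x (planeBasis i)) := by
    intro i
    have := (Complex.conjCLE.toContinuousLinearMap.hasFDerivAt (x := v x)).comp x
      (hv.differentiable (by simp) x).hasFDerivAt
    have h3 : fderiv ℝ (fun y => (starRingEnd ℂ) (v y)) x = _ := this.fderiv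
    rw [h3]
    rfl
  rw [h1, h2, annularConductivity_eq, hd, hd]
  simp [Fin.sum_univ_two, classicalGrad_apply]
  ring

/-- The energy of a field that is a combination of harmonic fields in each of the three regions
`|x| < R²`, `R² < |x| < R`, `R < |x| < 1`. -/
theorem energyForm_piecewise {α R : ℝ} (hR0 : 0 < R) (hR1 : R < 1) {κ : ℝ} (hκ : κ = 1 ∨ κ = -1)
    (n : ℕ) {u : sobolevH1 unitDisc} {G : Plane → EuclideanSpace ℂ (Fin 2)}
    (hG : sobolevGrad u =ᵐ[volume.restrict unitDisc] G) {a₁ a₂ b₂ a₃ b₃ : ℂ}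
    (h₁ : ∀ x, ‖x‖ < R ^ 2 → G x = a₁ • harmonicGrad κ n x)
    (h₂ : ∀ x, R ^ 2 < ‖x‖ → ‖x‖ < R →
      G x = a₂ • harmonicGrad κ n x + b₂ • harmonicGrad (-κ) (-n) x)
    (h₃ : ∀ x, R < ‖x‖ → G x = a₃ • harmonicGrad κ n x + b₃ • harmonicGrad (-κ) (-n) x)
    {v : Plane → ℂ} (hv : ContDiff ℝ ∞ v) {W : ℝ → ℂ}
    (hW : W = circleMoment κ n (fun y => (starRingEnd ℂ) (v y))) :
    energyForm (annularConductivity α R) u (smoothH1 v hv) =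
      n * (a₁ * ((R ^ 2) ^ n * W (R ^ 2)) +
        (1 + α) * (a₂ * (R ^ n * W R - (R ^ 2) ^ n * W (R ^ 2)) -
          b₂ * ((R ^ n : ℂ)⁻¹ * W R - ((R ^ 2) ^ n : ℂ)⁻¹ * W (R ^ 2))) +
        (a₃ * (W 1 - R ^ n * W R) - b₃ * (W 1 - (R ^ n : ℂ)⁻¹ * W R))) := by
  have hRR : R ^ 2 < R := by nlinarith
  have hR20 : 0 < R ^ 2 := by positivity
  set w : Plane → ℂ := fun y => (starRingEnd ℂ) (v y) with hw
  have hwc : ContDiff ℝ ∞ w := Complex.conjCLE.contDiff.comp hv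
  rw [energyForm_annular_smooth R hG hv]
  set F : Plane → ℂ := fun x => (annularWeight α R x : ℂ) *
        (G x 0 * fderiv ℝ w x (planeBasis 0) + G x 1 * fderiv ℝ w x (planeBasis 1)) with hF
  set D₁ := Metric.ball (0 : Plane) (R ^ 2)
  set D₂ := Metric.ball (0 : Plane) R \ Metric.ball (0 : Plane) (R ^ 2)
  set D₃ := Metric.ball (0 : Plane) 1 \ Metric.ball (0 : Plane) R
  have m₁ : MeasurableSet D₁ := Metric.isOpen_ball.measurableSet
  have m₂ : MeasurableSet D₂ := Metric.isOpen_ball.measurableSet.diff m₁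
  have m₃ : MeasurableSet D₃ :=
    Metric.isOpen_ball.measurableSet.diff Metric.isOpen_ball.measurableSet
  have hs : ∀ r : ℝ, ∀ᵐ x : Plane, ‖x‖ ≠ r := by
    intro r
    have h0 : volume (Metric.sphere (0 : Plane) r) = 0 := Measure.addHaar_sphere _ _ _
    filter_upwards [compl_mem_ae_iff.2 h0] with x hx h
    exact hx (mem_sphere_zero_iff_norm.2 h)
  have e₁ : F =ᵐ[volume.restrict D₁] fun x => a₁ * harmonicPairing κ n w x := by
    filter_upwards [ae_restrict_mem m₁] with x hx
    have hx' : ‖x‖ < R ^ 2 := mem_ball_zero_iff.1 hx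
    have hwt : annularWeight α R x = 1 := by
      simp only [annularWeight, Set.mem_sdiff, mem_ball_zero_iff]
      rw [if_neg (by tauto)]
    simp only [hF]
    rw [hwt, h₁ x hx', ← harmonicGrad_pairing]
    simp only [PiLp.smul_apply, smul_eq_mul]
    push_cast
    ring
  have e₂ : F =ᵐ[volume.restrict D₂] fun x => ((1 + α) * a₂) * harmonicPairing κ n w x +
      ((1 + α) * b₂) * harmonicPairing (-κ) (-n) w x := by
    filter_upwards [ae_restrict_mem m₂, ae_restrict_of_ae (hs (R ^ 2))] with x hx hne
    have hx1 : ‖x‖ < R := mem_ball_zero_iff.1 hx.1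
    have hx2 : R ^ 2 ≤ ‖x‖ := by
      have := hx.2
      rwa [mem_ball_zero_iff, not_lt] at this
    have hwt : annularWeight α R x = 1 + α := if_pos hx
    simp only [hF]
    rw [hwt, h₂ x (lt_of_le_of_ne hx2 (Ne.symm hne)) hx1, ← harmonicGrad_pairing,
      ← harmonicGrad_pairing]
    simp only [PiLp.add_apply, PiLp.smul_apply, smul_eq_mul]
    push_cast
    ring
  have e₃ : F =ᵐ[volume.restrict D₃] fun x => a₃ * harmonicPairing κ n w x +
      b₃ * harmonicPairing (-κ) (-n) w x := by
    filter_upwards [ae_restrict_mem m₃, ae_restrict_of_ae (hs R)] with x hx hne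
    have hx2 : R ≤ ‖x‖ := by
      have := hx.2
      rwa [mem_ball_zero_iff, not_lt] at this
    have hwt : annularWeight α R x = 1 := by
      simp only [annularWeight, Set.mem_sdiff, mem_ball_zero_iff]
      rw [if_neg (by intro h; linarith [h.1])]
    simp only [hF]
    rw [hwt, h₃ x (lt_of_le_of_ne hx2 (Ne.symm hne)), ← harmonicGrad_pairing,
      ← harmonicGrad_pairing]
    simp only [PiLp.add_apply, PiLp.smul_apply, smul_eq_mul]
    push_cast
    ring
  have i₁ : IntegrableOn F D₁ := ((integrableOn_harmonicPairing_nat κ n hwc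
    (Metric.ball_subset_ball (by nlinarith))).const_mul a₁).congr e₁.symm
  obtain ⟨j₂, k₂⟩ := integral_combination_annulus hκ n hR20 hRR.le hwc
    ((1 + α) * a₂) ((1 + α) * b₂)
  obtain ⟨j₃, k₃⟩ := integral_combination_annulus hκ n hR0 hR1.le hwc a₃ b₃
  have i₂ : IntegrableOn F D₂ := j₂.congr e₂.symm
  have i₃ : IntegrableOn F D₃ := j₃.congr e₃.symm
  have s12 : D₁ ∪ D₂ = Metric.ball (0 : Plane) R :=
    Set.union_sdiff_cancel (Metric.ball_subset_ball hRR.le)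
  have s3 : (D₁ ∪ D₂) ∪ D₃ = unitDisc := by
    rw [s12]
    exact Set.union_sdiff_cancel (Metric.ball_subset_ball hR1.le)
  have d12 : Disjoint D₁ D₂ := Set.disjoint_sdiff_right
  have d3 : Disjoint (D₁ ∪ D₂) D₃ := by
    rw [s12]
    exact Set.disjoint_sdiff_right
  rw [← s3, setIntegral_union d3 m₃ (i₁.union i₂) i₃, setIntegral_union d12 m₂ i₁ i₂,
    integral_congr_ae e₁, integral_congr_ae e₂, integral_congr_ae e₃, k₂, k₃, integral_const_mul,
    integral_harmonicPairing_ball hκ n hR20.le hwc, ← hW]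
  push_cast
  simp only [one_pow, inv_one, one_mul]
  ring

/-! ### Solutions with a single Fourier mode on the boundary -/

/-- A mode dominated by `|x|ⁿ` concentrates near the circle. The resulting decay `1/(n+1)` makes the
`L²` norms summable against `H^{1/2}` data in `summable_norm_fun`. -/
theorem norm_sq_sobolevFun_le {u : sobolevH1 unitDisc} {C : ℝ} {n : ℕ}
    (h : ∀ᵐ x ∂(volume.restrict unitDisc), ‖sobolevFun u x‖ ≤ C * ‖x‖ ^ n) :
    ‖sobolevFun u‖ ^ 2 ≤ C ^ 2 * (Real.pi / (n + 1)) := by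
  have hf : Integrable (fun x => ‖sobolevFun u x‖ ^ 2) (volume.restrict unitDisc) :=
    (Lp.memLp (sobolevFun u)).integrable_norm_pow (by norm_num)
  have e1 : ‖sobolevFun u‖ ^ 2 = ∫ x in unitDisc, ‖sobolevFun u x‖ ^ 2 := by
    rw [← norm_sq_eq_re_inner_self, L2.inner_def]
    have : ∀ x, (inner ℂ (sobolevFun u x) (sobolevFun u x)) =
        ((‖sobolevFun u x‖ ^ 2 : ℝ) : ℂ) := fun x => by
      rw [inner_self_eq_norm_sq_to_K]; push_cast; rfl
    simp only [this]
    rw [integral_complex_ofReal]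
    exact Complex.ofReal_re _
  have e2 : ∫ x in unitDisc, ‖x‖ ^ (2 * n) = Real.pi / (n + 1) := by
    have h := integral_unitDisc_norm_pow n
    simp only [← Complex.ofReal_pow] at h
    rw [integral_complex_ofReal] at h
    exact_mod_cast h
  have hi : IntegrableOn (fun x : Plane => ‖x‖ ^ (2 * n)) unitDisc :=
    ((continuous_norm.pow _).continuousOn.integrableOn_compact
      (isCompact_closedBall (0 : Plane) 1)).mono_set Metric.ball_subset_closedBall
  rw [e1, ← e2, ← integral_const_mul]
  refine integral_mono_ae hf (hi.const_mul _) ?_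
  filter_upwards [h] with x hx
  calc ‖sobolevFun u x‖ ^ 2 ≤ (C * ‖x‖ ^ n) ^ 2 := pow_le_pow_left₀ (norm_nonneg _) hx 2
    _ = C ^ 2 * ‖x‖ ^ (2 * n) := by ring

theorem classicalGrad_radialMode_one (κ : ℝ) (n : ℕ) (x : Plane) :
    classicalGrad (radialMode κ n fun _ => 1) x = harmonicGrad κ n x := by
  ext i
  rw [classicalGrad_radialMode κ n contDiff_const, harmonicGrad_natCast]
  simp

/-! ### Coefficients of the transmission problem -/

/-- The trace normalisation of the mode that solves the transmission problem;
`t = R ^ (2 * |k|)`. -/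
noncomputable def transmissionDenom (α t : ℝ) : ℝ :=
  2 + α + α * t ^ 2 + α * (1 - t) + α ^ 2 * (1 - t) ^ 2 / 2

theorem two_le_transmissionDenom {α t : ℝ} (hα : 0 ≤ α) (ht : t ≤ 1) :
    2 ≤ transmissionDenom α t := by
  unfold transmissionDenom
  have : 0 ≤ α * (1 - t) := mul_nonneg hα (by linarith)
  have : 0 ≤ α * t ^ 2 := by positivity
  have : 0 ≤ α ^ 2 * (1 - t) ^ 2 / 2 := by positivity
  linarith

/-- The eigenvalue of the Dirichlet-to-Neumann map of the annular conductivity on the `k`-th Fourier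
mode. -/
noncomputable def dnEigen (α R : ℝ) (k : ℤ) : ℝ :=
  k.natAbs * (1 + α * (2 + α) * (R ^ (2 * k.natAbs) * (1 - R ^ (2 * k.natAbs))) /
    transmissionDenom α (R ^ (2 * k.natAbs)))

/-- Here `p = R^n`, and `W₁`, `W₂`, `W₃` are the moments at radii `R²`, `R`, `1`. Continuity of the
flux at `R²` fixes the ratio `B / A`, and at `R` it then fixes `M`; these are exactly the conditions
under which `W₁` and `W₂` drop out. -/
theorem transmission_balance {α p a W₁ W₂ W₃ : ℂ} (hp : p ≠ 0) (t A B M a₃ b₃ : ℂ) (ht : t = p ^ 2)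
    (hA : A = a * (2 + 2 * α)) (hB : B = a * (α * t ^ 2))
    (hM : M = a * (-(α * (1 + α)) * t + α ^ 2 * (t ^ 2 + t) / 2))
    (h₃ : a₃ = A - B * (t ^ 2)⁻¹ - M * t⁻¹) (hb₃ : b₃ = B + M) :
    A * (t * W₁) + (1 + α) * ((A - B * (t ^ 2)⁻¹) * (p * W₂ - t * W₁) -
      B * (p⁻¹ * W₂ - t⁻¹ * W₁)) + (a₃ * (W₃ - p * W₂) - b₃ * (W₃ - p⁻¹ * W₂)) =
      a * (2 + α - α * t ^ 2 + α * (1 + t) + α ^ 2 * (1 - t ^ 2) / 2) * W₃ := by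
  subst h₃ hb₃ hA hB hM ht
  field_simp
  ring

theorem continuous_energyForm_annular {α : ℝ} (hα : 0 ≤ α) (R : ℝ) (u : sobolevH1 unitDisc) :
    Continuous fun v => energyForm (annularConductivity α R) u v := by
  simp only [energyForm_annular hα]
  exact (sobolevGradL unitDisc).continuous.inner continuous_const

/-- The coefficient of the harmonic mode in the transmission problem. -/
noncomputable def coreCoeff (α t : ℝ) : ℝ := (transmissionDenom α t)⁻¹ * (2 + 2 * α)

/-- The strength of the kink on the inner circle in the transmission problem. -/
noncomputable def innerKink (α t : ℝ) : ℝ := (transmissionDenom α t)⁻¹ * (α * t ^ 2)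

/-- The strength of the kink on the outer circle in the transmission problem. -/
noncomputable def outerKink (α t : ℝ) : ℝ :=
  (transmissionDenom α t)⁻¹ * (-(α * (1 + α)) * t + α ^ 2 * (t ^ 2 + t) / 2)

/-- The three terms are the boundary values of the monomial and of the two kink modes; the
denominator is chosen to make them add up to `1`. -/
theorem transmission_trace {α t : ℝ} (hα : 0 ≤ α) (ht0 : 0 < t) (ht1 : t ≤ 1) :
    coreCoeff α t + innerKink α t * (1 - (t ^ 2)⁻¹) + outerKink α t * (1 - t⁻¹) = 1 := by
  have hne : transmissionDenom α t ≠ 0 := by linarith [two_le_transmissionDenom hα ht1]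
  have e : coreCoeff α t + innerKink α t * (1 - (t ^ 2)⁻¹) + outerKink α t * (1 - t⁻¹) =
      (transmissionDenom α t)⁻¹ * (2 + 2 * α + α * t ^ 2 * (1 - (t ^ 2)⁻¹) +
        (-(α * (1 + α)) * t + α ^ 2 * (t ^ 2 + t) / 2) * (1 - t⁻¹)) := by
    rw [coreCoeff, innerKink, outerKink]
    ring
  rw [e, inv_mul_eq_one₀ hne, transmissionDenom]
  field_simp
  ring

theorem abs_coreCoeff_le {α t : ℝ} (hα : 0 ≤ α) (ht1 : t ≤ 1) : |coreCoeff α t| ≤ 2 + 2 * α := by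
  have hN2 := two_le_transmissionDenom hα ht1
  rw [coreCoeff, abs_of_nonneg (by positivity)]
  exact mul_le_of_le_one_left (by positivity) (inv_le_one_of_one_le₀ (by linarith))

/-- The kink mode on the inner circle has amplitude up to `t⁻²`, which is unbounded in the
frequency. The factor `t²` in its strength compensates exactly; the outer kink behaves likewise with
`t⁻¹`. -/
theorem abs_innerKink_le {α t : ℝ} (hα : 0 ≤ α) (ht0 : 0 < t) (ht1 : t ≤ 1) :
    |innerKink α t| * (t ^ 2)⁻¹ ≤ α := by
  have hN2 := two_le_transmissionDenom hα ht1
  rw [innerKink, abs_of_nonneg (by positivity), ← mul_assoc, mul_assoc,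
    mul_inv_cancel₀ (by positivity), mul_one]
  exact mul_le_of_le_one_left hα (inv_le_one_of_one_le₀ (by linarith))

theorem abs_outerKink_le {α t : ℝ} (hα : 0 ≤ α) (ht0 : 0 < t) (ht1 : t ≤ 1) :
    |outerKink α t| * t⁻¹ ≤ α * (1 + α) + α ^ 2 := by
  have hN2 := two_le_transmissionDenom hα ht1
  have hN0 : 0 < (transmissionDenom α t)⁻¹ := by positivity
  have e : -(α * (1 + α)) * t + α ^ 2 * (t ^ 2 + t) / 2 =
      (-(α * (1 + α)) + α ^ 2 * (t + 1) / 2) * t := by ring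
  rw [outerKink, e, abs_mul, abs_mul, abs_of_pos hN0, abs_of_pos ht0, ← mul_assoc, mul_assoc,
    mul_inv_cancel₀ ht0.ne', mul_one]
  refine (mul_le_of_le_one_left (abs_nonneg _) (inv_le_one_of_one_le₀ (by linarith))).trans ?_
  have q1 : 0 ≤ α ^ 2 * (1 - t) := mul_nonneg (sq_nonneg _) (by linarith)
  have q2 : 0 ≤ α ^ 2 * t := by positivity
  rw [abs_le]
  constructor <;> nlinarith

/-- The gradient field of the solution of the transmission problem. -/
noncomputable def transmissionField (α R κ : ℝ) (n : ℕ) (x : Plane) : EuclideanSpace ℂ (Fin 2) :=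
  (coreCoeff α (R ^ (2 * n)) : ℂ) • harmonicGrad κ n x +
    (innerKink α (R ^ (2 * n)) : ℂ) • (if R ^ 4 < ‖x‖ ^ 2 then harmonicGrad (-κ) (-n) x -
      ((((R ^ (2 * n)) ^ 2)⁻¹ : ℝ) : ℂ) • harmonicGrad κ n x else 0) +
    (outerKink α (R ^ (2 * n)) : ℂ) • (if R ^ 2 < ‖x‖ ^ 2 then harmonicGrad (-κ) (-n) x -
      (((R ^ (2 * n))⁻¹ : ℝ) : ℂ) • harmonicGrad κ n x else 0)

/-- Each summand is continuous across the interfaces, so membership in `H¹` and the trace are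
inherited by linearity. The flux conditions play no role yet; they enter in the energy computation.
-/
theorem exists_transmissionMode {α R : ℝ} (hα : 0 ≤ α) (hR0 : 0 < R) (hR1 : R < 1) {κ : ℝ}
    (hκ : κ = 1 ∨ κ = -1) {n : ℕ} {k : ℤ} (hk : (k : ℝ) = κ * n) :
    ∃ E : sobolevH1 unitDisc, HasTrace E (Pi.single k 1) ∧
      ‖sobolevFun E‖ ^ 2 ≤ (2 * (1 + α) ^ 2) ^ 2 * (Real.pi / (n + 1)) ∧
      sobolevGrad E =ᵐ[volume.restrict unitDisc] transmissionField α R κ n := by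
  have ht0 : 0 < R ^ (2 * n) := pow_pos hR0 _
  have ht1 : R ^ (2 * n) ≤ 1 := pow_le_one₀ hR0.le hR1.le
  have hNsum := transmission_trace hα ht0 ht1
  have ha := abs_coreCoeff_le hα ht1
  have hb := abs_innerKink_le hα ht0 ht1
  have hm := abs_outerKink_le hα ht0 ht1
  have hc4 : (R ^ 4) ^ n = (R ^ (2 * n)) ^ 2 := by ring
  have hc2 : (R ^ 2) ^ n = R ^ (2 * n) := by ring
  unfold transmissionField
  generalize coreCoeff α (R ^ (2 * n)) = A at *
  generalize innerKink α (R ^ (2 * n)) = B at *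
  generalize outerKink α (R ^ (2 * n)) = M at *
  generalize R ^ (2 * n) = t at *
  obtain ⟨U, U1, U2, U3⟩ := exists_kinkMode hκ (n := n) (k := k) hk (c := R ^ 4) (by positivity)
    (pow_lt_one₀ hR0.le hR1 (by norm_num))
  obtain ⟨V, V1, V2, V3⟩ := exists_kinkMode hκ (n := n) (k := k) hk (c := R ^ 2) (by positivity)
    (pow_lt_one₀ hR0.le hR1 (by norm_num))
  rw [hc4] at U1 U2 U3
  rw [hc2] at V1 V2 V3
  have hS : ContDiff ℝ ∞ (radialMode κ n fun _ => 1) := contDiff_radialMode κ n contDiff_const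
  set S := smoothH1 (radialMode κ n fun _ => 1) hS with hSdef
  set E : sobolevH1 unitDisc := (A : ℂ) • S + (B : ℂ) • U + (M : ℂ) • V with hE
  have hfun : sobolevFun E =ᵐ[volume.restrict unitDisc] fun x =>
      ((A + B * ((max (‖x‖ ^ 2) (R ^ 4) ^ n)⁻¹ - (t ^ 2)⁻¹) +
        M * ((max (‖x‖ ^ 2) (R ^ 2) ^ n)⁻¹ - t⁻¹) : ℝ) : ℂ) * zCoord κ x ^ n := by
    have e : sobolevFun E =
        (A : ℂ) • sobolevFun S + (B : ℂ) • sobolevFun U + (M : ℂ) • sobolevFun V := rfl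
    rw [e]
    filter_upwards [Lp.coeFn_add ((A : ℂ) • sobolevFun S + (B : ℂ) • sobolevFun U)
      ((M : ℂ) • sobolevFun V), Lp.coeFn_add ((A : ℂ) • sobolevFun S) ((B : ℂ) • sobolevFun U),
      Lp.coeFn_smul (A : ℂ) (sobolevFun S), Lp.coeFn_smul (B : ℂ) (sobolevFun U),
      Lp.coeFn_smul (M : ℂ) (sobolevFun V), sobolevFun_smoothH1 hS, U1, V1]
      with x h1 h2 h3 h4 h5 h6 h7 h8
    rw [h1, Pi.add_apply, h2, Pi.add_apply, h3, h4, h5, Pi.smul_apply, Pi.smul_apply,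
      Pi.smul_apply, h6, h7, h8, radialMode]
    simp only [smul_eq_mul]
    push_cast
    ring
  have hgrad : sobolevGrad E =ᵐ[volume.restrict unitDisc] fun x => (A : ℂ) • harmonicGrad κ n x +
    (B : ℂ) • (if R ^ 4 < ‖x‖ ^ 2 then
      harmonicGrad (-κ) (-n) x - (((t ^ 2)⁻¹ : ℝ) : ℂ) • harmonicGrad κ n x else 0) +
    (M : ℂ) • (if R ^ 2 < ‖x‖ ^ 2 then
      harmonicGrad (-κ) (-n) x - ((t⁻¹ : ℝ) : ℂ) • harmonicGrad κ n x else 0) := by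
    have e : sobolevGrad E =
        (A : ℂ) • sobolevGrad S + (B : ℂ) • sobolevGrad U + (M : ℂ) • sobolevGrad V := rfl
    rw [e]
    filter_upwards [Lp.coeFn_add ((A : ℂ) • sobolevGrad S + (B : ℂ) • sobolevGrad U)
      ((M : ℂ) • sobolevGrad V), Lp.coeFn_add ((A : ℂ) • sobolevGrad S) ((B : ℂ) • sobolevGrad U),
      Lp.coeFn_smul (A : ℂ) (sobolevGrad S), Lp.coeFn_smul (B : ℂ) (sobolevGrad U),
      Lp.coeFn_smul (M : ℂ) (sobolevGrad V), sobolevGrad_smoothH1 hS, U2, V2]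
      with x h1 h2 h3 h4 h5 h6 h7 h8
    rw [h1, Pi.add_apply, h2, Pi.add_apply, h3, h4, h5, Pi.smul_apply, Pi.smul_apply,
      Pi.smul_apply, h6, h7, h8, classicalGrad_radialMode_one]
  refine ⟨E, ?_, ?_, hgrad⟩
  · have h := (((hasTrace_smoothH1 hS).smul (A : ℂ)).add (U3.smul (B : ℂ))).add (V3.smul (M : ℂ))
    rw [boundaryCoeff_radialMode hκ hk] at h
    convert h using 1
    rw [← Pi.single_smul, ← Pi.single_smul, ← Pi.single_smul, ← Pi.single_add, ← Pi.single_add]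
    congr 1
    have hc := congrArg (fun r : ℝ => (r : ℂ)) hNsum
    push_cast at hc ⊢
    simp only [smul_eq_mul]
    linear_combination -hc
  · refine norm_sq_sobolevFun_le ?_
    filter_upwards [hfun] with x hx
    rw [hx, norm_mul, norm_pow, norm_zCoord hκ, Complex.norm_real, Real.norm_eq_abs]
    refine mul_le_mul_of_nonneg_right ?_ (by positivity)
    have key : ∀ {c q : ℝ}, 0 < c → c ^ n = q →
        |(max (‖x‖ ^ 2) c ^ n)⁻¹ - q⁻¹| ≤ q⁻¹ := by
      rintro c q hc rfl
      have h2 : (max (‖x‖ ^ 2) c ^ n)⁻¹ ≤ (c ^ n)⁻¹ :=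
        inv_anti₀ (pow_pos hc n) (pow_le_pow_left₀ hc.le (le_max_right _ _) n)
      have h3 : 0 < (max (‖x‖ ^ 2) c ^ n)⁻¹ := inv_pos.2 (pow_pos (lt_max_of_lt_right hc) n)
      rw [abs_le]
      constructor <;> linarith
    have k1 := mul_le_mul_of_nonneg_left (key (by positivity) hc4) (abs_nonneg B)
    have k2 := mul_le_mul_of_nonneg_left (key (by positivity) hc2) (abs_nonneg M)
    rw [← abs_mul] at k1 k2
    refine (abs_add_le _ _).trans ((add_le_add_left (abs_add_le _ _) _).trans ?_)
    -- The three bounds add up to `(2 + 2α) + α + (α(1 + α) + α²) = 2(1 + α)²`.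
    nlinarith

theorem energyForm_transmissionField {α R : ℝ} (hα : 0 ≤ α) (hR0 : 0 < R) (hR1 : R < 1) {κ : ℝ}
    (hκ : κ = 1 ∨ κ = -1) {n : ℕ} {k : ℤ} (hk : (k : ℝ) = κ * n) {E : sobolevH1 unitDisc}
    (hE : sobolevGrad E =ᵐ[volume.restrict unitDisc] transmissionField α R κ n)
    {v : Plane → ℂ} (hv : ContDiff ℝ ∞ v) :
    energyForm (annularConductivity α R) E (smoothH1 v hv) =
      2 * Real.pi * ((n * (1 + α * (2 + α) * (R ^ (2 * n) * (1 - R ^ (2 * n))) /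
        transmissionDenom α (R ^ (2 * n))) : ℝ) : ℂ) * (starRingEnd ℂ) (boundaryCoeff v k) := by
  set t := R ^ (2 * n) with ht
  set N := transmissionDenom α t with hN
  have ht0 : 0 < t := pow_pos hR0 _
  have hp0 : R ^ n ≠ 0 := (pow_pos hR0 n).ne'
  have ht1 : t ≤ 1 := pow_le_one₀ hR0.le hR1.le
  have hN0 : N ≠ 0 := by linarith [two_le_transmissionDenom hα ht1]
  have hR2 : ∀ x : Plane, R ^ 2 < ‖x‖ ↔ R ^ 4 < ‖x‖ ^ 2 := fun x => by
    rw [show R ^ 4 = (R ^ 2) ^ 2 by ring]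
    exact (pow_lt_pow_iff_left₀ (by positivity) (norm_nonneg _) two_ne_zero).symm
  have hR : ∀ x : Plane, R < ‖x‖ ↔ R ^ 2 < ‖x‖ ^ 2 := fun x =>
    (pow_lt_pow_iff_left₀ hR0.le (norm_nonneg _) two_ne_zero).symm
  have hRR : R ^ 2 < R := by nlinarith
  have h := energyForm_piecewise (α := α) hR0 hR1 hκ n hE (a₁ := coreCoeff α t)
    (a₂ := coreCoeff α t - innerKink α t * ((t : ℂ) ^ 2)⁻¹) (b₂ := innerKink α t)
    (a₃ := coreCoeff α t - innerKink α t * ((t : ℂ) ^ 2)⁻¹ - outerKink α t * (t : ℂ)⁻¹)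
    (b₃ := innerKink α t + outerKink α t) ?_ ?_ ?_ hv rfl
  · have htC : ((R : ℂ) ^ 2) ^ n = t := by rw [ht]; push_cast; ring
    rw [h, circleMoment_one (by exact_mod_cast hk), htC]
    rw [transmission_balance (α := α) (a := (N : ℂ)⁻¹) (by exact_mod_cast hp0) t
      (coreCoeff α t) (innerKink α t) (outerKink α t) _ _
      (by rw [ht]; push_cast; ring) (by rw [coreCoeff]; push_cast; rfl)
      (by rw [innerKink]; push_cast; rfl) (by rw [outerKink]; push_cast; rfl) rfl rfl]
    have hN0' : (N : ℂ) ≠ 0 := by exact_mod_cast hN0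
    have hNe : (N : ℂ) = 2 + α + α * t ^ 2 + α * (1 - t) + α ^ 2 * (1 - t) ^ 2 / 2 := by
      rw [hN, transmissionDenom]; push_cast; rfl
    push_cast
    field_simp
    rw [hNe]
    ring
  · intro x hx
    rw [transmissionField, if_neg (by rw [← hR2]; linarith), if_neg (by rw [← hR]; linarith)]
    simp [ht]
  · intro x h1 h2
    rw [transmissionField, if_pos ((hR2 x).1 h1), if_neg (by rw [← hR]; linarith), ← ht]
    push_cast
    module
  · intro x hx
    rw [transmissionField, if_pos ((hR2 x).1 (hRR.trans hx)), if_pos ((hR x).1 hx), ← ht]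
    push_cast
    module

/-- Both sides of the energy identity are continuous in the pair of `v` and its trace, so smooth `v`
suffice. With `c = 0` the identity says that the mode is a weak solution. -/
theorem exists_dnMode {α R : ℝ} (hα : 0 ≤ α) (hR0 : 0 < R) (hR1 : R < 1) (k : ℤ) :
    ∃ E : sobolevH1 unitDisc, HasTrace E (Pi.single k 1) ∧
      ‖sobolevFun E‖ ^ 2 ≤ (2 * (1 + α) ^ 2) ^ 2 * (Real.pi / (k.natAbs + 1)) ∧
      ∀ v c, HasTrace v c → energyForm (annularConductivity α R) E v =
        2 * Real.pi * dnEigen α R k * (starRingEnd ℂ) (c k) := by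
  -- `κ` is the sign of `k`, selecting `z` or `z̄` so that only nonnegative powers occur in the
  -- core; for `k = 0` either choice works.
  obtain ⟨κ, hκ, hk⟩ : ∃ κ : ℝ, (κ = 1 ∨ κ = -1) ∧ (k : ℝ) = κ * k.natAbs := by
    rcases Int.natAbs_eq k with h | h
    · refine ⟨1, Or.inl rfl, ?_⟩
      rw [one_mul, ← Int.cast_natCast, ← h]
    · refine ⟨-1, Or.inr rfl, ?_⟩
      rw [neg_one_mul, ← Int.cast_natCast, ← Int.cast_neg, ← h]
  obtain ⟨E, h1, h2, h3⟩ := exists_transmissionMode hα hR0 hR1 hκ hk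
  refine ⟨E, h1, h2, fun v c hv => ?_⟩
  have c1 : Continuous fun q : sobolevH1 unitDisc × (ℤ → ℂ) =>
      energyForm (annularConductivity α R) E q.1 :=
    (continuous_energyForm_annular hα R E).comp continuous_fst
  have c2 : Continuous fun q : sobolevH1 unitDisc × (ℤ → ℂ) =>
      2 * Real.pi * (dnEigen α R k : ℂ) * (starRingEnd ℂ) (q.2 k) :=
    continuous_const.mul (Complex.continuous_conj.comp ((continuous_apply k).comp continuous_snd))
  exact HasTrace.induction (p := fun v c => energyForm (annularConductivity α R) E v =
    2 * Real.pi * (dnEigen α R k : ℂ) * (starRingEnd ℂ) (c k)) (isClosed_eq c1 c2)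
    (fun v hv => energyForm_transmissionField hα hR0 hR1 hκ hk h3 hv) hv

/-! ### The Dirichlet-to-Neumann map of an annular conductivity -/

theorem fourierWeight_half_sq (k : ℤ) :
    fourierWeight (1 / 2) k ^ 2 = if k = 0 then 1 else |(k : ℝ)| := by
  unfold fourierWeight
  split_ifs with h
  · exact one_pow 2
  · rw [← Real.rpow_natCast, ← Real.rpow_mul (abs_nonneg _)]
    norm_num

theorem fourierWeight_neg_half_sq (k : ℤ) :
    fourierWeight (-(1 / 2)) k ^ 2 = if k = 0 then 1 else |(k : ℝ)|⁻¹ := by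
  unfold fourierWeight
  split_ifs with h
  · exact one_pow 2
  · rw [← Real.rpow_natCast, ← Real.rpow_mul (abs_nonneg _), ← Real.rpow_neg_one]
    norm_num

theorem abs_le_fourierWeight_half_sq (k : ℤ) : |(k : ℝ)| ≤ fourierWeight (1 / 2) k ^ 2 := by
  rw [fourierWeight_half_sq]
  split_ifs with h
  · simp [h]
  · exact le_rfl

theorem CircleSobolev.ext {s : ℝ} {a b : CircleSobolev s}
    (h : ∀ k, circleCoeff a k = circleCoeff b k) : a = b :=
  Subtype.ext (funext h)

/-- Distributions on the circle with prescribed Fourier coefficients. -/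
def CircleSobolev.mk {s : ℝ} (c : ℤ → ℂ)
    (h : Summable fun k => fourierWeight s k ^ 2 * ‖c k‖ ^ 2) : CircleSobolev s :=
  ⟨c, (memℓp_gen_iff (by norm_num)).2 (h.congr fun k => by
    simp [mul_pow])⟩

/-- The squared weights differ by the factor `|k|²` for `k ≠ 0`, which a symbol of size `C|k|` uses
up. At `k = 0` the hypothesis forces the symbol to vanish. -/
theorem multiplier_bound {lam : ℤ → ℝ} {C : ℝ} (h : ∀ k : ℤ, |lam k| ≤ C * |(k : ℝ)|) (k : ℤ)
    (z : ℂ) : fourierWeight (-(1 / 2)) k ^ 2 * ‖(lam k : ℂ) * z‖ ^ 2 ≤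
      C ^ 2 * (fourierWeight (1 / 2) k ^ 2 * ‖z‖ ^ 2) := by
  rw [fourierWeight_half_sq, fourierWeight_neg_half_sq, norm_mul, Complex.norm_real,
    Real.norm_eq_abs, mul_pow]
  have h1 : |lam k| ^ 2 ≤ C ^ 2 * |(k : ℝ)| ^ 2 := by
    rw [← mul_pow]
    exact pow_le_pow_left₀ (abs_nonneg _) (h k) 2
  split_ifs with hk
  · subst hk
    simp only [Int.cast_zero, abs_zero] at h1
    have : |lam 0| ^ 2 = 0 := le_antisymm (by linarith) (sq_nonneg _)
    rw [this]
    simp only [zero_mul, mul_zero]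
    positivity
  · have hk0 : 0 < |(k : ℝ)| := abs_pos.2 (Int.cast_ne_zero.2 hk)
    calc |(k : ℝ)|⁻¹ * (|lam k| ^ 2 * ‖z‖ ^ 2)
        ≤ |(k : ℝ)|⁻¹ * (C ^ 2 * |(k : ℝ)| ^ 2 * ‖z‖ ^ 2) := by gcongr
      _ = C ^ 2 * (|(k : ℝ)| * ‖z‖ ^ 2) := by field_simp

theorem summable_multiplier {lam : ℤ → ℝ} {C : ℝ} (h : ∀ k : ℤ, |lam k| ≤ C * |(k : ℝ)|)
    (φ : CircleSobolev (1 / 2)) :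
    Summable fun k => fourierWeight (-(1 / 2)) k ^ 2 * ‖(lam k : ℂ) * circleCoeff φ k‖ ^ 2 :=
  .of_nonneg_of_le (fun k => by positivity) (fun k => multiplier_bound h k (circleCoeff φ k))
    ((circleSobolev_norm_sq φ).summable.mul_left _)

/-- The Fourier multiplier of order one with symbol `lam`, as a linear map. -/
noncomputable def circleMultiplierLin (lam : ℤ → ℝ) (C : ℝ)
    (h : ∀ k : ℤ, |lam k| ≤ C * |(k : ℝ)|) :
    CircleSobolev (1 / 2) →ₗ[ℂ] CircleSobolev (-(1 / 2)) where
  toFun φ := CircleSobolev.mk (fun k => (lam k : ℂ) * circleCoeff φ k) (summable_multiplier h φ)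
  map_add' _ _ := CircleSobolev.ext fun _ => mul_add _ _ _
  map_smul' _ _ := CircleSobolev.ext fun _ => mul_left_comm _ _ _

theorem norm_circleMultiplierLin_le {lam : ℤ → ℝ} {C : ℝ} (hC : 0 ≤ C)
    (h : ∀ k : ℤ, |lam k| ≤ C * |(k : ℝ)|) (φ : CircleSobolev (1 / 2)) :
    ‖circleMultiplierLin lam C h φ‖ ≤ C * ‖φ‖ := by
  have h1 := circleSobolev_norm_sq (circleMultiplierLin lam C h φ)
  have h2 := (circleSobolev_norm_sq φ).mul_left (C ^ 2)
  have h3 : ‖circleMultiplierLin lam C h φ‖ ^ 2 ≤ C ^ 2 * ‖φ‖ ^ 2 :=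
    hasSum_le (fun k => multiplier_bound h k (circleCoeff φ k)) h1 h2
  rw [← mul_pow] at h3
  exact (abs_le_of_sq_le_sq' h3 (by positivity)).2

/-- The Fourier multiplier of order one with symbol `lam`. -/
noncomputable def circleMultiplier (lam : ℤ → ℝ) (C : ℝ) (hC : 0 ≤ C)
    (h : ∀ k : ℤ, |lam k| ≤ C * |(k : ℝ)|) :
    CircleSobolev (1 / 2) →L[ℂ] CircleSobolev (-(1 / 2)) :=
  (circleMultiplierLin lam C h).mkContinuous C (norm_circleMultiplierLin_le hC h)

/-- The energy form as a functional of its first argument. -/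
noncomputable def energyFormL {α : ℝ} (hα : 0 ≤ α) (R : ℝ) (v : sobolevH1 unitDisc) :
    sobolevH1 unitDisc →L[ℂ] ℂ :=
  (innerSL ℂ (sobolevGrad v)).comp ((annularMul hα R _).comp (sobolevGradL unitDisc))

theorem energyFormL_apply {α : ℝ} (hα : 0 ≤ α) (R : ℝ) (u v : sobolevH1 unitDisc) :
    energyFormL hα R v u = energyForm (annularConductivity α R) u v :=
  (energyForm_annular hα R u v).symm

theorem hasSum_smul_single (c : ℤ → ℂ) :
    HasSum (fun k => c k • (Pi.single k 1 : ℤ → ℂ)) c := by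
  rw [Pi.hasSum]
  intro j
  have h := hasSum_single (f := fun k => (c k • (Pi.single k 1 : ℤ → ℂ)) j) j fun k hk => by
    simp [Pi.single_eq_of_ne hk.symm]
  simpa using h

theorem sum_smul_single_apply (c : ℤ → ℂ) {t : Finset ℤ} {j : ℤ} (hj : j ∈ t) :
    (∑ k ∈ t, c k • (Pi.single k 1 : ℤ → ℂ)) j = c j := by
  rw [Finset.sum_apply, Finset.sum_eq_single_of_mem j hj fun k _ hk => by
    simp [Pi.single_eq_of_ne hk.symm]]
  simp

/-! ### Superposition of single-mode solutions -/

section Modes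

variable {α R C D : ℝ} {E : ℤ → sobolevH1 unitDisc} {lam : ℤ → ℝ}

/-- The energy form is diagonal on the modes, because the energy of `E k` against `v` sees only the
`k`-th coefficient of the trace of `v`. Since the weight is at least `1`, this energy controls the
Dirichlet integral. -/
theorem norm_sq_grad_sum_le (hα : 0 ≤ α) (hC : ∀ k : ℤ, |lam k| ≤ C * |(k : ℝ)|) (hC0 : 0 ≤ C)
    (ht : ∀ k, HasTrace (E k) (Pi.single k 1))
    (hg : ∀ k v c, HasTrace v c → energyForm (annularConductivity α R) (E k) v =
      2 * Real.pi * lam k * (starRingEnd ℂ) (c k)) (φ : ℤ → ℂ) (s : Finset ℤ) :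
    ‖sobolevGrad (∑ k ∈ s, φ k • E k)‖ ^ 2 ≤
      ∑ k ∈ s, 2 * Real.pi * C * (fourierWeight (1 / 2) k ^ 2 * ‖φ k‖ ^ 2) := by
  set T := ∑ k ∈ s, φ k • E k with hT
  have hTt : HasTrace T (∑ k ∈ s, φ k • (Pi.single k 1 : ℤ → ℂ)) :=
    HasTrace.sum s fun k => (ht k).smul (φ k)
  have h1 := norm_sq_le_re_inner_annularMul hα R (sobolevGrad T)
  rw [← energyForm_annular hα R, ← energyFormL_apply hα] at h1
  have h2 : energyFormL hα R T T =
      ((∑ k ∈ s, 2 * Real.pi * lam k * ‖φ k‖ ^ 2 : ℝ) : ℂ) := by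
    conv_lhs => arg 2; rw [hT]
    rw [map_sum]
    push_cast
    refine Finset.sum_congr rfl fun k hk => ?_
    rw [map_smul, energyFormL_apply, hg k T _ hTt, sum_smul_single_apply φ hk, smul_eq_mul,
      ← Complex.mul_conj']
    ring
  rw [h2, Complex.ofReal_re] at h1
  refine h1.trans (Finset.sum_le_sum fun k _ => ?_)
  have h3 : lam k ≤ C * fourierWeight (1 / 2) k ^ 2 :=
    (le_abs_self _).trans ((hC k).trans
      (mul_le_mul_of_nonneg_left (abs_le_fourierWeight_half_sq k) hC0))
  have h4 : 0 ≤ 2 * Real.pi * ‖φ k‖ ^ 2 := by positivity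
  nlinarith [mul_le_mul_of_nonneg_left h3 h4]

/-- No orthogonality in `L²` is needed: splitting off the weight `|k|^{1/2}`, the product is at most
the sum of a term of the `H^{1/2}` norm and one of order `D / k²`. -/
theorem summable_norm_fun (hD : ∀ k : ℤ, ‖sobolevFun (E k)‖ ^ 2 ≤ D / (k.natAbs + 1))
    (φ : CircleSobolev (1 / 2)) : Summable fun k => ‖circleCoeff φ k‖ * ‖sobolevFun (E k)‖ := by
  have hs2 : Summable fun k : ℤ => ‖sobolevFun (E k)‖ ^ 2 / fourierWeight (1 / 2) k ^ 2 := by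
    refine Summable.of_norm_bounded_eventually
      ((Real.summable_one_div_int_pow.2 one_lt_two).mul_left D) ?_
    filter_upwards [(Set.finite_singleton (0 : ℤ)).compl_mem_cofinite] with k hk
    have hk0 : k ≠ 0 := hk
    have hka : 0 < |(k : ℝ)| := abs_pos.2 (Int.cast_ne_zero.2 hk0)
    -- The sign of `D` is read off from the zero mode.
    have hD0 : 0 ≤ D := by
      have := (sq_nonneg _).trans (hD 0)
      simpa using this
    rw [Real.norm_of_nonneg (by positivity), fourierWeight_half_sq, if_neg hk0]
    have hn : ((k.natAbs : ℕ) : ℝ) = |(k : ℝ)| := by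
      rw [Nat.cast_natAbs, Int.cast_abs]
    calc ‖sobolevFun (E k)‖ ^ 2 / |(k : ℝ)| ≤ D / (k.natAbs + 1) / |(k : ℝ)| := by
          gcongr
          exact hD k
      _ ≤ D / |(k : ℝ)| / |(k : ℝ)| := by
          rw [hn]
          gcongr
          linarith
      _ = D * (1 / (k : ℝ) ^ 2) := by
          rw [← sq_abs (k : ℝ)]
          field_simp
  refine .of_nonneg_of_le (fun k => by positivity) (fun k => ?_)
    ((circleSobolev_norm_sq φ).summable.add hs2)
  have hw := fourierWeight_pos (1 / 2) k
  set a := fourierWeight (1 / 2) k * ‖circleCoeff φ k‖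
  set b := ‖sobolevFun (E k)‖ / fourierWeight (1 / 2) k
  have e : ‖circleCoeff φ k‖ * ‖sobolevFun (E k)‖ = a * b := by
    simp only [a, b]
    field_simp
  rw [e, ← mul_pow, ← div_pow]
  change a * b ≤ a ^ 2 + b ^ 2
  nlinarith [sq_nonneg (a - b), sq_nonneg a, sq_nonneg b]

/-- Cauchy criterion in `H¹`: the function parts are absolutely summable, whereas the gradients are
controlled only through the diagonal energy of finite sums. -/
theorem summable_modes (hα : 0 ≤ α) (hC : ∀ k : ℤ, |lam k| ≤ C * |(k : ℝ)|) (hC0 : 0 ≤ C)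
    (ht : ∀ k, HasTrace (E k) (Pi.single k 1))
    (hD : ∀ k : ℤ, ‖sobolevFun (E k)‖ ^ 2 ≤ D / (k.natAbs + 1))
    (hg : ∀ k v c, HasTrace v c → energyForm (annularConductivity α R) (E k) v =
      2 * Real.pi * lam k * (starRingEnd ℂ) (c k)) (φ : CircleSobolev (1 / 2)) :
    Summable fun k => circleCoeff φ k • E k := by
  rw [summable_iff_vanishing_norm]
  intro ε hε
  obtain ⟨s₁, h₁⟩ := summable_iff_vanishing_norm.1 (summable_norm_fun hD φ) (ε / 2) (by positivity)
  obtain ⟨s₂, h₂⟩ := summable_iff_vanishing_norm.1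
    ((circleSobolev_norm_sq φ).summable.mul_left (2 * Real.pi * C)) ((ε / 2) ^ 2) (by positivity)
  refine ⟨s₁ ∪ s₂, fun t htd => ?_⟩
  rw [Finset.disjoint_union_right] at htd
  have k₁ := h₁ t htd.1
  have k₂ := h₂ t htd.2
  rw [Real.norm_of_nonneg (Finset.sum_nonneg fun k _ => by positivity)] at k₁ k₂
  have k₃ := norm_sq_grad_sum_le hα hC hC0 ht hg (circleCoeff φ) t
  have k₄ : ‖sobolevGrad (∑ k ∈ t, circleCoeff φ k • E k)‖ < ε / 2 :=
    lt_of_pow_lt_pow_left₀ 2 (by positivity) (k₃.trans_lt k₂)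
  have k₅ : ‖sobolevFun (∑ k ∈ t, circleCoeff φ k • E k)‖ < ε / 2 := by
    refine lt_of_le_of_lt ?_ k₁
    rw [← sobolevFunL_apply, map_sum]
    refine (norm_sum_le _ _).trans (le_of_eq (Finset.sum_congr rfl fun k _ => ?_))
    rw [map_smul, norm_smul]
    rfl
  exact (sobolevH1_norm_le _).trans_lt (by linarith)

/-- A family of solutions with single-mode boundary values diagonalises the Dirichlet-to-Neumann
map. -/
theorem isDirichletToNeumann_of_modes (hα : 0 ≤ α) (hC0 : 0 ≤ C)
    (hC : ∀ k : ℤ, |lam k| ≤ C * |(k : ℝ)|)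
    (ht : ∀ k, HasTrace (E k) (Pi.single k 1))
    (hD : ∀ k : ℤ, ‖sobolevFun (E k)‖ ^ 2 ≤ D / (k.natAbs + 1))
    (hg : ∀ k v c, HasTrace v c → energyForm (annularConductivity α R) (E k) v =
      2 * Real.pi * lam k * (starRingEnd ℂ) (c k)) :
    IsDirichletToNeumann (annularConductivity α R) (circleMultiplier lam C hC0 hC) := by
  intro φ
  obtain ⟨u, hu⟩ := summable_modes hα hC hC0 ht hD hg φ
  -- This identity for the superposition serves twice: as the Dirichlet-to-Neumann pairing, and with
  -- zero trace as the weak equation.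
  have hgreen : ∀ v c, HasTrace v c → HasSum (fun k : ℤ => 2 * (Real.pi : ℂ) *
      (lam k * circleCoeff φ k * (starRingEnd ℂ) (c k)))
      (energyForm (annularConductivity α R) u v) := by
    intro v c hv
    have h := (energyFormL hα R v).hasSum hu
    rw [energyFormL_apply] at h
    refine h.congr_fun fun k => ?_
    rw [map_smul, energyFormL_apply, hg k v c hv, smul_eq_mul]
    ring
  refine ⟨u, ⟨?_, fun v => ?_⟩, fun ψ v hv => hgreen v _ hv⟩
  · exact HasTrace.of_tendsto (fun s : Finset ℤ => HasTrace.sum s fun k => (ht k).smul _) hu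
      (hasSum_smul_single (circleCoeff φ))
  · have h := hgreen v 0 (hasTrace_zero_of_mem_sobolevH10 v.2)
    refine h.unique ?_
    simp only [Pi.zero_apply, map_zero, mul_zero]
    exact hasSum_zero

end Modes

theorem abs_dnEigen_le {α R : ℝ} (hα : 0 ≤ α) (hR0 : 0 < R) (hR1 : R < 1) (k : ℤ) :
    |dnEigen α R k| ≤ (1 + α * (2 + α)) * |(k : ℝ)| := by
  have ht0 : 0 < R ^ (2 * k.natAbs) := pow_pos hR0 _
  have ht1 : R ^ (2 * k.natAbs) ≤ 1 := pow_le_one₀ hR0.le hR1.le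
  have hN := two_le_transmissionDenom hα ht1
  have hn : ((k.natAbs : ℕ) : ℝ) = |(k : ℝ)| := by
    rw [Nat.cast_natAbs, Int.cast_abs]
  rw [dnEigen, hn]
  generalize R ^ (2 * k.natAbs) = t at *
  have h0 : 0 ≤ t * (1 - t) := mul_nonneg ht0.le (by linarith)
  have h1 : α * (2 + α) * (t * (1 - t)) / transmissionDenom α t ≤ α * (2 + α) := by
    rw [div_le_iff₀ (by linarith)]
    refine mul_le_mul_of_nonneg_left ?_ (by positivity)
    nlinarith
  rw [abs_of_nonneg (by positivity), mul_comm]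
  gcongr

/-- The Dirichlet-to-Neumann map of the annular conductivity. -/
noncomputable def annularDN {α R : ℝ} (hα : 0 ≤ α) (hR0 : 0 < R) (hR1 : R < 1) :
    CircleSobolev (1 / 2) →L[ℂ] CircleSobolev (-(1 / 2)) :=
  circleMultiplier (dnEigen α R) (1 + α * (2 + α)) (by positivity) (abs_dnEigen_le hα hR0 hR1)

theorem isDirichletToNeumann_annularDN {α R : ℝ} (hα : 0 ≤ α) (hR0 : 0 < R) (hR1 : R < 1) :
    IsDirichletToNeumann (annularConductivity α R) (annularDN hα hR0 hR1) := by
  choose E h1 h2 h3 using exists_dnMode hα hR0 hR1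
  exact isDirichletToNeumann_of_modes (D := (2 * (1 + α) ^ 2) ^ 2 * Real.pi) hα _ _ h1
    (fun k => (h2 k).trans_eq (mul_div_assoc _ _ _).symm) h3

/-! ### Discontinuity of the Dirichlet-to-Neumann map -/

/-- Test on `e^{ikθ}`, whose squared `H^{1/2}` norm is `|k|`; its image has squared `H^{-1/2}` norm
`|lam k - mu k|² / |k|`. -/
theorem le_norm_circleMultiplier_sub {lam mu : ℤ → ℝ} {C C' : ℝ} {hC : 0 ≤ C} {hC' : 0 ≤ C'}
    {h : ∀ k : ℤ, |lam k| ≤ C * |(k : ℝ)|} {h' : ∀ k : ℤ, |mu k| ≤ C' * |(k : ℝ)|} {k : ℤ}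
    (hk : k ≠ 0) :
    |lam k - mu k| / |(k : ℝ)| ≤ ‖circleMultiplier lam C hC h - circleMultiplier mu C' hC' h'‖ := by
  set A := circleMultiplier lam C hC h - circleMultiplier mu C' hC' h' with hA
  have hk0 : 0 < |(k : ℝ)| := abs_pos.2 (Int.cast_ne_zero.2 hk)
  have hs : ∀ {s : ℝ} (b : CircleSobolev s), (∀ j, j ≠ k → circleCoeff b j = 0) →
      ‖b‖ ^ 2 = fourierWeight s k ^ 2 * ‖circleCoeff b k‖ ^ 2 := by
    intro s b hb
    refine (circleSobolev_norm_sq b).unique (hasSum_single k fun j hj => ?_)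
    rw [hb j hj]
    simp
  set e : CircleSobolev (1 / 2) := CircleSobolev.mk (Pi.single k 1)
    (summable_of_ne_finset_zero (s := {k}) fun j hj => by
      rw [Pi.single_eq_of_ne (by simpa using hj)]
      simp) with he
  have hek : circleCoeff e k = 1 := Pi.single_eq_same (M := fun _ => ℂ) k 1
  have hej : ∀ j, j ≠ k → circleCoeff e j = 0 := fun j hj =>
    Pi.single_eq_of_ne (M := fun _ => ℂ) hj 1
  have hAe : ∀ j, circleCoeff (A e) j = ((lam j - mu j : ℝ) : ℂ) * circleCoeff e j := by
    intro j
    have : circleCoeff (A e) j = lam j * circleCoeff e j - mu j * circleCoeff e j := rfl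
    rw [this]
    push_cast
    ring
  have n1 : ‖e‖ ^ 2 = |(k : ℝ)| := by
    rw [hs e hej, hek, fourierWeight_half_sq, if_neg hk]
    simp
  have n2 : ‖A e‖ ^ 2 = |(k : ℝ)|⁻¹ * |lam k - mu k| ^ 2 := by
    rw [hs (A e) fun j hj => by rw [hAe, hej j hj, mul_zero], hAe, hek, mul_one,
      fourierWeight_neg_half_sq, if_neg hk, Complex.norm_real, Real.norm_eq_abs]
  have n3 := pow_le_pow_left₀ (norm_nonneg _) (A.le_opNorm e) 2
  rw [mul_pow, n1, n2] at n3
  refine (abs_le_of_sq_le_sq' ?_ (norm_nonneg _)).2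
  rw [div_pow, div_le_iff₀ (by positivity)]
  calc |lam k - mu k| ^ 2 = |(k : ℝ)| * (|(k : ℝ)|⁻¹ * |lam k - mu k| ^ 2) := by field_simp
    _ ≤ |(k : ℝ)| * (‖A‖ ^ 2 * |(k : ℝ)|) := by gcongr
    _ = ‖A‖ ^ 2 * |(k : ℝ)| ^ 2 := by ring

theorem dnEigen_zero (R : ℝ) (k : ℤ) : dnEigen 0 R k = k.natAbs := by
  simp [dnEigen]

/-- At `t = 1/2` the factor `t(1-t)` takes its maximum `1/4`, and the relative deviation no longer
depends on `n`. -/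
theorem dnEigen_of_pow_eq_half {α R : ℝ} {n : ℕ} (h : R ^ (2 * n) = 1 / 2) :
    dnEigen α R n = n * (1 + α * (2 + α) / (4 * transmissionDenom α (1 / 2))) := by
  rw [dnEigen, Int.natAbs_natCast, h, mul_div_mul_comm, div_eq_mul_inv]
  congr 2
  ring

/-- After cross-multiplication this is `N(1/2) < 4(2+α)²`, where `N(1/2) = 2 + 7α/4 + α²/8`; the
constant in the theorem is far from sharp. -/
theorem lt_of_transmissionDenom_half {α : ℝ} (hα : 0 < α) :
    α / (16 * (2 + α)) < α * (2 + α) / (4 * transmissionDenom α (1 / 2)) := by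
  have hN := two_le_transmissionDenom hα.le (t := 1 / 2) (by norm_num)
  rw [div_lt_div_iff₀ (by positivity) (by positivity), mul_assoc]
  refine mul_lt_mul_of_pos_left ?_ hα
  unfold transmissionDenom
  nlinarith

/-! ### Ellipticity, the boundary layer and the resonant radii -/

theorem isElliptic_annular {α : ℝ} (hα : 0 ≤ α) (R : ℝ) (Ω : Set Plane) :
    IsElliptic (1 + α) Ω (annularConductivity α R) where
  memLp_top i j := by
    simp only [annularConductivity_eq, Matrix.smul_apply, smul_eq_mul]
    refine memLp_top_of_bound
      ((measurable_annularWeight α R).mul_const _).aestronglyMeasurable (1 + α)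
      (Eventually.of_forall fun x => ?_)
    have h1 := one_le_annularWeight hα R x
    have h2 := annularWeight_le hα R x
    rw [Real.norm_eq_abs, abs_mul, abs_of_nonneg (by linarith), Matrix.one_apply]
    split_ifs <;> simp <;> linarith
  bounds := Eventually.of_forall fun x ξ => by
    have h1 := one_le_annularWeight hα R x
    have h2 := annularWeight_le hα R x
    have h3 : (1 + α)⁻¹ ≤ 1 := inv_le_one_of_one_le₀ (by linarith)
    have h0 : 0 ≤ ξ ⬝ᵥ ξ := by
      rw [dotProduct]
      exact Finset.sum_nonneg fun i _ => mul_self_nonneg _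
    rw [annularConductivity_eq, Matrix.smul_mulVec, Matrix.one_mulVec, smul_dotProduct,
      smul_eq_mul]
    exact ⟨mul_le_mul_of_nonneg_right (h3.trans h1) h0, mul_le_mul_of_nonneg_right h2 h0⟩

/-- The distance to the unit circle is at least `1 - |x|`, so the layer of width `1 - R` lies in
`|x| ≥ R`, outside the annulus. -/
theorem annularConductivity_eq_one_of_mem_boundaryLayer (α R : ℝ) {x : Plane}
    (hx : x ∈ boundaryLayer unitDisc (1 - R)) : annularConductivity α R x = 1 := by
  have h1 : 1 - ‖x‖ ≤ Metric.infDist x (frontier unitDisc) := by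
    rw [frontier_ball 0 one_ne_zero]
    refine (Metric.le_infDist (NormedSpace.sphere_nonempty.2 zero_le_one)).2 fun y hy => ?_
    rw [mem_sphere_zero_iff_norm] at hy
    rw [dist_comm, dist_eq_norm, ← hy]
    exact norm_sub_norm_le y x
  have h2 : ¬ ‖x‖ < R := by linarith [hx.2]
  rw [annularConductivity_eq, annularWeight, if_neg fun h => h2 (mem_ball_zero_iff.1 h.1),
    one_smul]

/-- The radius with `R ^ (2 * (n + 1)) = 1 / 2`. -/
noncomputable def resonantRadius (n : ℕ) : ℝ := (1 / 2 : ℝ) ^ (1 / (2 * ((n : ℝ) + 1)))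

theorem resonantRadius_pos (n : ℕ) : 0 < resonantRadius n := Real.rpow_pos_of_pos (by norm_num) _

theorem resonantRadius_lt_one (n : ℕ) : resonantRadius n < 1 :=
  Real.rpow_lt_one (by norm_num) (by norm_num) (by positivity)

theorem resonantRadius_pow (n : ℕ) : resonantRadius n ^ (2 * (n + 1)) = 1 / 2 := by
  rw [resonantRadius, ← Real.rpow_natCast, ← Real.rpow_mul (by norm_num)]
  push_cast
  rw [one_div_mul_cancel (by positivity), Real.rpow_one]

theorem tendsto_resonantRadius : Tendsto resonantRadius atTop (𝓝 1) := by
  have h1 : Tendsto (fun n : ℕ => 1 / (2 * ((n : ℝ) + 1))) atTop (𝓝 0) := by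
    have h := (tendsto_one_div_add_atTop_nhds_zero_nat (𝕜 := ℝ)).const_mul (1 / 2)
    rw [mul_zero] at h
    refine h.congr fun n => ?_
    field_simp
  have h2 := (Real.continuousAt_const_rpow (a := 1 / 2) (b := 0) (by norm_num)).tendsto.comp h1
  rwa [Real.rpow_zero] at h2

theorem le_norm_annularDN_sub {α : ℝ} (hα : 0 ≤ α) (n : ℕ) {R : ℝ} (hR0 : 0 < R) (hR1 : R < 1) :
    α * (2 + α) / (4 * transmissionDenom α (1 / 2)) ≤
      ‖annularDN hα (resonantRadius_pos n) (resonantRadius_lt_one n) -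
        annularDN le_rfl hR0 hR1‖ := by
  -- The test frequency is `n + 1`, matched to `resonantRadius n` and never zero.
  have hk : ((n + 1 : ℕ) : ℤ) ≠ 0 := by positivity
  refine le_trans (le_of_eq ?_) (le_norm_circleMultiplier_sub hk)
  have hN := two_le_transmissionDenom hα (t := 1 / 2) (by norm_num)
  have hn : (0 : ℝ) < ((n + 1 : ℕ) : ℝ) := by positivity
  rw [dnEigen_zero, dnEigen_of_pow_eq_half (resonantRadius_pow n), Int.natAbs_natCast,
    Int.cast_natCast, abs_of_pos hn, mul_one_add, add_sub_cancel_left,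
    abs_of_nonneg (by positivity), mul_div_cancel_left₀ _ hn.ne']

theorem theorem4p9 (α : ℝ) (hα : 0 < α) :
    ∃ (σ : ℕ → Conductivity) (δ R : ℕ → ℝ)
      (Λ : ℕ → CircleSobolev (1 / 2) →L[ℂ] CircleSobolev (-(1 / 2)))
      (ΛI : CircleSobolev (1 / 2) →L[ℂ] CircleSobolev (-(1 / 2))),
      (∀ n, 0 < R n ∧ R n < 1) ∧ Tendsto R atTop (𝓝 1) ∧
      (∀ n, σ n = annularConductivity α (R n)) ∧
      (∀ n, IsElliptic (1 + α) unitDisc (σ n)) ∧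
      (∀ n, 0 < δ n) ∧ Tendsto δ atTop (𝓝 0) ∧
      (∀ n, ∀ x ∈ boundaryLayer unitDisc (δ n), σ n x = 1) ∧
      GConverges (1 + α) unitDisc σ (fun _ => 1) ∧
      (∀ n, IsDirichletToNeumann (σ n) (Λ n)) ∧
      IsDirichletToNeumann (fun _ => 1) ΛI ∧
      ENNReal.ofReal (α / (16 * (2 + α))) < limsup (fun n => ‖Λ n - ΛI‖ₑ) atTop := by
  -- `Λ_I` is taken as the annular map with `α = 0`. The radius is then immaterial, and `1/2` is
  -- merely an admissible value.
  have h0 : (0 : ℝ) < 1 / 2 := by norm_num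
  have h1 : (1 / 2 : ℝ) < 1 := by norm_num
  refine ⟨fun n => annularConductivity α (resonantRadius n), fun n => 1 - resonantRadius n,
    resonantRadius, fun n => annularDN hα.le (resonantRadius_pos n) (resonantRadius_lt_one n),
    annularDN le_rfl h0 h1, fun n => ⟨resonantRadius_pos n, resonantRadius_lt_one n⟩,
    tendsto_resonantRadius, fun _ => rfl, fun n => isElliptic_annular hα.le _ _,
    fun n => sub_pos.2 (resonantRadius_lt_one n), ?_,
    fun n x hx => annularConductivity_eq_one_of_mem_boundaryLayer α _ hx,
    gConverges_annular hα.le tendsto_resonantRadius,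
    fun n => isDirichletToNeumann_annularDN hα.le _ _, ?_, ?_⟩
  · simpa using tendsto_resonantRadius.const_sub 1
  · have h := isDirichletToNeumann_annularDN le_rfl h0 h1
    rwa [annularConductivity_zero] at h
  · have hlt := lt_of_transmissionDenom_half hα
    -- The lower bound is uniform in `n`, so it passes to the limsup. Taken in `ℝ≥0∞`, the limsup
    -- requires no upper bound on the norms.
    have hle : ∀ n, ENNReal.ofReal (α * (2 + α) / (4 * transmissionDenom α (1 / 2))) ≤
        ‖annularDN hα.le (resonantRadius_pos n) (resonantRadius_lt_one n) -
          annularDN le_rfl h0 h1‖ₑ := fun n => by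
      rw [← ofReal_norm]
      exact ENNReal.ofReal_le_ofReal (le_norm_annularDN_sub hα.le n h0 h1)
    calc ENNReal.ofReal (α / (16 * (2 + α)))
        < ENNReal.ofReal (α * (2 + α) / (4 * transmissionDenom α (1 / 2))) :=
          (ENNReal.ofReal_lt_ofReal_iff (lt_of_le_of_lt (by positivity) hlt)).2 hlt
      _ = limsup (fun _ : ℕ =>
          ENNReal.ofReal (α * (2 + α) / (4 * transmissionDenom α (1 / 2)))) atTop :=
          limsup_const _ |>.symm
      _ ≤ _ := limsup_le_limsup (Eventually.of_forall hle)
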